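/- Let $\mathbb T=\mathbb R/2\pi\mathbb Z$, $\langle x\rangle=\sqrt{1+|x|^2}$, and let $\langle\partial_x^2\rangle=(1+\partial_x^4)^{1/2}$ be the Fourier multiplier with symbol $\sqrt{1+k^4}$. For $\tau>0$ let $\Pi_\tau$ be the Fourier multiplier with symbol $\mathbf 1_{[-1,1]}(k\tau^{1/2})$. For $s,b\in\mathbb R$ the Bourgain space $X^{s,b}$ on $\mathbb R\times\mathbb T$ has the norm $$\|v\|_{X^{s,b}}=\big\|\langle k\rangle^s\langle\sigma-\sqrt{k^4+1}\rangle^b\,\widehat v(\sigma,k)\big\|_{\ell^2_kL^2_\sigma},$$ where $\widehat v$ is the space-time Fourier transform, and $\|u\|_{X^{s,b}(T)}=\inf\{\|v\|_{X^{s,b}}: v|_{[0,T]}=u\}$. Consider, on $\mathbb T$, the reformulated "good" Boussinesq equation $$\partial_tu=i\langle\partial_x^2\rangle u-\tfrac i4\langle\partial_x^2\rangle^{-1}\big[2(u+\overline u)+\partial_x^2(u+\overline u)^2\big],\qquad u(0)=u_0,\tag{1}$$ and its projected version $$\partial_tu_\tau=i\langle\partial_x^2\rangle u_\tau-\tfrac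 i4\langle\partial_x^2\rangle^{-1}\Pi_\tau\big[2(u_\tau+\overline{u}_\tau)+\partial_x^2(\Pi_\tau u_\tau+\Pi_\tau\overline{u}_\tau)^2\big],\qquad u_\tau(0)=\Pi_\tau u_0,\tag{2}$$ both understood in the mild (Duhamel) sense. Proposition. Let $b\in(1/2,1)$, $s\ge 0$ and $u_0\in H^s(\mathbb T)$, and let $T_s$ be the maximal existence time of (1), i.e. the supremum of the $T>0$ such that (1) has a solution in $X^{s,b}(T)$ on $[0,T]$. Then $X^{s,b}(T)\subset C([0,T],H^s)$ for every $T>0$, and for every $0<T<T_s$ equation (1) has a unique solution $u\in X^{s,b}(T)$ on $[0,T]$, and there are $\tau_0>0$ and $C_T>0$ such that for all $0<\tau\le\tau_0$ equation (2) has a unique solution $u_\tau\in X^{s,b}(T)$ on $[0,T]$, and $$\|u-u_\tau\|_{L^\infty([0,T],L^2)}\le K\,\|u-u_\tau\|_{X^{0,b}(T)},\qquad \|u-u_\tau\|_{X^{0,b}(T)}\le C_T\,\tau^{s/2},$$ where $K$ depends only on $b$ (not on $s,u_0,T,\tau$), and $\tau_0,C_T$ do not depend on $\tau$. -/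

import Mathlib

open MeasureTheory Set Filter Topology
open scoped ENNReal

noncomputable section

namespace GoodBoussinesq

instance fact_two_pi_pos : Fact (0 < 2 * Real.pi) := ⟨Real.two_pi_pos⟩

/-- The torus `𝕋 = ℝ / 2πℤ`. -/
abbrev Torus : Type := AddCircle (2 * Real.pi)

/-- `L²(𝕋; ℂ)`, with respect to the normalized measure `dx / (2π)`. For `f : L2`,
`fourierCoeff f k = (1 / 2π) ∫ f(x) e^{-ikx} dx`. -/
abbrev L2 : Type := Lp ℂ 2 (AddCircle.haarAddCircle : Measure Torus)

/-- The Japanese bracket `⟨x⟩ = √(1 + |x|²)`. -/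
def bracket (x : ℝ) : ℝ := Real.sqrt (1 + x ^ 2)

/-- The symbol `⟨k²⟩ = √(1 + k⁴)` of the operator `⟨∂ₓ²⟩`. -/
def omega (k : ℤ) : ℝ := Real.sqrt (1 + (k : ℝ) ^ 4)

/-! ### Sobolev spaces on the torus (of nonnegative order) -/

/-- The `H^s` norm `‖⟨k⟩^s f̂(k)‖_{ℓ²}`, with the value `∞` if `f ∉ H^s`. -/
def sobolevENorm (s : ℝ) (f : L2) : ℝ≥0∞ :=
  eLpNorm (fun k : ℤ => ((bracket k ^ s : ℝ) : ℂ) * fourierCoeff f k) 2 Measure.count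

/-- `f ∈ H^s`. -/
def MemSobolev (s : ℝ) (f : L2) : Prop := sobolevENorm s f < ⊤

/-- `u ∈ C([0,T], H^s)`. -/
def ContinuousInSobolev (s T : ℝ) (u : ℝ → L2) : Prop :=
  (∀ t ∈ Icc 0 T, MemSobolev s (u t)) ∧
    ∀ t ∈ Icc 0 T,
      Tendsto (fun r => sobolevENorm s (u r - u t)) (𝓝[Icc 0 T] t) (𝓝 0)

/-! ### Bourgain spaces

For `s ≥ 0` and `b > 1/2` a tempered distribution on `ℝ × 𝕋` with finite `X^{s,b}` norm has a
space-time Fourier transform that is integrable in `σ` for each `k`, and it is represented by a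
unique continuous function of time with values in `L²(𝕋)`, given at every time by the inversion
formula. In this range (the only one used) the elements of `X^{s,b}` are these functions. -/

/-- `a(k, σ)` is the space-time Fourier transform of `v`, through the inversion formula
`v(t, x) = (1 / 2π) ∑ₖ ∫ a(k, σ) e^{iσt + ikx} dσ`. -/
structure IsSpaceTimeFourier (v : ℝ → L2) (a : ℤ × ℝ → ℂ) : Prop where
  aestronglyMeasurable : AEStronglyMeasurable a (Measure.count.prod volume)
  integrable : ∀ k : ℤ, Integrable (fun σ : ℝ => a (k, σ))
  inversion : ∀ (t : ℝ) (k : ℤ), fourierCoeff (v t) k =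
    1 / (2 * Real.pi) * ∫ σ : ℝ, a (k, σ) * Complex.exp (Complex.I * σ * t)

/-- `‖v‖_{X^{s,b}} = ‖⟨k⟩^s ⟨σ - √(k⁴+1)⟩^b v̂(σ, k)‖_{ℓ²_k L²_σ}`, with the value `∞` if
`v ∉ X^{s,b}`. The space-time Fourier transform is unique up to null sets. -/
def bourgainENorm (s b : ℝ) (v : ℝ → L2) : ℝ≥0∞ :=
  ⨅ (a : ℤ × ℝ → ℂ) (_ : IsSpaceTimeFourier v a),
    eLpNorm (fun p : ℤ × ℝ => ((bracket p.1 ^ s * bracket (p.2 - omega p.1) ^ b : ℝ) : ℂ) * a p)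
      2 (Measure.count.prod volume)

/-- The localized norm `‖u‖_{X^{s,b}(T)} = inf {‖v‖_{X^{s,b}} : v = u on [0,T]}`. Only the values
of `u` on `[0,T]` matter. -/
def localBourgainENorm (s b T : ℝ) (u : ℝ → L2) : ℝ≥0∞ :=
  ⨅ (v : ℝ → L2) (_ : EqOn v u (Icc 0 T)), bourgainENorm s b v

/-- `u ∈ X^{s,b}(T)`. -/
def MemLocalBourgain (s b T : ℝ) (u : ℝ → L2) : Prop := localBourgainENorm s b T u < ⊤

/-! ### The frequency projection -/

/-- The symbol `χ(k / τ^{-1/2})` of `Π_τ`, where `χ` is the characteristic function of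
`[-1, 1]`. -/
def cutoff (τ : ℝ) (k : ℤ) : ℂ :=
  (Icc (-1 : ℝ) 1).indicator (fun _ => (1 : ℂ)) ((k : ℝ) / τ ^ (-(1 / 2) : ℝ))

/-- The projection `Π_τ`, for `τ > 0` (the sum is then finite). -/
def proj (τ : ℝ) (f : L2) : L2 :=
  ∑' k : ℤ, (cutoff τ k * fourierCoeff f k) • (fourierLp 2 k : L2)

lemma fourierCoeff_proj {τ : ℝ} (hτ : 0 < τ) (f : L2) (k : ℤ) :
    fourierCoeff (proj τ f) k = cutoff τ k * fourierCoeff f k := by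
  have hM : 0 < τ ^ (-(1 / 2) : ℝ) := Real.rpow_pos_of_pos hτ _
  have hfin : ∀ j ∉ Finset.Icc (-⌈τ ^ (-(1 / 2) : ℝ)⌉) ⌈τ ^ (-(1 / 2) : ℝ)⌉, cutoff τ j = 0 := by
    intro j hj
    refine indicator_of_notMem (fun h => hj ?_) _
    obtain ⟨h1, h2⟩ := h
    rw [le_div_iff₀ hM] at h1
    rw [div_le_iff₀ hM] at h2
    have h3 := Int.le_ceil (τ ^ (-(1 / 2) : ℝ))
    rw [Finset.mem_Icc]
    constructor
    · have : ((-⌈τ ^ (-(1 / 2) : ℝ)⌉ : ℤ) : ℝ) ≤ j := by push_cast; linarith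
      exact_mod_cast this
    · have : (j : ℝ) ≤ (⌈τ ^ (-(1 / 2) : ℝ)⌉ : ℤ) := by linarith
      exact_mod_cast this
  have hsum : proj τ f = ∑ j ∈ Finset.Icc (-⌈τ ^ (-(1 / 2) : ℝ)⌉) ⌈τ ^ (-(1 / 2) : ℝ)⌉,
      (cutoff τ j * fourierCoeff f j) • (fourierLp 2 j : L2) :=
    tsum_eq_sum (fun j hj => by rw [hfin j hj]; simp)
  rw [← fourierBasis_repr, hsum, ← coe_fourierBasis, HilbertBasis.repr_apply_apply, inner_sum]
  simp only [inner_smul_right]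
  have horth := orthonormal_iff_ite.mp
    (fourierBasis : HilbertBasis ℤ ℂ L2).orthonormal
  simp only [horth, mul_ite, mul_one, mul_zero, Finset.sum_ite_eq]
  split_ifs with h
  · rfl
  · rw [hfin k h, zero_mul]

/-! ### The equations -/

/-- The function `f + f̄` on the torus. -/
def addConj (f : L2) (x : Torus) : ℂ := f x + (starRingEnd ℂ) (f x)

/-- The `k`-th Fourier coefficient of `-(i/4) ⟨∂ₓ²⟩⁻¹ [2 (f + f̄) + ∂ₓ² (f + f̄)²]`. -/
def forcing (f : L2) (k : ℤ) : ℂ :=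
  -(Complex.I / 4) * (omega k : ℂ)⁻¹ *
    (2 * fourierCoeff (addConj f) k
      + -(k : ℂ) ^ 2 * fourierCoeff (fun x => addConj f x ^ 2) k)

/-- The `k`-th Fourier coefficient of
`-(i/4) ⟨∂ₓ²⟩⁻¹ Π_τ [2 (f + f̄) + ∂ₓ² (Π_τ f + Π_τ f̄)²]`; note that `Π_τ f̄` is the complex
conjugate of `Π_τ f`, the symbol of `Π_τ` being real and even. -/
def projForcing (τ : ℝ) (f : L2) (k : ℤ) : ℂ :=
  -(Complex.I / 4) * (omega k : ℂ)⁻¹ * cutoff τ k *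
    (2 * fourierCoeff (addConj f) k
      + -(k : ℂ) ^ 2 * fourierCoeff (fun x => addConj (proj τ f) x ^ 2) k)

/-- `u` solves `∂ₜ u = i ⟨∂ₓ²⟩ u + N(u)`, `u(0) = u₀` on `[0,T]` in the mild sense, that is
`u(t) = e^{it⟨∂ₓ²⟩} u₀ + ∫₀ᵗ e^{i(t-θ)⟨∂ₓ²⟩} N(u(θ)) dθ`, as an identity of distributions on `𝕋`
(equality of all Fourier coefficients) at every `t ∈ [0,T]`. Here `N f k` is the `k`-th Fourier
coefficient of `N(f)`. -/
def IsMildSolution (N : L2 → ℤ → ℂ) (u₀ : L2) (T : ℝ) (u : ℝ → L2) : Prop :=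
  ∀ k : ℤ, IntervalIntegrable (fun θ => N (u θ) k) volume 0 T ∧
    ∀ t ∈ Icc 0 T, fourierCoeff (u t) k =
      Complex.exp (Complex.I * t * omega k) * fourierCoeff u₀ k
        + ∫ θ in (0 : ℝ)..t, Complex.exp (Complex.I * (t - θ) * omega k) * N (u θ) k

/-- `u ∈ X^{s,b}(T)` is a solution on `[0,T]` of
`∂ₜ u = i ⟨∂ₓ²⟩ u - (i/4) ⟨∂ₓ²⟩⁻¹ [2 (u + ū) + ∂ₓ² (u + ū)²]`, `u(0) = u₀`. -/
def IsSolution (s b : ℝ) (u₀ : L2) (T : ℝ) (u : ℝ → L2) : Prop :=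
  MemLocalBourgain s b T u ∧ IsMildSolution forcing u₀ T u

/-- `u ∈ X^{s,b}(T)` is a solution on `[0,T]` of
`∂ₜ u = i ⟨∂ₓ²⟩ u - (i/4) ⟨∂ₓ²⟩⁻¹ Π_τ [2 (u + ū) + ∂ₓ² (Π_τ u + Π_τ ū)²]`, `u(0) = Π_τ u₀`. -/
def IsProjSolution (s b τ : ℝ) (u₀ : L2) (T : ℝ) (u : ℝ → L2) : Prop :=
  MemLocalBourgain s b T u ∧ IsMildSolution (projForcing τ) (proj τ u₀) T u

/-- The maximal existence time `T_s ∈ [0, ∞]`: the supremum of the lengths `T > 0` such that there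
is a solution in `X^{s,b}(T)` on `[0,T]`. -/
def maximalTime (s b : ℝ) (u₀ : L2) : ℝ≥0∞ :=
  ⨆ (T : ℝ) (_ : 0 < T ∧ ∃ u : ℝ → L2, IsSolution s b u₀ T u), ENNReal.ofReal T

end GoodBoussinesq

end

open FourierTransform

noncomputable section

namespace GoodBoussinesq

/-! The operator `⟨∂ₓ²⟩⁻¹∂ₓ²` has order zero, so the nonlinearity loses no derivative. The `L²` norm
of a difference of forcing terms is controlled by `‖f - g‖` and by the `L²` norm of the product `|f
- g| |f + g|` (`sqNorm_forcing_sub_le`). The whole argument therefore runs at the level of `L²([0,T]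
× 𝕋)`, and its one dispersive ingredient is a bilinear estimate for such products.

For free solutions this is `exists_strichartz`. The product of two of them is a sum of oscillations
with frequency `j + l` and phase `ω_j + ω_l`. Moving from `(j, l)` to `(j + r, l - r)` changes the
phase by `2r(r + j - l)` up to a bounded error, because `k² ≤ ω_k ≤ k² + 1`. Against a Gaussian
weight in time the Gram matrix of these oscillations has uniformly summable rows, and Schur's test
applies.

The estimate passes to any superposition of free solutions whose square is dominated pointwise by a
weighted integral of squares of free solutions (`lintegral_mul_superposition_le`). Two kinds are
needed. Elements of `X^{0,b}` with `b > 1/2` are such superpositions over `σ`, with weight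
`⟨σ⟩^{2b}` from Cauchy-Schwarz. Duhamel terms are such superpositions over the source time `θ`. In
the second case, a weight `e^{-2λt}` in time yields a factor `1/(2λ)`, which makes linear terms
absorbable on all of `[0,T]` at once, without iteration over short intervals.

Uniqueness (`eqOn_of_isDuhamel`): the weighted energy of the difference of the forcing terms is
finite and at most half of itself for large `λ`, so it vanishes.

Existence and error for the projected equation (`exists_isProjSolution`): let `v` extend the given
solution to the line. The projected equation has finitely many frequencies. After a radial
truncation of its nonlinearity it is a globally Lipschitz ODE, with a solution `w` on `[0,T]`. Write
`v - w = q + e`, where `q = (1 - Π_τ)v` is the high-frequency part and `e = Π_τ v - w` is a Duhamel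
term. The energy `y` of `e` satisfies `y ≤ A m + B y/(2λ) + D y²`, where `m` is the squared
`X^{0,b}` norm of the profile of `q`. A continuity argument in time gives `y ≤ 4 A m` and `‖e‖ ≤ 1`,
so the truncation is never active and `w` solves the projected equation. A Duhamel term with source
in `L²` of `[0,T] × 𝕋` belongs to `X^{0,b}(T)` for `b ≤ 1` (`exists_mode`), so the whole error is
controlled by `m`. Finally `m ≤ τ^s ‖v‖²` in `X^{s,b}` because `1 ≤ τ⟨k⟩²` at the frequencies
removed, and `m → 0` even when `s = 0` by convergence of the defining series. -/

/-! ### Inequalities in `[0, ∞]` -/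

/-- The Cauchy-Schwarz inequality. -/
lemma lintegral_mul_sq_le {α : Type*} [MeasurableSpace α] (μ : Measure α) {f g : α → ℝ≥0∞}
    (hf : AEMeasurable f μ) (hg : AEMeasurable g μ) :
    (∫⁻ x, f x * g x ∂μ) ^ 2 ≤ (∫⁻ x, f x ^ 2 ∂μ) * ∫⁻ x, g x ^ 2 ∂μ := by
  have h := ENNReal.lintegral_mul_le_Lp_mul_Lq μ Real.HolderConjugate.two_two hf hg
  simp only [Pi.mul_apply, ENNReal.rpow_two] at h
  calc _ ≤ ((∫⁻ x, f x ^ 2 ∂μ) ^ (1 / 2 : ℝ) * (∫⁻ x, g x ^ 2 ∂μ) ^ (1 / 2 : ℝ)) ^ 2 := by gcongr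
    _ = _ := by
        rw [mul_pow, ← ENNReal.rpow_two, ← ENNReal.rpow_two, ← ENNReal.rpow_mul,
          ← ENNReal.rpow_mul]
        norm_num

lemma add_sq_le_two_mul (a b : ℝ≥0∞) : (a + b) ^ 2 ≤ 2 * a ^ 2 + 2 * b ^ 2 := by
  rcases eq_or_ne a ⊤ with rfl | ha
  · simp
  rcases eq_or_ne b ⊤ with rfl | hb
  · simp
  lift a to NNReal using ha
  lift b to NNReal using hb
  norm_cast
  rw [← NNReal.coe_le_coe]
  push_cast
  nlinarith [sq_nonneg ((a : ℝ) - b)]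

lemma enorm_add_sq_le {E : Type*} [NormedAddCommGroup E] (a b : E) :
    ‖a + b‖ₑ ^ 2 ≤ 2 * ‖a‖ₑ ^ 2 + 2 * ‖b‖ₑ ^ 2 :=
  (pow_le_pow_left' (enorm_add_le a b) 2).trans (add_sq_le_two_mul _ _)

lemma enorm_sub_sq_le {E : Type*} [NormedAddCommGroup E] (a b : E) :
    ‖a - b‖ₑ ^ 2 ≤ 2 * ‖a‖ₑ ^ 2 + 2 * ‖b‖ₑ ^ 2 := by
  simpa [sub_eq_add_neg] using enorm_add_sq_le a (-b)

/-! ### Square sums of Fourier coefficients -/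

/-- The squared `ℓ²` norm. -/
def sqNorm (c : ℤ → ℂ) : ℝ≥0∞ := ∑' k, ‖c k‖ₑ ^ 2

/-- The squared `L²` norm of a product. -/
def pair (f g : Torus → ℂ) : ℝ≥0∞ :=
  ∫⁻ x, ‖f x‖ₑ ^ 2 * ‖g x‖ₑ ^ 2 ∂AddCircle.haarAddCircle

lemma le_sqNorm (c : ℤ → ℂ) (k : ℤ) : ‖c k‖ₑ ^ 2 ≤ sqNorm c :=
  ENNReal.le_tsum (f := fun k => ‖c k‖ₑ ^ 2) k

lemma sqNorm_mono {c d : ℤ → ℂ} (h : ∀ k, ‖c k‖ₑ ≤ ‖d k‖ₑ) : sqNorm c ≤ sqNorm d :=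
  ENNReal.tsum_le_tsum fun k => pow_le_pow_left' (h k) 2

lemma measurable_sqNorm {α : Type*} [MeasurableSpace α] {c : α → ℤ → ℂ}
    (hc : ∀ k, Measurable fun x => c x k) : Measurable fun x => sqNorm (c x) :=
  Measurable.tsum fun k => ((hc k).enorm).pow_const 2

lemma fourierCoeff_add (f g : L2) (k : ℤ) :
    fourierCoeff (f + g : L2) k = fourierCoeff f k + fourierCoeff g k := by
  simp only [← fourierBasis_repr, map_add, lp.coeFn_add, Pi.add_apply]

lemma fourierCoeff_sub (f g : L2) (k : ℤ) :
    fourierCoeff (f - g : L2) k = fourierCoeff f k - fourierCoeff g k := by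
  simp only [← fourierBasis_repr, map_sub, lp.coeFn_sub, Pi.sub_apply]

lemma fourierCoeff_injective {f g : L2} (h : ∀ k, fourierCoeff f k = fourierCoeff g k) :
    f = g := by
  apply (fourierBasis (T := 2 * Real.pi)).repr.injective
  ext k
  simpa only [fourierBasis_repr] using h k

lemma enorm_sq_eq_lintegral (f : L2) :
    ‖f‖ₑ ^ 2 = ∫⁻ x, ‖f x‖ₑ ^ 2 ∂AddCircle.haarAddCircle := by
  rw [Lp.enorm_def, eLpNorm_eq_lintegral_rpow_enorm_toReal (by norm_num) (by norm_num)]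
  simp only [ENNReal.toReal_ofNat, ENNReal.rpow_two, one_div]
  rw [← ENNReal.rpow_two, ← ENNReal.rpow_mul]
  norm_num

lemma enorm_sq_eq_sqNorm (f : L2) : ‖f‖ₑ ^ 2 = sqNorm (fourierCoeff f) := by
  have h1 := hasSum_sq_fourierCoeff f
  have h2 : (∫ t : Torus, ‖f t‖ ^ 2 ∂AddCircle.haarAddCircle) = ‖f‖ ^ 2 := by
    rw [integral_eq_lintegral_of_nonneg_ae (ae_of_all _ fun x => by positivity)
      (by simpa only [Pi.pow_apply] using! (Lp.aestronglyMeasurable f).norm.pow 2)]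
    have : ∀ x : Torus, ENNReal.ofReal (‖f x‖ ^ 2) = ‖f x‖ₑ ^ 2 := fun x => by
      rw [ENNReal.ofReal_pow (norm_nonneg _), ofReal_norm]
    simp only [this, ← enorm_sq_eq_lintegral]
    simp [ENNReal.toReal_pow]
  rw [h2] at h1
  have h3 := ENNReal.ofReal_tsum_of_nonneg (fun n : ℤ => by positivity) h1.summable
  rw [h1.tsum_eq, ENNReal.ofReal_pow (norm_nonneg _), ofReal_norm] at h3
  rw [h3]
  exact tsum_congr fun k => by rw [ENNReal.ofReal_pow (norm_nonneg _), ofReal_norm]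

/-- Bessel's inequality, for functions which need not be square integrable. -/
lemma sqNorm_fourierCoeff_le {φ : Torus → ℂ}
    (hφ : AEStronglyMeasurable φ AddCircle.haarAddCircle) :
    sqNorm (fourierCoeff φ) ≤ ∫⁻ x, ‖φ x‖ₑ ^ 2 ∂AddCircle.haarAddCircle := by
  rcases eq_or_ne (∫⁻ x, ‖φ x‖ₑ ^ 2 ∂AddCircle.haarAddCircle) ⊤ with h | h
  · simp [h]
  have hmem : MemLp φ 2 (AddCircle.haarAddCircle : Measure Torus) := by
    refine ⟨hφ, ?_⟩
    rw [eLpNorm_lt_top_iff_lintegral_rpow_enorm_lt_top (by norm_num) (by norm_num)]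
    simpa using h.lt_top
  have h1 := enorm_sq_eq_sqNorm hmem.toLp
  have h2 : fourierCoeff (hmem.toLp φ) = fourierCoeff φ :=
    fourierCoeff_congr_ae hmem.coeFn_toLp
  rw [h2, enorm_sq_eq_lintegral] at h1
  rw [← h1]
  exact (lintegral_congr_ae (hmem.coeFn_toLp.mono fun x hx => by simp only [hx])).le

lemma aemeasurable_enorm_sq (f : L2) :
    AEMeasurable (fun x => ‖f x‖ₑ ^ 2) (AddCircle.haarAddCircle : Measure Torus) :=
  (Lp.aestronglyMeasurable f).enorm.pow_const 2

lemma pair_comm (f g : Torus → ℂ) : pair f g = pair g f := by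
  simp only [pair, mul_comm]

/-! ### The nonlinearity -/

lemma one_le_omega (k : ℤ) : 1 ≤ omega k := by
  rw [omega]
  exact Real.one_le_sqrt.mpr (by nlinarith [sq_nonneg ((k : ℝ) ^ 2)])

lemma sq_le_omega (k : ℤ) : (k : ℝ) ^ 2 ≤ omega k :=
  Real.le_sqrt_of_sq_le (by nlinarith)

lemma omega_le (k : ℤ) : omega k ≤ (k : ℝ) ^ 2 + 1 := by
  rw [omega, Real.sqrt_le_left (by positivity)]
  nlinarith [sq_nonneg (k : ℝ)]

lemma norm_addConj_le (f : L2) (x : Torus) : ‖addConj f x‖ ≤ 2 * ‖f x‖ := by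
  refine (norm_add_le _ _).trans ?_
  rw [RCLike.norm_conj]
  exact (two_mul _).ge

lemma enorm_addConj_sq_le (f : L2) (x : Torus) : ‖addConj f x‖ₑ ^ 2 ≤ 4 * ‖f x‖ₑ ^ 2 := by
  refine (enorm_add_sq_le _ _).trans ?_
  have : ‖(starRingEnd ℂ) (f x)‖ₑ = ‖f x‖ₑ := by
    rw [← ofReal_norm, RCLike.norm_conj, ofReal_norm]
  rw [this, ← add_mul]
  norm_num

lemma memLp_addConj (f : L2) : MemLp (addConj f) 2 (AddCircle.haarAddCircle : Measure Torus) :=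
  (Lp.memLp f).add ((Lp.memLp f).star)

lemma integrable_addConj (f : L2) :
    Integrable (addConj f) (AddCircle.haarAddCircle : Measure Torus) :=
  (memLp_addConj f).integrable (by norm_num)

lemma integrable_addConj_mul (f g : L2) : Integrable (fun x => addConj f x * addConj g x)
    (AddCircle.haarAddCircle : Measure Torus) :=
  (memLp_addConj f).integrable_mul (memLp_addConj g)

lemma fourierCoeff_fun_sub {f g : Torus → ℂ} (hf : Integrable f AddCircle.haarAddCircle)
    (hg : Integrable g AddCircle.haarAddCircle) (k : ℤ) :
    fourierCoeff f k - fourierCoeff g k = fourierCoeff (fun x => f x - g x) k := by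
  simp only [fourierCoeff, smul_sub]
  rw [integral_sub (hf.fourier_smul _) (hg.fourier_smul _)]

lemma addConj_sub_ae (f g : L2) :
    (fun x => addConj f x - addConj g x) =ᵐ[AddCircle.haarAddCircle] addConj (f - g) := by
  filter_upwards [Lp.coeFn_sub f g] with x hx
  simp only [addConj, hx, Pi.sub_apply, map_sub]
  ring

lemma addConj_sq_sub_ae (f g : L2) :
    (fun x => addConj f x ^ 2 - addConj g x ^ 2) =ᵐ[AddCircle.haarAddCircle]
      fun x => addConj (f - g) x * addConj (f + g) x := by
  filter_upwards [Lp.coeFn_sub f g, Lp.coeFn_add f g] with x hx hx'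
  simp only [addConj, hx, hx', Pi.sub_apply, Pi.add_apply, map_sub, map_add]
  ring

/-- Since `k² ≤ ω_k` and `1 ≤ ω_k`, the multiplier `k²/ω_k` is bounded by one. The quadratic part
factors as a difference of squares. -/
lemma norm_forcing_sub_le (f g : L2) (k : ℤ) : ‖forcing f k - forcing g k‖ ≤
    1 / 2 * ‖fourierCoeff (addConj (f - g)) k‖
      + 1 / 4 * ‖fourierCoeff (fun x => addConj (f - g) x * addConj (f + g) x) k‖ := by
  rw [← fourierCoeff_congr_ae (addConj_sub_ae f g), ← fourierCoeff_congr_ae (addConj_sq_sub_ae f g),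
    ← fourierCoeff_fun_sub (integrable_addConj f) (integrable_addConj g),
    ← fourierCoeff_fun_sub (by simpa only [sq] using integrable_addConj_mul f f)
      (by simpa only [sq] using integrable_addConj_mul g g)]
  set a := fourierCoeff (addConj f) k - fourierCoeff (addConj g) k
  set b := fourierCoeff (fun x => addConj f x ^ 2) k - fourierCoeff (fun x => addConj g x ^ 2) k
  have hω := one_le_omega k
  have h : forcing f k - forcing g k =
      -(Complex.I / 4) * (omega k : ℂ)⁻¹ * (2 * a + -(k : ℂ) ^ 2 * b) := by
    simp only [forcing, a, b]; ring
  have hn : ‖(omega k : ℂ)⁻¹‖ = (omega k)⁻¹ := by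
    rw [norm_inv, Complex.norm_real, Real.norm_of_nonneg (by linarith)]
  rw [h, norm_mul, norm_mul, hn, norm_neg, norm_div, Complex.norm_I]
  have h2 : ‖2 * a + -(k : ℂ) ^ 2 * b‖ ≤ 2 * ‖a‖ + (k : ℝ) ^ 2 * ‖b‖ := by
    refine (norm_add_le _ _).trans ?_
    simp [Complex.norm_intCast]
  have h3 : (omega k)⁻¹ * (2 * ‖a‖ + (k : ℝ) ^ 2 * ‖b‖) ≤ 2 * ‖a‖ + ‖b‖ := by
    rw [inv_mul_le_iff₀ (by linarith)]
    have := sq_le_omega k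
    have ha := norm_nonneg a
    have hb := norm_nonneg b
    nlinarith
  have h4 : ‖(4 : ℂ)‖ = 4 := by norm_num
  rw [h4, mul_assoc]
  have h5 : (omega k)⁻¹ * ‖2 * a + -(k : ℂ) ^ 2 * b‖ ≤ 2 * ‖a‖ + ‖b‖ :=
    (mul_le_mul_of_nonneg_left h2 (by positivity)).trans h3
  linarith

lemma sqNorm_forcing_sub_le (f g : L2) : sqNorm (fun k => forcing f k - forcing g k) ≤
    2 * ‖f - g‖ₑ ^ 2 + 2 * pair (f - g : L2) (f + g : L2) := by
  set A := fourierCoeff (addConj (f - g))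
  set B := fourierCoeff (fun x => addConj (f - g) x * addConj (f + g) x)
  have hA : sqNorm A ≤ 4 * ‖f - g‖ₑ ^ 2 := by
    refine (sqNorm_fourierCoeff_le (memLp_addConj _).1).trans ?_
    rw [enorm_sq_eq_lintegral, ← lintegral_const_mul' _ _ (by norm_num)]
    exact lintegral_mono fun x => enorm_addConj_sq_le _ x
  have hB : sqNorm B ≤ 16 * pair (f - g : L2) (f + g : L2) := by
    refine (sqNorm_fourierCoeff_le (integrable_addConj_mul _ _).1).trans ?_
    rw [pair, ← lintegral_const_mul' _ _ (by norm_num)]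
    refine lintegral_mono fun x => ?_
    rw [enorm_mul, mul_pow]
    refine (mul_le_mul' (enorm_addConj_sq_le _ x) (enorm_addConj_sq_le _ x)).trans_eq ?_
    ring
  have h1 : ∀ k, ‖forcing f k - forcing g k‖ₑ ^ 2 ≤ 2⁻¹ * ‖A k‖ₑ ^ 2 + 8⁻¹ * ‖B k‖ₑ ^ 2 := by
    intro k
    have h := norm_forcing_sub_le f g k
    have h2 : ‖forcing f k - forcing g k‖ ^ 2 ≤ 2⁻¹ * ‖A k‖ ^ 2 + 8⁻¹ * ‖B k‖ ^ 2 := by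
      refine (pow_le_pow_left₀ (norm_nonneg _) h 2).trans ?_
      nlinarith [sq_nonneg (2 * ‖A k‖ - ‖B k‖)]
    have h3 := ENNReal.ofReal_le_ofReal h2
    rw [ENNReal.ofReal_add (by positivity) (by positivity), ENNReal.ofReal_mul (by positivity),
      ENNReal.ofReal_mul (by positivity), ENNReal.ofReal_pow (norm_nonneg _),
      ENNReal.ofReal_pow (norm_nonneg _), ENNReal.ofReal_pow (norm_nonneg _)] at h3
    simpa only [ofReal_norm, ENNReal.ofReal_inv_of_pos (zero_lt_two' ℝ),
      ENNReal.ofReal_inv_of_pos (by norm_num : (0 : ℝ) < 8), ENNReal.ofReal_ofNat] using h3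
  calc sqNorm (fun k => forcing f k - forcing g k)
      ≤ ∑' k, (2⁻¹ * ‖A k‖ₑ ^ 2 + 8⁻¹ * ‖B k‖ₑ ^ 2) := ENNReal.tsum_le_tsum h1
    _ = 2⁻¹ * sqNorm A + 8⁻¹ * sqNorm B := by
        rw [ENNReal.tsum_add, ENNReal.tsum_mul_left, ENNReal.tsum_mul_left]; rfl
    _ ≤ 2⁻¹ * (4 * ‖f - g‖ₑ ^ 2) + 8⁻¹ * (16 * pair (f - g : L2) (f + g : L2)) := by gcongr
    _ = _ := by
        rw [← mul_assoc, ← mul_assoc]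
        have e1 : (2⁻¹ * 4 : ℝ≥0∞) = 2 := by
          rw [show (4 : ℝ≥0∞) = 2 * 2 by norm_num, ← mul_assoc,
            ENNReal.inv_mul_cancel (by norm_num) (by norm_num), one_mul]
        have e2 : (8⁻¹ * 16 : ℝ≥0∞) = 2 := by
          rw [show (16 : ℝ≥0∞) = 8 * 2 by norm_num, ← mul_assoc,
            ENNReal.inv_mul_cancel (by norm_num) (by norm_num), one_mul]
        rw [e1, e2]

lemma lintegral_mul_le_enorm_mul (f g : L2) :
    ∫⁻ x, ‖f x‖ₑ * ‖g x‖ₑ ∂AddCircle.haarAddCircle ≤ ‖f‖ₑ * ‖g‖ₑ := by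
  have := lintegral_mul_sq_le (AddCircle.haarAddCircle : Measure Torus)
    (Lp.aestronglyMeasurable f).enorm (Lp.aestronglyMeasurable g).enorm
  rw [← enorm_sq_eq_lintegral, ← enorm_sq_eq_lintegral, ← mul_pow] at this
  exact (ENNReal.pow_le_pow_left_iff (two_ne_zero)).mp this

/-- A single coefficient of a product needs only its `L¹` norm, so `L²` control of the factors
suffices. This local Lipschitz bound gives continuity of each coefficient of the forcing and the
hypotheses of the ODE argument. -/
lemma norm_forcing_sub_le_mul (f g : L2) (k : ℤ) :
    ‖forcing f k - forcing g k‖ ≤ ‖f - g‖ * (1 + ‖f + g‖) := by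
  have hA : ‖fourierCoeff (addConj (f - g)) k‖ ≤ 2 * ‖f - g‖ := by
    have h : sqNorm (fourierCoeff (addConj (f - g))) ≤ 4 * ‖f - g‖ₑ ^ 2 := by
      refine (sqNorm_fourierCoeff_le (memLp_addConj _).1).trans ?_
      rw [enorm_sq_eq_lintegral, ← lintegral_const_mul' _ _ (by norm_num)]
      exact lintegral_mono fun x => enorm_addConj_sq_le _ x
    have h1 := (le_sqNorm _ k).trans h
    have e : (4 : ℝ≥0∞) * ‖f - g‖ₑ ^ 2 = (2 * ‖f - g‖ₑ) ^ 2 := by rw [mul_pow]; norm_num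
    rw [e, ENNReal.pow_le_pow_left_iff two_ne_zero] at h1
    rw [← ENNReal.ofReal_le_ofReal_iff (by positivity), ENNReal.ofReal_mul (by norm_num)]
    simpa only [ofReal_norm, ENNReal.ofReal_ofNat] using h1
  have hB : ‖fourierCoeff (fun x => addConj (f - g) x * addConj (f + g) x) k‖
      ≤ 4 * (‖f - g‖ * ‖f + g‖) := by
    rw [← ENNReal.ofReal_le_ofReal_iff (by positivity), ENNReal.ofReal_mul (by norm_num),
      ENNReal.ofReal_mul (by positivity)]
    simp only [ofReal_norm, ENNReal.ofReal_ofNat]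
    refine le_trans ?_ (mul_le_mul_right (lintegral_mul_le_enorm_mul _ _) _)
    rw [← lintegral_const_mul' _ _ (by norm_num)]
    refine (enorm_integral_le_lintegral_enorm _).trans (lintegral_mono fun x => ?_)
    rw [← ofReal_norm, ← ofReal_norm, ← ofReal_norm,
      ← ENNReal.ofReal_mul (norm_nonneg _), show (4 : ℝ≥0∞) = ENNReal.ofReal 4 by norm_num,
      ← ENNReal.ofReal_mul (by norm_num)]
    refine ENNReal.ofReal_le_ofReal ?_
    have hx : ‖(fourier (-k)) x‖ ≤ 1 := by rw [fourier_apply]; exact (Circle.norm_coe _).le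
    rw [norm_smul, norm_mul]
    have h1 := norm_addConj_le (f - g) x
    have h2 := norm_addConj_le (f + g) x
    calc _ ≤ 1 * ((2 * ‖(f - g : L2) x‖) * (2 * ‖(f + g : L2) x‖)) := by gcongr
      _ = _ := by push_cast; ring
  have := norm_forcing_sub_le f g k
  linarith

lemma continuous_forcing (k : ℤ) : Continuous fun f : L2 => forcing f k := by
  rw [continuous_iff_continuousAt]
  intro f
  rw [ContinuousAt, tendsto_iff_norm_sub_tendsto_zero]
  have hc : Continuous fun g : L2 => ‖g - f‖ * (1 + ‖g + f‖) := by fun_prop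
  have h0 : Tendsto (fun g : L2 => ‖g - f‖ * (1 + ‖g + f‖)) (𝓝 f) (𝓝 0) := by
    simpa using hc.tendsto f
  exact squeeze_zero (fun _ => norm_nonneg _) (fun g => norm_forcing_sub_le_mul g f k) h0

/-! ### Finite Fourier sums in `L²` -/

/-- The trigonometric polynomial with coefficients `c` on `S`. -/
def ofCoeff (S : Finset ℤ) (c : ℤ → ℂ) : L2 := ∑ k ∈ S, c k • (fourierLp 2 k : L2)

lemma fourierCoeff_ofCoeff (S : Finset ℤ) (c : ℤ → ℂ) (k : ℤ) :
    fourierCoeff (ofCoeff S c) k = if k ∈ S then c k else 0 := by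
  rw [← fourierBasis_repr, ofCoeff, ← coe_fourierBasis, HilbertBasis.repr_apply_apply, inner_sum]
  simp only [inner_smul_right]
  have horth := orthonormal_iff_ite.mp (fourierBasis : HilbertBasis ℤ ℂ L2).orthonormal
  simp only [horth, mul_ite, mul_one, mul_zero, Finset.sum_ite_eq]

lemma norm_cutoff_le (τ : ℝ) (k : ℤ) : ‖cutoff τ k‖ ≤ 1 := by
  rw [cutoff, indicator_apply]
  split_ifs <;> simp

lemma cutoff_eq_zero_or_one (τ : ℝ) (k : ℤ) : cutoff τ k = 0 ∨ cutoff τ k = 1 := by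
  rw [cutoff, indicator_apply]
  split_ifs <;> simp

lemma cutoff_neg (τ : ℝ) (k : ℤ) : cutoff τ (-k) = cutoff τ k := by
  simp only [cutoff, indicator_apply, mem_Icc, Int.cast_neg, neg_div]
  congr 1
  apply propext
  constructor <;> rintro ⟨h1, h2⟩ <;> constructor <;> linarith

/-- The frequencies of `Π_τ`. -/
def freq (τ : ℝ) : Finset ℤ := Finset.Icc (-⌈τ ^ (-(1 / 2) : ℝ)⌉) ⌈τ ^ (-(1 / 2) : ℝ)⌉

lemma cutoff_eq_zero {τ : ℝ} (hτ : 0 < τ) {k : ℤ} (hk : k ∉ freq τ) : cutoff τ k = 0 := by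
  have hM : 0 < τ ^ (-(1 / 2) : ℝ) := Real.rpow_pos_of_pos hτ _
  refine indicator_of_notMem (fun h => hk ?_) _
  obtain ⟨h1, h2⟩ := h
  rw [le_div_iff₀ hM] at h1
  rw [div_le_iff₀ hM] at h2
  have h3 := Int.le_ceil (τ ^ (-(1 / 2) : ℝ))
  rw [freq, Finset.mem_Icc]
  constructor
  · have : ((-⌈τ ^ (-(1 / 2) : ℝ)⌉ : ℤ) : ℝ) ≤ k := by push_cast; linarith
    exact_mod_cast this
  · have : (k : ℝ) ≤ (⌈τ ^ (-(1 / 2) : ℝ)⌉ : ℤ) := by linarith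
    exact_mod_cast this

lemma fourierCoeff_conj (φ : Torus → ℂ) (k : ℤ) :
    fourierCoeff (fun x => (starRingEnd ℂ) (φ x)) k = (starRingEnd ℂ) (fourierCoeff φ (-k)) := by
  simp only [fourierCoeff, smul_eq_mul, neg_neg]
  rw [← integral_conj]
  congr 1
  ext x
  simp

lemma fourierCoeff_addConj (f : L2) (k : ℤ) :
    fourierCoeff (addConj f) k =
      fourierCoeff f k + (starRingEnd ℂ) (fourierCoeff f (-k)) := by
  rw [← fourierCoeff_conj]
  have hf : Integrable f (AddCircle.haarAddCircle : Measure Torus) :=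
    (Lp.memLp f).integrable (by norm_num)
  have hf' : Integrable (fun x => (starRingEnd ℂ) (f x))
      (AddCircle.haarAddCircle : Measure Torus) :=
    ((Lp.memLp f).star).integrable (by norm_num)
  exact congrFun (fourierCoeff.add hf hf') k

/-- The symbol is even and idempotent, so the linear term may also be evaluated at `Π_τ f`. The
projected nonlinearity is thus `Π_τ N(Π_τ f)`, and estimates for `forcing` apply to it. -/
lemma projForcing_eq {τ : ℝ} (hτ : 0 < τ) (f : L2) (k : ℤ) :
    projForcing τ f k = cutoff τ k * forcing (proj τ f) k := by
  have h : cutoff τ k * fourierCoeff (addConj f) k =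
      cutoff τ k * fourierCoeff (addConj (proj τ f)) k := by
    rw [fourierCoeff_addConj, fourierCoeff_addConj, fourierCoeff_proj hτ, fourierCoeff_proj hτ,
      cutoff_neg]
    rcases cutoff_eq_zero_or_one τ k with h | h <;> simp [h]
  simp only [projForcing, forcing]
  linear_combination (-(Complex.I / 4) * (omega k : ℂ)⁻¹ * 2) * h

/-! ### Almost orthogonality -/

/-- Schur's test for the Gram matrix of a finite family of functions. -/
lemma lintegral_enorm_sum_sq_le_of_gram {ι α : Type*} [MeasurableSpace α] (μ : Measure α)
    [IsFiniteMeasure μ] (s : Finset ι) (φ : ι → α → ℂ) (hφ : ∀ i, Measurable (φ i))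
    (hφ1 : ∀ i x, ‖φ i x‖ ≤ 1) (c : ι → ℂ) (K : ι → ι → ℝ) (C : ℝ)
    (hK : ∀ i ∈ s, ∀ j ∈ s, ‖∫ x, φ i x * (starRingEnd ℂ) (φ j x) ∂μ‖ ≤ K i j)
    (hsymm : ∀ i j, K i j = K j i) (hC : ∀ i ∈ s, ∑ j ∈ s, K i j ≤ C) :
    ∫⁻ x, ‖∑ i ∈ s, c i * φ i x‖ₑ ^ 2 ∂μ ≤ ENNReal.ofReal (C * ∑ i ∈ s, ‖c i‖ ^ 2) := by
  have hint : ∀ i j, Integrable (fun x => φ i x * (starRingEnd ℂ) (φ j x)) μ := fun i j =>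
    Integrable.of_bound ((hφ i).mul (Complex.continuous_conj.measurable.comp
      (hφ j))).aestronglyMeasurable 1
      (ae_of_all _ fun x => by
        rw [norm_mul, RCLike.norm_conj]
        exact mul_le_one₀ (hφ1 i x) (norm_nonneg _) (hφ1 j x))
  have hexp : ∀ x, ‖∑ i ∈ s, c i * φ i x‖ ^ 2 =
      (∑ i ∈ s, ∑ j ∈ s, c i * (starRingEnd ℂ) (c j) *
        (φ i x * (starRingEnd ℂ) (φ j x))).re := by
    intro x
    have h := Complex.mul_conj (∑ i ∈ s, c i * φ i x)
    rw [Complex.normSq_eq_norm_sq] at h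
    rw [← Complex.ofReal_re (‖∑ i ∈ s, c i * φ i x‖ ^ 2), ← h, map_sum, Finset.sum_mul_sum]
    congr 1
    refine Finset.sum_congr rfl fun i _ => Finset.sum_congr rfl fun j _ => ?_
    rw [map_mul]; ring
  have hintS : Integrable (fun x => ∑ i ∈ s, ∑ j ∈ s, c i * (starRingEnd ℂ) (c j) *
      (φ i x * (starRingEnd ℂ) (φ j x))) μ :=
    integrable_finsetSum _ fun i _ => integrable_finsetSum _ fun j _ => (hint i j).const_mul _
  have hintN : Integrable (fun x => ‖∑ i ∈ s, c i * φ i x‖ ^ 2) μ := by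
    simp only [hexp]
    exact hintS.re
  have hle : ∫ x, ‖∑ i ∈ s, c i * φ i x‖ ^ 2 ∂μ ≤ C * ∑ i ∈ s, ‖c i‖ ^ 2 := by
    have h1 : ∫ x, ‖∑ i ∈ s, c i * φ i x‖ ^ 2 ∂μ = (∑ i ∈ s, ∑ j ∈ s,
        c i * (starRingEnd ℂ) (c j) * ∫ x, φ i x * (starRingEnd ℂ) (φ j x) ∂μ).re := by
      simp only [hexp]
      rw [← RCLike.re_eq_complex_re, integral_re hintS, integral_finsetSum _
        fun i _ => integrable_finsetSum _ fun j _ => (hint i j).const_mul _]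
      congr 1
      refine Finset.sum_congr rfl fun i _ => ?_
      rw [integral_finsetSum _ fun j _ => (hint i j).const_mul _]
      exact Finset.sum_congr rfl fun j _ => integral_const_mul _ _
    rw [h1]
    have hK0 : ∀ i ∈ s, ∀ j ∈ s, 0 ≤ K i j := fun i hi j hj => (norm_nonneg _).trans (hK i hi j hj)
    calc _ ≤ ‖∑ i ∈ s, ∑ j ∈ s,
          c i * (starRingEnd ℂ) (c j) * ∫ x, φ i x * (starRingEnd ℂ) (φ j x) ∂μ‖ :=
          Complex.re_le_norm _
      _ ≤ ∑ i ∈ s, ∑ j ∈ s, (‖c i‖ ^ 2 / 2 * K i j + ‖c j‖ ^ 2 / 2 * K i j) := by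
          refine (norm_sum_le _ _).trans (Finset.sum_le_sum fun i hi => ?_)
          refine (norm_sum_le _ _).trans (Finset.sum_le_sum fun j hj => ?_)
          rw [norm_mul, norm_mul, RCLike.norm_conj, ← add_mul]
          refine mul_le_mul ?_ (hK i hi j hj) (norm_nonneg _) (by positivity)
          -- The inequality `2|c_i||c_j| ≤ |c_i|² + |c_j|²`; symmetry of `K` then turns both halves
          -- into row sums.
          nlinarith [sq_nonneg (‖c i‖ - ‖c j‖)]
      _ = ∑ i ∈ s, ‖c i‖ ^ 2 * ∑ j ∈ s, K i j := by
          simp only [Finset.sum_add_distrib]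
          rw [Finset.sum_comm (f := fun i j => ‖c j‖ ^ 2 / 2 * K i j), ← Finset.sum_add_distrib]
          refine Finset.sum_congr rfl fun i _ => ?_
          rw [← Finset.mul_sum, ← Finset.mul_sum, Finset.sum_congr rfl fun j _ => hsymm j i]
          ring
      _ ≤ ∑ i ∈ s, ‖c i‖ ^ 2 * C :=
          Finset.sum_le_sum fun i hi => mul_le_mul_of_nonneg_left (hC i hi) (by positivity)
      _ = _ := by rw [← Finset.sum_mul, mul_comm]
  have h2 := ofReal_integral_eq_lintegral_ofReal hintN (ae_of_all _ fun x => by positivity)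
  have h3 : ∀ x, ENNReal.ofReal (‖∑ i ∈ s, c i * φ i x‖ ^ 2) = ‖∑ i ∈ s, c i * φ i x‖ₑ ^ 2 :=
    fun x => by rw [ENNReal.ofReal_pow (norm_nonneg _), ofReal_norm]
  simp only [h3] at h2
  rw [← h2]
  exact ENNReal.ofReal_le_ofReal hle

/-! ### The resonance function -/

lemma summable_inv_one_add_sq : Summable fun r : ℤ => 1 / (1 + (r : ℝ) ^ 2) := by
  refine Summable.of_nonneg_of_le (fun r => by positivity) (fun r => ?_)
    ((Real.summable_one_div_int_pow (p := 2)).mpr (by norm_num) |>.add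
      (summable_of_hasFiniteSupport (f := fun r : ℤ => if r = 0 then (1 : ℝ) else 0)
        ((finite_singleton (0 : ℤ)).subset fun r hr => by
          by_contra h
          exact hr (if_neg h))))
  by_cases h : r = 0
  · simp [h]
  · have : (0 : ℝ) < (r : ℝ) ^ 2 := by positivity
    simp only [h, if_false, add_zero]
    gcongr
    linarith

/-- `∑ 1 / (1 + r²)`. -/
def zetaSum : ℝ := ∑' r : ℤ, 1 / (1 + (r : ℝ) ^ 2)

lemma zetaSum_nonneg : 0 ≤ zetaSum := tsum_nonneg fun r => by positivity

lemma sum_shift_le_zetaSum (S : Finset ℤ) (a : ℤ) :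
    ∑ j ∈ S, 1 / (1 + ((j - a : ℤ) : ℝ) ^ 2) ≤ zetaSum := by
  have h := (Equiv.subRight a).summable_iff.mpr summable_inv_one_add_sq
  have h2 := (Equiv.subRight a).tsum_eq (fun r : ℤ => 1 / (1 + (r : ℝ) ^ 2))
  rw [zetaSum, ← h2]
  exact h.sum_le_tsum S fun j _ => by positivity

/-- A nonzero integer factor `r + p` gives `|r(r + p)| ≥ |r|`. The second term covers `r + p = 0`.
Both terms have sums over `r` bounded uniformly in `p`. -/
lemma inv_one_add_mul_sq_le (r p : ℤ) : 1 / (1 + ((r * (r + p) : ℤ) : ℝ) ^ 2) ≤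
    1 / (1 + (r : ℝ) ^ 2) + 1 / (1 + ((r + p : ℤ) : ℝ) ^ 2) := by
  by_cases h : r + p = 0
  · simp only [h, mul_zero]
    have : 0 ≤ 1 / (1 + (r : ℝ) ^ 2) := by positivity
    simpa using this
  · have h1 : (1 : ℝ) ≤ ((r + p : ℤ) : ℝ) ^ 2 := by
      have : 1 ≤ (r + p) ^ 2 := by
        have := sq_pos_of_ne_zero h
        omega
      exact_mod_cast this
    have h2 : 0 ≤ 1 / (1 + ((r + p : ℤ) : ℝ) ^ 2) := by positivity
    have h3 : 1 / (1 + ((r * (r + p) : ℤ) : ℝ) ^ 2) ≤ 1 / (1 + (r : ℝ) ^ 2) := by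
      rw [Int.cast_mul, mul_pow]
      refine one_div_le_one_div_of_le (by positivity) ?_
      nlinarith [sq_nonneg (r : ℝ)]
    linarith

/-- With `ω_k` replaced by `k²` the phase difference is exactly `-2r(r + j - l)`. The replacement
costs at most 2, so the Gaussian decay in the phase becomes summable decay in `r`. -/
lemma exp_resonance_le (j l r : ℤ) :
    Real.exp (-(omega j + omega l - omega (j + r) - omega (l - r)) ^ 2 / 2) ≤
      18 * (1 / (1 + (r : ℝ) ^ 2) + 1 / (1 + ((r + (j - l) : ℤ) : ℝ) ^ 2)) := by
  set lam := omega j + omega l - omega (j + r) - omega (l - r) with hlam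
  set m : ℝ := ((r * (r + (j - l)) : ℤ) : ℝ) with hm
  -- Each of the four symbols exceeds the corresponding square by an amount in `[0,1]`, two with
  -- each sign.
  have hE : |lam + 2 * m| ≤ 2 := by
    have h1 := sq_le_omega j
    have h2 := sq_le_omega l
    have h3 := sq_le_omega (j + r)
    have h4 := sq_le_omega (l - r)
    have h5 := omega_le j
    have h6 := omega_le l
    have h7 := omega_le (j + r)
    have h8 := omega_le (l - r)
    rw [hm, hlam, abs_le]
    push_cast at *
    constructor <;> nlinarith
  have h1 : Real.exp (-lam ^ 2 / 2) ≤ 2 / (1 + lam ^ 2) := by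
    rw [neg_div, Real.exp_neg, inv_le_comm₀ (Real.exp_pos _) (by positivity), inv_div]
    have := Real.add_one_le_exp (lam ^ 2 / 2)
    linarith
  have h2 : 2 / (1 + lam ^ 2) ≤ 18 * (1 / (1 + m ^ 2)) := by
    rw [mul_one_div, div_le_div_iff₀ (by positivity) (by positivity)]
    have := sq_le_sq' (abs_le.mp hE).1 (abs_le.mp hE).2
    nlinarith [sq_nonneg (lam + (lam + 2 * m)), sq_nonneg m, sq_nonneg lam,
      sq_nonneg (lam - (lam + 2 * m))]
  have h3 := inv_one_add_mul_sq_le r (j - l)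
  linarith

/-! ### The bilinear Strichartz estimate for free solutions -/

/-- Truncation of a Fourier series. -/
def trigSum (n : ℕ) (c : ℤ → ℂ) (x : Torus) : ℂ :=
  ∑ k ∈ Finset.Icc (-(n : ℤ)) n, c k * fourier k x

/-- The Fourier coefficients of `e^{it⟨∂ₓ²⟩} g`. -/
def free (g : ℤ → ℂ) (t : ℝ) (k : ℤ) : ℂ := Complex.exp (Complex.I * t * omega k) * g k

lemma norm_exp_I_mul (a b : ℝ) : ‖Complex.exp (Complex.I * a * b)‖ = 1 := by
  rw [show Complex.I * a * b = ((a * b : ℝ) : ℂ) * Complex.I by push_cast; ring,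
    Complex.norm_exp_ofReal_mul_I]

lemma enorm_exp_I_mul (a b : ℝ) : ‖Complex.exp (Complex.I * a * b)‖ₑ = 1 := by
  rw [← ofReal_norm, norm_exp_I_mul, ENNReal.ofReal_one]

lemma norm_fourier_apply (k : ℤ) (x : Torus) : ‖fourier k x‖ = 1 := by
  rw [fourier_apply]
  exact Circle.norm_coe _

lemma measurable_fourier (k : ℤ) : Measurable fun x : Torus => fourier k x :=
  (fourier k).continuous.measurable

lemma integral_fourier_mul_conj (k l : ℤ) :
    ∫ x : Torus, fourier k x * (starRingEnd ℂ) (fourier l x) ∂AddCircle.haarAddCircle =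
      if k = l then 1 else 0 := by
  have h := fourierCoeff_fourier (T := 2 * Real.pi) k
  have h2 := congrFun h l
  rw [fourierCoeff] at h2
  rw [Pi.single_apply] at h2
  simp only [smul_eq_mul, fourier_neg] at h2
  rw [← integral_congr_ae (ae_of_all _ fun x => mul_comm _ _), h2]
  simp only [eq_comm]

/-- The characteristic function of the standard Gaussian. A Gaussian weight replaces the sharp
interval because its transform decays fast enough for Schur's test. -/
lemma norm_integral_gaussian_exp (a b : ℝ) :
    ‖∫ t : ℝ, Complex.exp (Complex.I * t * a) * (starRingEnd ℂ) (Complex.exp (Complex.I * t * b))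
      ∂ProbabilityTheory.gaussianReal 0 1‖ = Real.exp (-(a - b) ^ 2 / 2) := by
  have h := ProbabilityTheory.charFun_gaussianReal (μ := 0) (v := 1) (a - b)
  rw [charFun_apply_real] at h
  have h2 : ∀ t : ℝ, Complex.exp (Complex.I * t * a) *
      (starRingEnd ℂ) (Complex.exp (Complex.I * t * b)) =
      Complex.exp (((a - b : ℝ) : ℂ) * t * Complex.I) := by
    intro t
    rw [← Complex.exp_conj, ← Complex.exp_add]
    congr 1
    simp only [map_mul, Complex.conj_I, Complex.conj_ofReal]
    push_cast
    ring
  simp only [h2]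
  rw [h, show (((a - b : ℝ) : ℂ) * ((0 : ℝ) : ℂ) * Complex.I
    - (((1 : NNReal) : ℝ) : ℂ) * ((a - b : ℝ) : ℂ) ^ 2 / 2) = ((-(a - b) ^ 2 / 2 : ℝ) : ℂ) by
      push_cast; ring, ← Complex.ofReal_exp, Complex.norm_real,
    Real.norm_of_nonneg (Real.exp_pos _).le]

/-- The functions `e^{it(ω_j + ω_l)} e_{j+l}(x)`. -/
def product (p : ℤ × ℤ) (z : ℝ × Torus) : ℂ :=
  Complex.exp (Complex.I * z.1 * (omega p.1 + omega p.2 : ℝ)) * fourier (p.1 + p.2) z.2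

/-- The Gram matrix of `product`. -/
def gram (p q : ℤ × ℤ) : ℝ :=
  if p.1 + p.2 = q.1 + q.2 then
    Real.exp (-(omega p.1 + omega p.2 - (omega q.1 + omega q.2)) ^ 2 / 2) else 0

/-- Conservation of the total frequency leaves one free index `j` in each row. The resonance bound
with `r = j - p.1` then gives two translates of the sum `zetaSum`. -/
lemma sum_gram_le (S : Finset ℤ) (p : ℤ × ℤ) : ∑ q ∈ S ×ˢ S, gram p q ≤ 36 * zetaSum := by
  rw [Finset.sum_product]
  calc ∑ j ∈ S, ∑ l ∈ S, gram p (j, l)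
      ≤ ∑ j ∈ S, 18 * (1 / (1 + ((j - p.1 : ℤ) : ℝ) ^ 2) +
          1 / (1 + ((j - p.2 : ℤ) : ℝ) ^ 2)) := by
        refine Finset.sum_le_sum fun j _ => ?_
        have h1 : ∀ l ∈ S, gram p (j, l) ≤ if l = p.1 + p.2 - j then
            18 * (1 / (1 + ((j - p.1 : ℤ) : ℝ) ^ 2) + 1 / (1 + ((j - p.2 : ℤ) : ℝ) ^ 2))
            else 0 := by
          intro l _
          simp only [gram]
          by_cases h : l = p.1 + p.2 - j
          · rw [if_pos h, if_pos (by omega)]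
            have := exp_resonance_le p.1 p.2 (j - p.1)
            rw [show p.1 + (j - p.1) = j by ring, show p.2 - (j - p.1) = l by rw [h]; ring,
              show j - p.1 + (p.1 - p.2) = j - p.2 by ring] at this
            convert this using 4
            ring
          · rw [if_neg h, if_neg (by omega)]
        refine (Finset.sum_le_sum h1).trans ?_
        rw [Finset.sum_ite_eq']
        split_ifs
        · exact le_rfl
        · positivity
    _ ≤ 36 * zetaSum := by
        rw [← Finset.mul_sum, Finset.sum_add_distrib]
        have h1 := sum_shift_le_zetaSum S p.1
        have h2 := sum_shift_le_zetaSum S p.2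
        linarith

lemma norm_integral_product_le (p q : ℤ × ℤ) :
    ‖∫ z, product p z * (starRingEnd ℂ) (product q z)
      ∂(ProbabilityTheory.gaussianReal 0 1).prod AddCircle.haarAddCircle‖ ≤ gram p q := by
  have h1 : ∀ z : ℝ × Torus, product p z * (starRingEnd ℂ) (product q z) =
      (Complex.exp (Complex.I * z.1 * (omega p.1 + omega p.2 : ℝ)) *
        (starRingEnd ℂ) (Complex.exp (Complex.I * z.1 * (omega q.1 + omega q.2 : ℝ)))) *
      (fourier (p.1 + p.2) z.2 * (starRingEnd ℂ) (fourier (q.1 + q.2) z.2)) := by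
    intro z
    simp only [product, map_mul]
    ring
  simp only [h1]
  rw [integral_prod_mul (fun t : ℝ => Complex.exp (Complex.I * t * (omega p.1 + omega p.2 : ℝ)) *
        (starRingEnd ℂ) (Complex.exp (Complex.I * t * (omega q.1 + omega q.2 : ℝ))))
      (fun x : Torus => fourier (p.1 + p.2) x * (starRingEnd ℂ) (fourier (q.1 + q.2) x)),
    norm_mul, norm_integral_gaussian_exp, integral_fourier_mul_conj, gram]
  split_ifs <;> simp

lemma measurable_trigSum {α : Type*} [MeasurableSpace α] (n : ℕ) {c : α → ℤ → ℂ}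
    (hc : ∀ k, Measurable fun t => c t k) :
    Measurable fun z : α × Torus => trigSum n (c z.1) z.2 :=
  Finset.measurable_sum _ fun k _ =>
    ((hc k).comp measurable_fst).mul ((measurable_fourier k).comp measurable_snd)

lemma measurable_free (g : ℤ → ℂ) (k : ℤ) : Measurable fun t => free g t k := by
  unfold free
  fun_prop

/-- The product of the two truncated solutions is a finite combination of the functions `product p`
with coefficients `f p.1 * g p.2`, whose square sum factors. The bound does not depend on `n`. -/
lemma lintegral_gaussian_pair_free_le (n : ℕ) (f g : ℤ → ℂ) :
    ∫⁻ t, pair (trigSum n (free f t)) (trigSum n (free g t)) ∂ProbabilityTheory.gaussianReal 0 1 ≤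
      ENNReal.ofReal (36 * zetaSum) * (sqNorm f * sqNorm g) := by
  set S := Finset.Icc (-(n : ℤ)) n
  have hprod : ∀ z : ℝ × Torus, trigSum n (free f z.1) z.2 * trigSum n (free g z.1) z.2 =
      ∑ p ∈ S ×ˢ S, (f p.1 * g p.2) * product p z := by
    intro z
    simp only [trigSum, Finset.sum_mul_sum, Finset.sum_product]
    refine Finset.sum_congr rfl fun j _ => Finset.sum_congr rfl fun l _ => ?_
    simp only [free, product, fourier_add, Complex.ofReal_add, mul_add, Complex.exp_add]
    ring
  have hmeas : Measurable fun z : ℝ × Torus =>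
      ‖trigSum n (free f z.1) z.2‖ₑ ^ 2 * ‖trigSum n (free g z.1) z.2‖ₑ ^ 2 :=
    ((measurable_trigSum n (measurable_free f)).enorm.pow_const 2).mul
      ((measurable_trigSum n (measurable_free g)).enorm.pow_const 2)
  have h1 : ∫⁻ t, pair (trigSum n (free f t)) (trigSum n (free g t))
      ∂ProbabilityTheory.gaussianReal 0 1 = ∫⁻ z, ‖∑ p ∈ S ×ˢ S, (f p.1 * g p.2) * product p z‖ₑ ^ 2
      ∂(ProbabilityTheory.gaussianReal 0 1).prod AddCircle.haarAddCircle := by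
    simp only [← hprod, enorm_mul, mul_pow]
    rw [lintegral_prod _ hmeas.aemeasurable]
    rfl
  rw [h1]
  have hm : ∀ p : ℤ × ℤ, Measurable (product p) := fun p =>
    Measurable.mul (by fun_prop) ((measurable_fourier (p.1 + p.2)).comp measurable_snd)
  refine (lintegral_enorm_sum_sq_le_of_gram _ (S ×ˢ S) product hm (fun p z => ?_)
    (fun p => f p.1 * g p.2) gram (36 * zetaSum) (fun p _ q _ => norm_integral_product_le p q)
    (fun p q => ?_) (fun p _ => sum_gram_le S p)).trans ?_
  · rw [product, norm_mul, norm_exp_I_mul, norm_fourier_apply, one_mul]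
  · simp only [gram, eq_comm (a := p.1 + p.2)]
    congr 3
    ring
  · rw [ENNReal.ofReal_mul (mul_nonneg (by norm_num) zetaSum_nonneg)]
    gcongr
    simp only [Finset.sum_product, norm_mul, mul_pow, ← Finset.sum_mul_sum]
    rw [ENNReal.ofReal_mul (Finset.sum_nonneg fun _ _ => by positivity)]
    have key : ∀ h : ℤ → ℂ, ENNReal.ofReal (∑ k ∈ S, ‖h k‖ ^ 2) ≤ sqNorm h := by
      intro h
      rw [ENNReal.ofReal_sum_of_nonneg fun _ _ => by positivity]
      refine le_trans (le_of_eq ?_) (ENNReal.sum_le_tsum S)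
      refine Finset.sum_congr rfl fun k _ => ?_
      rw [ENNReal.ofReal_pow (norm_nonneg _), ofReal_norm]
    exact mul_le_mul' (key f) (key g)

/-- On `[0,T]` the Gaussian density is at least its value at `T`, so Lebesgue measure there is
dominated by a multiple of the Gaussian. -/
lemma restrict_le_gaussian (T : ℝ) : ∃ C : NNReal,
    (volume : Measure ℝ).restrict (Icc 0 T) ≤ C • ProbabilityTheory.gaussianReal 0 1 := by
  set p : ℝ := ProbabilityTheory.gaussianPDFReal 0 1 T with hp
  have hp0 : 0 < p := ProbabilityTheory.gaussianPDFReal_pos 0 1 T one_ne_zero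
  have hle : ∀ t ∈ Icc 0 T, ENNReal.ofReal p ≤ ProbabilityTheory.gaussianPDF 0 1 t := by
    intro t ht
    refine ENNReal.ofReal_le_ofReal ?_
    rw [hp, ProbabilityTheory.gaussianPDFReal, ProbabilityTheory.gaussianPDFReal]
    have h0 := ht.1
    have h1 := ht.2
    gcongr
  refine ⟨(Real.toNNReal p)⁻¹, Measure.le_iff.mpr fun s hs => ?_⟩
  rw [Measure.restrict_apply hs, Measure.smul_apply, ENNReal.smul_def, smul_eq_mul,
    ENNReal.coe_inv (by simpa using hp0), ProbabilityTheory.gaussianReal_apply _ one_ne_zero,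
    ← ENNReal.mul_le_iff_le_inv (by simpa using hp0) (by simp)]
  calc ENNReal.ofReal p * volume (s ∩ Icc 0 T) = ∫⁻ _ in s ∩ Icc 0 T, ENNReal.ofReal p := by
        rw [setLIntegral_const]
    _ ≤ ∫⁻ t in s ∩ Icc 0 T, ProbabilityTheory.gaussianPDF 0 1 t :=
        setLIntegral_mono' (hs.inter measurableSet_Icc) fun t ht => hle t ht.2
    _ ≤ _ := lintegral_mono_set inter_subset_left

/-- The bilinear Strichartz estimate for free solutions. -/
lemma exists_strichartz (T : ℝ) : ∃ C : NNReal, ∀ (n : ℕ) (f g : ℤ → ℂ),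
    ∫⁻ t in Icc 0 T, pair (trigSum n (free f t)) (trigSum n (free g t)) ≤
      C * sqNorm f * sqNorm g := by
  obtain ⟨C, hC⟩ := restrict_le_gaussian T
  refine ⟨C * Real.toNNReal (36 * zetaSum), fun n f g => ?_⟩
  refine (lintegral_mono' hC le_rfl).trans ?_
  rw [lintegral_smul_measure, ENNReal.smul_def, smul_eq_mul, ENNReal.coe_mul, mul_assoc, mul_assoc]
  exact mul_le_mul_right (lintegral_gaussian_pair_free_le n f g) _

/-! ### Strichartz bounds and superposition of free solutions -/

/-- The bilinear estimate against free solutions, for the trigonometric truncations of the function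
with Fourier coefficients `c t`. -/
structure StrichartzBound (T : ℝ) (M : ℝ≥0∞) (c : ℝ → ℤ → ℂ) : Prop where
  measurable : ∀ k, Measurable fun t => c t k
  bound : ∀ (n : ℕ) (g : ℤ → ℂ),
    ∫⁻ t in Icc 0 T, pair (trigSum n (c t)) (trigSum n (free g t)) ≤ M * sqNorm g

lemma StrichartzBound.mono {T T' : ℝ} {M : ℝ≥0∞} {c : ℝ → ℤ → ℂ} (h : StrichartzBound T M c)
    (hT : T' ≤ T) : StrichartzBound T' M c :=
  ⟨h.measurable, fun n g =>
    (lintegral_mono_set (Icc_subset_Icc_right hT)).trans (h.bound n g)⟩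

/-- Tonelli's theorem in abstract form: if `ρ D` is dominated by a superposition of the `B t η` and
each of these obeys the bound against `A`, so does `ρ D`. Here `X` is time, `Y` the torus and `α`
the parameter of the superposition. -/
lemma lintegral_mul_superposition_le {X Y α : Type*} [MeasurableSpace X] [MeasurableSpace Y]
    [MeasurableSpace α] {μ : Measure X} {κ : Measure Y} {ν : Measure α} [SFinite μ] [SFinite κ]
    [SFinite ν] {A : X → Y → ℝ≥0∞} (hA : Measurable fun z : X × Y => A z.1 z.2)
    {B : X → α → Y → ℝ≥0∞} (hB : Measurable fun z : (X × α) × Y => B z.1.1 z.1.2 z.2)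
    {D : X → Y → ℝ≥0∞} {ρ : X → ℝ≥0∞} (hρ : ∀ t, ρ t ≠ ⊤) {W N : α → ℝ≥0∞} (hW : Measurable W)
    (hN : Measurable N) {M : ℝ≥0∞}
    (h : ∀ᵐ t ∂μ, ∀ y, ρ t * D t y ≤ ∫⁻ η, W η * B t η y ∂ν)
    (hM : ∀ η, ∫⁻ t, ∫⁻ y, A t y * B t η y ∂κ ∂μ ≤ M * N η) :
    ∫⁻ t, ρ t * ∫⁻ y, A t y * D t y ∂κ ∂μ ≤ M * ∫⁻ η, W η * N η ∂ν := by
  have hP : Measurable fun z : X × α => ∫⁻ y, A z.1 y * B z.1 z.2 y ∂κ :=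
    Measurable.lintegral_prod_right' (f := fun z : (X × α) × Y => A z.1.1 z.2 * B z.1.1 z.1.2 z.2)
      ((hA.comp (measurable_fst.fst.prodMk measurable_snd)).mul hB)
  have h1 : ∀ᵐ t ∂μ, ρ t * ∫⁻ y, A t y * D t y ∂κ ≤
      ∫⁻ η, W η * ∫⁻ y, A t y * B t η y ∂κ ∂ν := by
    filter_upwards [h] with t ht
    have hm1 : Measurable (A t) := hA.comp (measurable_const.prodMk measurable_id)
    have hm2 : Measurable fun z : Y × α => B t z.2 z.1 :=
      hB.comp ((measurable_const.prodMk measurable_snd).prodMk measurable_fst)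
    calc ρ t * ∫⁻ y, A t y * D t y ∂κ
        = ∫⁻ y, A t y * (ρ t * D t y) ∂κ := by
          rw [← lintegral_const_mul' _ _ (hρ t)]
          exact lintegral_congr fun y => by ring
      _ ≤ ∫⁻ y, A t y * ∫⁻ η, W η * B t η y ∂ν ∂κ :=
          lintegral_mono fun y => mul_le_mul_right (ht y) _
      _ = ∫⁻ y, ∫⁻ η, A t y * (W η * B t η y) ∂ν ∂κ :=
          lintegral_congr fun y => (lintegral_const_mul (f := fun η => W η * B t η y) _
            (hW.mul (hm2.comp (measurable_const.prodMk measurable_id)))).symm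
      _ = ∫⁻ η, ∫⁻ y, A t y * (W η * B t η y) ∂κ ∂ν :=
          lintegral_lintegral_swap
            (((hm1.comp measurable_fst).mul ((hW.comp measurable_snd).mul hm2)).aemeasurable)
      _ = _ := by
          refine lintegral_congr fun η => ?_
          rw [← lintegral_const_mul (f := fun y => A t y * B t η y) _
            (hm1.mul (hm2.comp (measurable_id.prodMk measurable_const)))]
          exact lintegral_congr fun y => by ring
  calc ∫⁻ t, ρ t * ∫⁻ y, A t y * D t y ∂κ ∂μ
      ≤ ∫⁻ t, ∫⁻ η, W η * ∫⁻ y, A t y * B t η y ∂κ ∂ν ∂μ := lintegral_mono_ae h1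
    _ = ∫⁻ η, ∫⁻ t, W η * ∫⁻ y, A t y * B t η y ∂κ ∂μ ∂ν :=
        lintegral_lintegral_swap ((hW.comp measurable_snd).mul hP).aemeasurable
    _ ≤ ∫⁻ η, M * (W η * N η) ∂ν := by
        refine lintegral_mono fun η => ?_
        dsimp only
        rw [lintegral_const_mul (f := fun t => ∫⁻ y, A t y * B t η y ∂κ) _
          (hP.comp (measurable_id.prodMk measurable_const))]
        refine (mul_le_mul_right (hM η) _).trans_eq ?_
        ring
    _ = _ := lintegral_const_mul (f := fun η => W η * N η) _ (hW.mul hN)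

lemma StrichartzBound.lintegral_superposition_le {α : Type*} [MeasurableSpace α] {ν : Measure α}
    [SFinite ν] {T : ℝ} {M : ℝ≥0∞} {c d : ℝ → ℤ → ℂ} (hc : StrichartzBound T M c)
    {g : α → ℤ → ℂ} (hg : ∀ k, Measurable fun η => g η k) {ρ : ℝ → ℝ≥0∞} (hρ : ∀ t, ρ t ≠ ⊤)
    {W : α → ℝ≥0∞} (hW : Measurable W) (n : ℕ)
    (h : ∀ t ∈ Icc 0 T, ∀ x, ρ t * ‖trigSum n (d t) x‖ₑ ^ 2 ≤
      ∫⁻ η, W η * ‖trigSum n (free (g η) t) x‖ₑ ^ 2 ∂ν) :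
    ∫⁻ t in Icc 0 T, ρ t * pair (trigSum n (c t)) (trigSum n (d t)) ≤
      M * ∫⁻ η, W η * sqNorm (g η) ∂ν := by
  have hfree : ∀ k, Measurable fun z : ℝ × α => free (g z.2) z.1 k := fun k =>
    Measurable.mul (by fun_prop) ((hg k).comp measurable_snd)
  have hmfree : Measurable fun z : (ℝ × α) × Torus =>
      ‖trigSum n (free (g z.1.2) z.1.1) z.2‖ₑ ^ 2 :=
    (measurable_trigSum n hfree).enorm.pow_const 2
  have hmc : Measurable fun z : ℝ × Torus => ‖trigSum n (c z.1) z.2‖ₑ ^ 2 :=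
    (measurable_trigSum n hc.measurable).enorm.pow_const 2
  exact lintegral_mul_superposition_le (A := fun t x => ‖trigSum n (c t) x‖ₑ ^ 2) hmc
    (B := fun t η x => ‖trigSum n (free (g η) t) x‖ₑ ^ 2) hmfree
    (D := fun t x => ‖trigSum n (d t) x‖ₑ ^ 2) hρ hW (measurable_sqNorm hg)
    ((ae_restrict_iff' measurableSet_Icc).mpr (ae_of_all _ h)) (fun η => hc.bound n (g η))

/-- A constant in the bilinear Strichartz estimate on `[0,T]`. -/
def strichartzConst (T : ℝ) : NNReal := (exists_strichartz T).choose

lemma strichartzBound_free (T : ℝ) (f : ℤ → ℂ) :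
    StrichartzBound T (strichartzConst T * sqNorm f) (free f) :=
  ⟨measurable_free f, fun n g => (exists_strichartz T).choose_spec n f g⟩

/-- The bilinear estimate is used here with the roles of its two factors exchanged. The constant
refers to a fixed `T' ≥ T`, which keeps it uniform while the final time varies in the continuity
argument. -/
lemma strichartzBound_of_superposition {α : Type*} [MeasurableSpace α] {ν : Measure α}
    [SFinite ν] {T T' : ℝ} (hT : T ≤ T') {d : ℝ → ℤ → ℂ} (hd : ∀ k, Measurable fun t => d t k)
    {g : α → ℤ → ℂ} (hg : ∀ k, Measurable fun η => g η k)
    {W : α → ℝ≥0∞} (hW : Measurable W)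
    (h : ∀ n, ∀ t ∈ Icc 0 T, ∀ x, ‖trigSum n (d t) x‖ₑ ^ 2 ≤
      ∫⁻ η, W η * ‖trigSum n (free (g η) t) x‖ₑ ^ 2 ∂ν) :
    StrichartzBound T (strichartzConst T' * ∫⁻ η, W η * sqNorm (g η) ∂ν) d := by
  refine ⟨hd, fun n f => ?_⟩
  have := ((strichartzBound_free T' f).mono hT).lintegral_superposition_le (d := d) hg
    (ρ := fun _ => 1)
    (by simp) hW n (by simpa only [one_mul] using h n)
  simp only [one_mul] at this
  simp only [pair_comm (trigSum n (d _))]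
  exact this.trans_eq (by ring)

/-! ### Profiles of functions in Bourgain spaces -/

lemma enorm_ofReal {x : ℝ} (hx : 0 ≤ x) : ‖(x : ℂ)‖ₑ = ENNReal.ofReal x := by
  rw [← ofReal_norm, Complex.norm_real, Real.norm_of_nonneg hx]

lemma lt_top_of_sq_lt_top {a : ℝ≥0∞} (h : a ^ 2 < ⊤) : a < ⊤ := by
  rw [ENNReal.pow_lt_top_iff] at h
  exact h.resolve_right two_ne_zero

lemma one_le_bracket (x : ℝ) : 1 ≤ bracket x :=
  Real.one_le_sqrt.mpr (by nlinarith [sq_nonneg x])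

lemma bracket_pos (x : ℝ) : 0 < bracket x := zero_lt_one.trans_le (one_le_bracket x)

lemma continuous_bracket : Continuous bracket := by
  unfold bracket
  fun_prop

lemma continuous_bracket_rpow (b : ℝ) : Continuous fun σ => bracket σ ^ b :=
  continuous_bracket.rpow_const fun σ => Or.inl (bracket_pos σ).ne'

/-- `v(t) = e^{it⟨∂ₓ²⟩} ∫ g(σ) e^{iσt} dσ`. -/
structure IsProfile (v : ℝ → L2) (g : ℝ → ℤ → ℂ) : Prop where
  measurable : ∀ k, Measurable fun σ => g σ k
  integrable : ∀ k, Integrable fun σ => g σ k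
  eq : ∀ (t : ℝ) (k : ℤ), fourierCoeff (v t) k = Complex.exp (Complex.I * t * omega k) *
    ∫ σ : ℝ, g σ k * Complex.exp (Complex.I * σ * t)

/-- The squared norm of a profile with one frequency. -/
def modeNorm (b : ℝ) (φ : ℝ → ℂ) : ℝ≥0∞ := ∫⁻ σ, ENNReal.ofReal (bracket σ ^ b) ^ 2 * ‖φ σ‖ₑ ^ 2

/-- The squared norm of a profile. -/
def profNorm (s b : ℝ) (g : ℝ → ℤ → ℂ) : ℝ≥0∞ :=
  ∑' k : ℤ, ENNReal.ofReal (bracket k ^ s) ^ 2 * modeNorm b fun σ => g σ k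

lemma modeNorm_congr {b : ℝ} {φ ψ : ℝ → ℂ} (h : φ =ᵐ[volume] ψ) : modeNorm b φ = modeNorm b ψ :=
  lintegral_congr_ae (h.mono fun x hx => by simp only [hx])

lemma modeNorm_const_mul (b : ℝ) (c : ℂ) (φ : ℝ → ℂ) :
    modeNorm b (fun σ => c * φ σ) = ‖c‖ₑ ^ 2 * modeNorm b φ := by
  rw [modeNorm, modeNorm, ← lintegral_const_mul' _ _ (by finiteness)]
  refine lintegral_congr fun σ => ?_
  rw [enorm_mul]
  ring

/-- The translation `σ ↦ σ + ω_k` on each frequency straightens the weight to `⟨σ⟩^b`. This is why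
profiles are written relative to the free flow. -/
lemma eLpNorm_bourgain_sq {s b : ℝ} {a : ℤ × ℝ → ℂ}
    (ha : AEStronglyMeasurable a (Measure.count.prod volume)) :
    eLpNorm (fun p : ℤ × ℝ => ((bracket p.1 ^ s * bracket (p.2 - omega p.1) ^ b : ℝ) : ℂ) * a p)
      2 (Measure.count.prod volume) ^ 2 =
    ∑' k : ℤ, ENNReal.ofReal (bracket k ^ s) ^ 2 * modeNorm b fun σ => a (k, σ + omega k) := by
  have hw : Measurable fun p : ℤ × ℝ =>
      ((bracket p.1 ^ s * bracket (p.2 - omega p.1) ^ b : ℝ) : ℂ) := by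
    refine measurable_from_prod_countable_right fun k => ?_
    have h : Continuous fun σ => bracket (σ - omega k) ^ b :=
      (continuous_bracket_rpow b).comp (by fun_prop)
    have h2 : Continuous fun σ => ((bracket k ^ s * bracket (σ - omega k) ^ b : ℝ) : ℂ) := by
      fun_prop
    exact h2.measurable
  have hm := (hw.aestronglyMeasurable (μ := Measure.count.prod volume)).mul ha
  rw [eLpNorm_eq_lintegral_rpow_enorm_toReal (by norm_num) (by norm_num)]
  simp only [ENNReal.toReal_ofNat, ENNReal.rpow_two, one_div]
  rw [← ENNReal.rpow_two, ← ENNReal.rpow_mul, inv_mul_cancel₀ two_ne_zero, ENNReal.rpow_one,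
    lintegral_prod _ (by simpa using! hm.enorm.pow_const 2), lintegral_count]
  refine tsum_congr fun k => ?_
  rw [modeNorm, ← lintegral_add_right_eq_self _ (omega k),
    ← lintegral_const_mul' _ _ (by finiteness)]
  refine lintegral_congr fun σ => ?_
  rw [add_sub_cancel_right, enorm_mul, mul_pow, Complex.ofReal_mul, enorm_mul,
    enorm_ofReal (Real.rpow_nonneg (bracket_pos _).le _),
    enorm_ofReal (Real.rpow_nonneg (bracket_pos _).le _)]
  ring

/-- The profile is `g(σ, k) = a(k, σ + ω_k) / 2π`, taken in a measurable representative; the factor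
`1/2π ≤ 1` is dropped from the norm. -/
lemma IsSpaceTimeFourier.exists_profile {v : ℝ → L2} {a : ℤ × ℝ → ℂ} (h : IsSpaceTimeFourier v a)
    (s b : ℝ) : ∃ g, IsProfile v g ∧ profNorm s b g ≤
      eLpNorm (fun p : ℤ × ℝ => ((bracket p.1 ^ s * bracket (p.2 - omega p.1) ^ b : ℝ) : ℂ) * a p)
        2 (Measure.count.prod volume) ^ 2 := by
  set c : ℂ := 1 / (2 * Real.pi) with hc
  have hI : ∀ k, Integrable fun σ => a (k, σ + omega k) := fun k =>
    (h.integrable k).comp_add_right _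
  set g : ℝ → ℤ → ℂ := fun σ k => c * (hI k).aestronglyMeasurable.mk _ σ with hg
  have hae : ∀ k, (fun σ => g σ k) =ᵐ[volume] fun σ => c * a (k, σ + omega k) := fun k =>
    (hI k).aestronglyMeasurable.ae_eq_mk.mono fun σ hσ => by simp only [hg, ← hσ]
  refine ⟨g, ⟨fun k => ?_, fun k => ((hI k).const_mul c).congr (hae k).symm, fun t k => ?_⟩, ?_⟩
  · exact (hI k).aestronglyMeasurable.stronglyMeasurable_mk.measurable.const_mul c
  · have h1 : ∫ σ : ℝ, g σ k * Complex.exp (Complex.I * σ * t) =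
        ∫ σ : ℝ, c * a (k, σ + omega k) * Complex.exp (Complex.I * σ * t) :=
      integral_congr_ae ((hae k).mono fun σ hσ => by simp only [hσ])
    rw [h.inversion t k, h1, ← integral_add_right_eq_self _ (omega k), ← integral_const_mul,
      ← integral_const_mul]
    refine integral_congr_ae (ae_of_all _ fun σ => ?_)
    have : Complex.exp (Complex.I * (σ + omega k : ℝ) * t) =
        Complex.exp (Complex.I * t * omega k) * Complex.exp (Complex.I * σ * t) := by
      rw [← Complex.exp_add]
      congr 1
      push_cast
      ring
    simp only [this]
    ring
  · rw [eLpNorm_bourgain_sq h.aestronglyMeasurable, profNorm]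
    refine ENNReal.tsum_le_tsum fun k => mul_le_mul_right ?_ _
    rw [modeNorm_congr (hae k), modeNorm_const_mul]
    refine mul_le_of_le_one_left' ?_
    have hc1 : ‖c‖ ≤ 1 := by
      rw [hc, norm_div, norm_one, show (2 * Real.pi : ℂ) = ((2 * Real.pi : ℝ) : ℂ) by push_cast; rfl,
        Complex.norm_real, Real.norm_of_nonneg Real.two_pi_pos.le, div_le_one Real.two_pi_pos]
      linarith [Real.pi_gt_three]
    refine pow_le_one' ?_ 2
    rw [← ofReal_norm]
    exact ENNReal.ofReal_le_one.mpr hc1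

lemma IsProfile.bourgainENorm_sq_le {v : ℝ → L2} {g : ℝ → ℤ → ℂ} (h : IsProfile v g) (s b : ℝ) :
    bourgainENorm s b v ^ 2 ≤ ENNReal.ofReal ((2 * Real.pi) ^ 2) * profNorm s b g := by
  set a : ℤ × ℝ → ℂ := fun p => (2 * Real.pi : ℝ) * g (p.2 - omega p.1) p.1 with ha
  have hm : Measurable a := by
    refine measurable_from_prod_countable_right fun k => ?_
    have h1 : Measurable fun σ => g (σ - omega k) k :=
      (h.measurable k).comp (measurable_id.sub_const _)
    exact h1.const_mul _
  have hF : IsSpaceTimeFourier v a := by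
    refine ⟨hm.aestronglyMeasurable, fun k => ?_, fun t k => ?_⟩
    · have h1 : Integrable fun σ => g (σ - omega k) k := (h.integrable k).comp_sub_right (omega k)
      exact h1.const_mul _
    rw [h.eq t k, ← integral_add_right_eq_self (fun σ => a (k, σ) * _) (omega k),
      ← integral_const_mul, ← integral_const_mul]
    refine integral_congr_ae (ae_of_all _ fun σ => ?_)
    have : Complex.exp (Complex.I * (σ + omega k : ℝ) * t) =
        Complex.exp (Complex.I * t * omega k) * Complex.exp (Complex.I * σ * t) := by
      rw [← Complex.exp_add]
      congr 1
      push_cast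
      ring
    have hpi : (2 * Real.pi : ℂ) ≠ 0 := by
      exact_mod_cast Real.two_pi_pos.ne'
    simp only [this, ha, add_sub_cancel_right]
    push_cast
    field_simp
  have h1 : bourgainENorm s b v ≤ eLpNorm (fun p : ℤ × ℝ =>
      ((bracket p.1 ^ s * bracket (p.2 - omega p.1) ^ b : ℝ) : ℂ) * a p)
      2 (Measure.count.prod volume) := iInf₂_le a hF
  refine (pow_le_pow_left' h1 2).trans_eq ?_
  rw [eLpNorm_bourgain_sq hm.aestronglyMeasurable, profNorm, ← ENNReal.tsum_mul_left]
  refine tsum_congr fun k => ?_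
  simp only [ha, add_sub_cancel_right]
  rw [modeNorm_const_mul, enorm_ofReal Real.two_pi_pos.le,
    ENNReal.ofReal_pow Real.two_pi_pos.le]
  ring

lemma profNorm_zero_left (b : ℝ) {g : ℝ → ℤ → ℂ} (hg : ∀ k, Measurable fun σ => g σ k) :
    profNorm 0 b g = ∫⁻ σ, ENNReal.ofReal (bracket σ ^ b) ^ 2 * sqNorm (g σ) := by
  simp only [profNorm, Real.rpow_zero, ENNReal.ofReal_one, one_pow, one_mul, modeNorm, sqNorm,
    ← ENNReal.tsum_mul_left]
  rw [lintegral_tsum fun k => ?_]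
  exact (((continuous_bracket_rpow b).measurable.ennreal_ofReal.pow_const 2).mul
    ((hg k).enorm.pow_const 2)).aemeasurable

lemma profNorm_mono {s s' : ℝ} (h : s' ≤ s) (b : ℝ) (g : ℝ → ℤ → ℂ) :
    profNorm s' b g ≤ profNorm s b g := by
  unfold profNorm
  gcongr
  exact one_le_bracket _

lemma IsProfile.add {v w : ℝ → L2} {g h : ℝ → ℤ → ℂ} (hv : IsProfile v g) (hw : IsProfile w h) :
    IsProfile (fun t => v t + w t) (fun σ k => g σ k + h σ k) := by
  have hexp : ∀ t : ℝ, ∀ {φ : ℝ → ℂ}, Integrable φ →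
      Integrable fun σ : ℝ => φ σ * Complex.exp (Complex.I * σ * t) := fun t φ hφ =>
    hφ.mul_bdd (c := 1) (by fun_prop) (ae_of_all _ fun σ => (norm_exp_I_mul σ t).le)
  refine ⟨fun k => (hv.measurable k).add (hw.measurable k),
    fun k => (hv.integrable k).add (hw.integrable k), fun t k => ?_⟩
  rw [fourierCoeff_add, hv.eq, hw.eq, ← mul_add]
  simp only [add_mul]
  rw [integral_add (hexp t (hv.integrable k)) (hexp t (hw.integrable k))]

lemma profNorm_add_le (s b : ℝ) {g h : ℝ → ℤ → ℂ} (hg : ∀ k, Measurable fun σ => g σ k) :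
    profNorm s b (fun σ k => g σ k + h σ k) ≤ 2 * profNorm s b g + 2 * profNorm s b h := by
  simp only [profNorm, ← ENNReal.tsum_mul_left, ← ENNReal.tsum_add]
  refine ENNReal.tsum_le_tsum fun k => ?_
  have : modeNorm b (fun σ => g σ k + h σ k) ≤
      2 * modeNorm b (fun σ => g σ k) + 2 * modeNorm b (fun σ => h σ k) := by
    simp only [modeNorm]
    rw [← lintegral_const_mul' _ _ (by norm_num), ← lintegral_const_mul' _ _ (by norm_num),
      ← lintegral_add_left]
    · refine lintegral_mono fun σ => (mul_le_mul_right (enorm_add_sq_le _ _) _).trans_eq ?_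
      ring
    · exact ((((continuous_bracket_rpow b).measurable.ennreal_ofReal.pow_const 2).mul
        ((hg k).enorm.pow_const 2))).const_mul _
  refine (mul_le_mul_right this _).trans_eq ?_
  ring

lemma IsProfile.multiplier {v w : ℝ → L2} {g : ℝ → ℤ → ℂ} (hv : IsProfile v g) {m : ℤ → ℂ}
    (hw : ∀ t k, fourierCoeff (w t) k = m k * fourierCoeff (v t) k) :
    IsProfile w (fun σ k => m k * g σ k) := by
  refine ⟨fun k => (hv.measurable k).const_mul _, fun k => (hv.integrable k).const_mul _,
    fun t k => ?_⟩
  simp only [hw, hv.eq, mul_assoc, integral_const_mul]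
  ring

lemma profNorm_multiplier (s b : ℝ) (g : ℝ → ℤ → ℂ) (m : ℤ → ℂ) :
    profNorm s b (fun σ k => m k * g σ k) =
      ∑' k, ‖m k‖ₑ ^ 2 * (ENNReal.ofReal (bracket k ^ s) ^ 2 * modeNorm b fun σ => g σ k) := by
  simp only [profNorm, modeNorm_const_mul]
  exact tsum_congr fun k => by ring

lemma profNorm_multiplier_le (s b : ℝ) (g : ℝ → ℤ → ℂ) {m : ℤ → ℂ} (hm : ∀ k, ‖m k‖ₑ ≤ 1) :
    profNorm s b (fun σ k => m k * g σ k) ≤ profNorm s b g := by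
  rw [profNorm_multiplier]
  exact ENNReal.tsum_le_tsum fun k => mul_le_of_le_one_left' (pow_le_one' (hm k) 2)

/-! ### Embedding of Bourgain spaces -/

/-- `∫ ⟨σ⟩^{-2b} dσ`. -/
def weightConst (b : ℝ) : ℝ≥0∞ := ∫⁻ σ, ENNReal.ofReal (bracket σ ^ (-b)) ^ 2

lemma weightConst_lt_top {b : ℝ} (hb : 1 / 2 < b) : weightConst b < ⊤ := by
  have h := integrable_rpow_neg_one_add_norm_sq (E := ℝ) (μ := volume) (r := 2 * b)
    (by simp; linarith)
  have h2 := h.lintegral_lt_top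
  refine lt_of_eq_of_lt (lintegral_congr fun σ => ?_) h2
  rw [← ENNReal.ofReal_pow (Real.rpow_nonneg (bracket_pos _).le _)]
  congr 1
  have hpos : (0 : ℝ) ≤ 1 + σ ^ 2 := by positivity
  rw [bracket, Real.sqrt_eq_rpow, ← Real.rpow_natCast, ← Real.rpow_mul hpos,
    ← Real.rpow_mul hpos, Real.norm_eq_abs, sq_abs]
  congr 1
  push_cast
  ring

/-- Cauchy-Schwarz for `⟨σ⟩^{-b} · ⟨σ⟩^b |φ|`. The condition `b > 1/2` enters the whole proof only
through the finiteness of `weightConst b`. -/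
lemma lintegral_enorm_sq_le_weight (b : ℝ) {φ : ℝ → ℂ} (hφ : Measurable φ) :
    (∫⁻ σ, ‖φ σ‖ₑ) ^ 2 ≤ weightConst b * modeNorm b φ := by
  have hm : ∀ b : ℝ, Measurable fun σ => ENNReal.ofReal (bracket σ ^ b) := fun b =>
    (continuous_bracket_rpow b).measurable.ennreal_ofReal
  have h := lintegral_mul_sq_le volume (hm (-b)).aemeasurable
    ((hm b).mul hφ.enorm).aemeasurable
  have h1 : ∀ σ, ENNReal.ofReal (bracket σ ^ (-b)) * (ENNReal.ofReal (bracket σ ^ b) * ‖φ σ‖ₑ)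
      = ‖φ σ‖ₑ := by
    intro σ
    rw [← mul_assoc, ← ENNReal.ofReal_mul (Real.rpow_nonneg (bracket_pos _).le _),
      ← Real.rpow_add (bracket_pos _), neg_add_cancel, Real.rpow_zero, ENNReal.ofReal_one, one_mul]
  simp only [Pi.mul_apply, h1, mul_pow] at h
  exact h

lemma enorm_integral_exp_sq_le (b t : ℝ) {φ : ℝ → ℂ} (hφ : Measurable φ) :
    ‖∫ σ : ℝ, φ σ * Complex.exp (Complex.I * σ * t)‖ₑ ^ 2 ≤ weightConst b * modeNorm b φ := by
  refine le_trans (pow_le_pow_left' ?_ 2) (lintegral_enorm_sq_le_weight b hφ)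
  refine (enorm_integral_le_lintegral_enorm _).trans_eq (lintegral_congr fun σ => ?_)
  rw [enorm_mul, enorm_exp_I_mul, mul_one]

lemma IsProfile.enorm_fourierCoeff_sq_le {v : ℝ → L2} {g : ℝ → ℤ → ℂ} (h : IsProfile v g)
    (b t : ℝ) (k : ℤ) :
    ‖fourierCoeff (v t) k‖ₑ ^ 2 ≤ weightConst b * modeNorm b fun σ => g σ k := by
  rw [h.eq, enorm_mul, enorm_exp_I_mul, one_mul]
  exact enorm_integral_exp_sq_le b t (h.measurable k)

lemma IsProfile.enorm_sq_le {v : ℝ → L2} {g : ℝ → ℤ → ℂ} (h : IsProfile v g) (b t : ℝ) :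
    ‖v t‖ₑ ^ 2 ≤ weightConst b * profNorm 0 b g := by
  rw [enorm_sq_eq_sqNorm, sqNorm, profNorm, ← ENNReal.tsum_mul_left]
  refine ENNReal.tsum_le_tsum fun k => ?_
  simpa using h.enorm_fourierCoeff_sq_le b t k

lemma IsProfile.continuous_fourierCoeff {v : ℝ → L2} {g : ℝ → ℤ → ℂ} (h : IsProfile v g) (k : ℤ) :
    Continuous fun t => fourierCoeff (v t) k := by
  simp only [h.eq]
  refine Continuous.mul (by fun_prop) ?_
  refine continuous_of_dominated (bound := fun σ => ‖g σ k‖) (fun t => ?_) (fun t => ?_)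
    (h.integrable k).norm (ae_of_all _ fun σ => by fun_prop)
  · exact (h.measurable k).aestronglyMeasurable.mul (by fun_prop)
  · exact ae_of_all _ fun σ => by rw [norm_mul, norm_exp_I_mul, mul_one]

/-- The weight in the superposition of free solutions which represents an element of `X^{0,b}`. -/
def profWeight (b σ : ℝ) : ℝ≥0∞ := weightConst b * ENNReal.ofReal (bracket σ ^ b) ^ 2

lemma measurable_profWeight (b : ℝ) : Measurable (profWeight b) :=
  ((continuous_bracket_rpow b).measurable.ennreal_ofReal.pow_const 2).const_mul _

lemma lintegral_profWeight (b : ℝ) {g : ℝ → ℤ → ℂ} (hg : ∀ k, Measurable fun σ => g σ k) :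
    ∫⁻ σ, profWeight b σ * sqNorm (g σ) = weightConst b * profNorm 0 b g := by
  rw [profNorm_zero_left b hg, ← lintegral_const_mul
    (f := fun σ => ENNReal.ofReal (bracket σ ^ b) ^ 2 * sqNorm (g σ)) _
    (((continuous_bracket_rpow b).measurable.ennreal_ofReal.pow_const 2).mul (measurable_sqNorm hg))]
  simp only [profWeight, mul_assoc]

/-- At each point, `v` is an integral over `σ` of free solutions with data `g σ`, times unimodular
factors. The weighted Cauchy-Schwarz inequality puts the square inside the integral. -/
lemma IsProfile.enorm_trigSum_sq_le {v : ℝ → L2} {g : ℝ → ℤ → ℂ} (h : IsProfile v g) (b : ℝ)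
    (n : ℕ) (t : ℝ) (x : Torus) : ‖trigSum n (fourierCoeff (v t)) x‖ₑ ^ 2 ≤
      ∫⁻ σ, profWeight b σ * ‖trigSum n (free (g σ) t) x‖ₑ ^ 2 := by
  have hφ : Measurable fun σ => trigSum n (free (g σ) t) x :=
    Finset.measurable_sum _ fun k _ => ((h.measurable k).const_mul _).mul_const _
  have h1 : trigSum n (fourierCoeff (v t)) x =
      ∫ σ : ℝ, trigSum n (free (g σ) t) x * Complex.exp (Complex.I * σ * t) := by
    simp only [trigSum, Finset.sum_mul]
    rw [integral_finsetSum]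
    · refine Finset.sum_congr rfl fun k _ => ?_
      rw [h.eq, mul_right_comm, ← integral_const_mul]
      exact integral_congr_ae (ae_of_all _ fun σ => by simp only [free]; ring)
    · intro k _
      have := ((h.integrable k).mul_bdd (c := 1) (g := fun σ : ℝ =>
        Complex.exp (Complex.I * σ * t)) (by fun_prop)
        (ae_of_all _ fun σ => (norm_exp_I_mul σ t).le)).const_mul
        (Complex.exp (Complex.I * t * omega k) * fourier k x)
      exact this.congr (ae_of_all _ fun σ => by simp only [free]; ring)
  rw [h1]
  refine (enorm_integral_exp_sq_le b t hφ).trans_eq ?_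
  rw [modeNorm, ← lintegral_const_mul (f := fun σ => ENNReal.ofReal (bracket σ ^ b) ^ 2 *
    ‖trigSum n (free (g σ) t) x‖ₑ ^ 2) _
    (((continuous_bracket_rpow b).measurable.ennreal_ofReal.pow_const 2).mul (hφ.enorm.pow_const 2))]
  simp only [profWeight, mul_assoc]

lemma IsProfile.strichartzBound {v : ℝ → L2} {g : ℝ → ℤ → ℂ} (h : IsProfile v g) (b T : ℝ) :
    StrichartzBound T (strichartzConst T * (weightConst b * profNorm 0 b g))
      (fun t => fourierCoeff (v t)) := by
  rw [← lintegral_profWeight b h.measurable]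
  exact strichartzBound_of_superposition le_rfl (fun k => (h.continuous_fourierCoeff k).measurable)
    h.measurable (measurable_profWeight b) fun n t _ x => h.enorm_trigSum_sq_le b n t x

lemma sobolevENorm_sq (s : ℝ) (f : L2) : sobolevENorm s f ^ 2 =
    ∑' k : ℤ, ENNReal.ofReal (bracket k ^ s) ^ 2 * ‖fourierCoeff f k‖ₑ ^ 2 := by
  rw [sobolevENorm, eLpNorm_eq_lintegral_rpow_enorm_toReal (by norm_num) (by norm_num)]
  simp only [ENNReal.toReal_ofNat, ENNReal.rpow_two, one_div]
  rw [← ENNReal.rpow_two, ← ENNReal.rpow_mul, inv_mul_cancel₀ two_ne_zero, ENNReal.rpow_one,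
    lintegral_count]
  refine tsum_congr fun k => ?_
  rw [enorm_mul, mul_pow, enorm_ofReal (Real.rpow_nonneg (bracket_pos _).le _)]

lemma sobolevENorm_zero (f : L2) : sobolevENorm 0 f = ‖f‖ₑ := by
  have h : sobolevENorm 0 f ^ 2 = ‖f‖ₑ ^ 2 := by
    rw [sobolevENorm_sq, enorm_sq_eq_sqNorm]
    simp [sqNorm]
  exact le_antisymm ((ENNReal.pow_le_pow_left_iff two_ne_zero).mp h.le)
    ((ENNReal.pow_le_pow_left_iff two_ne_zero).mp h.ge)

lemma IsProfile.memSobolev {v : ℝ → L2} {g : ℝ → ℤ → ℂ} (h : IsProfile v g) {s b : ℝ}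
    (hb : 1 / 2 < b) (hfin : profNorm s b g < ⊤) (t : ℝ) : MemSobolev s (v t) := by
  refine lt_top_of_sq_lt_top ?_
  rw [sobolevENorm_sq]
  refine lt_of_le_of_lt ?_ (ENNReal.mul_lt_top (weightConst_lt_top hb) hfin)
  rw [profNorm, ← ENNReal.tsum_mul_left]
  refine ENNReal.tsum_le_tsum fun k => ?_
  refine (mul_le_mul_right (h.enorm_fourierCoeff_sq_le b t k) _).trans_eq ?_
  ring

/-- Each coefficient is continuous in time, and the coefficients are bounded uniformly in time by a
summable sequence, so dominated convergence applies over `k`. -/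
lemma IsProfile.tendsto_sobolevENorm {v : ℝ → L2} {g : ℝ → ℤ → ℂ} (h : IsProfile v g) {s b : ℝ}
    (hb : 1 / 2 < b) (hfin : profNorm s b g < ⊤) (t : ℝ) :
    Tendsto (fun r => sobolevENorm s (v r - v t)) (𝓝 t) (𝓝 0) := by
  have key : Tendsto (fun r => sobolevENorm s (v r - v t) ^ 2) (𝓝 t) (𝓝 0) := by
    simp only [sobolevENorm_sq]
    simp only [← lintegral_count]
    have h0 : (0 : ℝ≥0∞) = ∫⁻ _ : ℤ, 0 ∂Measure.count := by simp
    rw [h0]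
    refine tendsto_lintegral_filter_of_dominated_convergence (fun k : ℤ =>
      4 * weightConst b * (ENNReal.ofReal (bracket k ^ s) ^ 2 * modeNorm b fun σ => g σ k))
      (Eventually.of_forall fun r => measurable_from_top)
      (Eventually.of_forall fun r => ae_of_all _ fun k => ?_) ?_ (ae_of_all _ fun k => ?_)
    · have h1 := h.enorm_fourierCoeff_sq_le b r k
      have h2 := h.enorm_fourierCoeff_sq_le b t k
      rw [fourierCoeff_sub]
      refine (mul_le_mul_right ((enorm_sub_sq_le _ _).trans (add_le_add (mul_le_mul_right h1 _)
        (mul_le_mul_right h2 _))) _).trans_eq ?_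
      ring
    · rw [lintegral_count, ENNReal.tsum_mul_left]
      exact (ENNReal.mul_lt_top (ENNReal.mul_lt_top (by norm_num) (weightConst_lt_top hb))
        hfin).ne
    · have hc : Continuous fun r => ENNReal.ofReal (bracket k ^ s) ^ 2 *
          ‖fourierCoeff (v r - v t : L2) k‖ₑ ^ 2 := by
        have := h.continuous_fourierCoeff k
        simp only [fourierCoeff_sub]
        refine ENNReal.continuous_const_mul (by finiteness) |>.comp ?_
        fun_prop
      have := hc.tendsto t
      rw [fourierCoeff_sub, sub_self, enorm_zero] at this
      simpa using this
  have h2 := (ENNReal.continuous_rpow_const (y := 1 / 2)).continuousAt.tendsto.comp key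
  simp only [ENNReal.zero_rpow_of_pos one_half_pos] at h2
  refine h2.congr fun r => ?_
  simp only [Function.comp_apply]
  rw [← ENNReal.rpow_natCast, ← ENNReal.rpow_mul]
  norm_num

lemma IsProfile.continuous {v : ℝ → L2} {g : ℝ → ℤ → ℂ} (h : IsProfile v g) {b : ℝ}
    (hb : 1 / 2 < b) (hfin : profNorm 0 b g < ⊤) : Continuous v := by
  rw [continuous_iff_continuousAt]
  intro t
  have := h.tendsto_sobolevENorm hb hfin t
  simp only [sobolevENorm_zero] at this
  rw [ContinuousAt, tendsto_iff_edist_tendsto_0]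
  simpa only [edist_eq_enorm_sub] using this

lemma MemLocalBourgain.exists_profile {s b T : ℝ} {u : ℝ → L2} (h : MemLocalBourgain s b T u) :
    ∃ (v : ℝ → L2) (g : ℝ → ℤ → ℂ), EqOn v u (Icc 0 T) ∧ IsProfile v g ∧ profNorm s b g < ⊤ := by
  simp only [MemLocalBourgain, localBourgainENorm, bourgainENorm, iInf_lt_iff] at h
  obtain ⟨v, hv, a, ha, hlt⟩ := h
  obtain ⟨g, hg, hle⟩ := ha.exists_profile s b
  exact ⟨v, g, hv, hg, hle.trans_lt (ENNReal.pow_lt_top hlt)⟩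

lemma IsProfile.localBourgainENorm_sq_le {v u : ℝ → L2} {g : ℝ → ℤ → ℂ} (h : IsProfile v g)
    (s b : ℝ) {T : ℝ} (hu : EqOn v u (Icc 0 T)) :
    localBourgainENorm s b T u ^ 2 ≤ ENNReal.ofReal ((2 * Real.pi) ^ 2) * profNorm s b g :=
  (pow_le_pow_left' (iInf₂_le v hu) 2).trans (h.bourgainENorm_sq_le s b)

lemma IsProfile.memLocalBourgain {v u : ℝ → L2} {g : ℝ → ℤ → ℂ} (h : IsProfile v g)
    {s b T : ℝ} (hu : EqOn v u (Icc 0 T)) (hfin : profNorm s b g < ⊤) :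
    MemLocalBourgain s b T u := by
  exact lt_top_of_sq_lt_top <| (h.localBourgainENorm_sq_le s b hu).trans_lt
    (ENNReal.mul_lt_top ENNReal.ofReal_lt_top hfin)

lemma IsSpaceTimeFourier.enorm_sq_le {v : ℝ → L2} {a : ℤ × ℝ → ℂ} (h : IsSpaceTimeFourier v a)
    (b t : ℝ) : ‖v t‖ₑ ^ 2 ≤ weightConst b *
      eLpNorm (fun p : ℤ × ℝ => ((bracket p.1 ^ (0 : ℝ) * bracket (p.2 - omega p.1) ^ b : ℝ) : ℂ) *
        a p) 2 (Measure.count.prod volume) ^ 2 := by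
  obtain ⟨g, hg, hle⟩ := h.exists_profile 0 b
  exact (hg.enorm_sq_le b t).trans (mul_le_mul_right hle _)

/-- The embedding `X^{0,b}(T) ⊂ L^∞([0,T], L²)`, with a constant which only depends on `b`. -/
lemma exists_enorm_le_localBourgainENorm {b : ℝ} (hb : 1 / 2 < b) : ∃ K : ℝ, 0 < K ∧
    ∀ (T : ℝ) (u : ℝ → L2), ∀ t ∈ Icc 0 T,
      ‖u t‖ₑ ≤ ENNReal.ofReal K * localBourgainENorm 0 b T u := by
  set K : ℝ := Real.sqrt (weightConst b).toReal + 1 with hK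
  have hK0 : 0 < K := by positivity
  have hle : weightConst b ≤ ENNReal.ofReal K ^ 2 := by
    rw [← ENNReal.ofReal_pow hK0.le, ← ENNReal.ofReal_toReal (weightConst_lt_top hb).ne]
    refine ENNReal.ofReal_le_ofReal ?_
    have h1 := Real.sq_sqrt (ENNReal.toReal_nonneg (a := weightConst b))
    have h2 := Real.sqrt_nonneg (weightConst b).toReal
    nlinarith
  refine ⟨K, hK0, fun T u t ht => ?_⟩
  have hK' : ENNReal.ofReal K ≠ 0 := by simpa using hK0
  refine le_of_le_of_eq ?_ (mul_comm (localBourgainENorm 0 b T u) (ENNReal.ofReal K))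
  -- With the constant moved to the left, the right side is a bare infimum and it suffices to bound
  -- each competitor.
  rw [← ENNReal.div_le_iff_le_mul (Or.inl hK') (Or.inl ENNReal.ofReal_ne_top)]
  refine le_iInf₂ fun v hv => le_iInf₂ fun a ha => ?_
  rw [ENNReal.div_le_iff_le_mul (Or.inl hK') (Or.inl ENNReal.ofReal_ne_top), ← hv ht,
    ← ENNReal.pow_le_pow_left_iff two_ne_zero, mul_pow]
  exact (ha.enorm_sq_le b t).trans ((mul_le_mul_left hle _).trans_eq (mul_comm _ _))

lemma continuousInSobolev_of_memLocalBourgain {s b T : ℝ} (hb : 1 / 2 < b) {u : ℝ → L2}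
    (h : MemLocalBourgain s b T u) : ContinuousInSobolev s T u := by
  obtain ⟨v, g, hv, hg, hfin⟩ := h.exists_profile
  refine ⟨fun t ht => hv ht ▸ hg.memSobolev hb hfin t, fun t ht => ?_⟩
  refine ((hg.tendsto_sobolevENorm hb hfin t).mono_left nhdsWithin_le_nhds).congr' ?_
  filter_upwards [self_mem_nhdsWithin] with r hr
  rw [hv ht, hv hr]

/-! ### Passage to the limit in the truncations -/

/-- Fatou's lemma along a subsequence converging almost everywhere. The first extraction, on which
`pair` stays below some `c < pair f g`, makes the later extractions harmless. -/
lemma pair_le_liminf {f g : L2} {F G : ℕ → L2} (hF : Tendsto F atTop (𝓝 f))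
    (hG : Tendsto G atTop (𝓝 g)) :
    pair f g ≤ liminf (fun n => pair (F n) (G n)) atTop := by
  by_contra! hlt
  obtain ⟨c, hc1, hc2⟩ := exists_between hlt
  obtain ⟨φ, hφ, hφc⟩ := extraction_of_frequently_atTop
    (frequently_lt_of_liminf_lt (by isBoundedDefault) hc1)
  have hFm := tendstoInMeasure_of_tendsto_Lp (hF.comp hφ.tendsto_atTop)
  obtain ⟨ψ, hψ, hFae⟩ := hFm.exists_seq_tendsto_ae
  have hGm := tendstoInMeasure_of_tendsto_Lp ((hG.comp hφ.tendsto_atTop).comp hψ.tendsto_atTop)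
  obtain ⟨χ, hχ, hGae⟩ := hGm.exists_seq_tendsto_ae
  have hle : pair f g ≤ liminf (fun n => pair (F (φ (ψ (χ n)))) (G (φ (ψ (χ n))))) atTop := by
    refine le_trans (lintegral_mono_ae ?_) (lintegral_liminf_le' fun n =>
      (aemeasurable_enorm_sq (F (φ (ψ (χ n))))).mul (aemeasurable_enorm_sq (G (φ (ψ (χ n))))))
    filter_upwards [hFae, hGae] with x hx1 hx2
    have h1 : Tendsto (fun n => ‖F (φ (ψ (χ n))) x‖ₑ ^ 2) atTop (𝓝 (‖f x‖ₑ ^ 2)) :=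
      ((ENNReal.continuous_pow 2).tendsto _).comp ((hx1.comp hχ.tendsto_atTop).enorm)
    have h2 : Tendsto (fun n => ‖G (φ (ψ (χ n))) x‖ₑ ^ 2) atTop (𝓝 (‖g x‖ₑ ^ 2)) :=
      ((ENNReal.continuous_pow 2).tendsto _).comp hx2.enorm
    exact (ENNReal.Tendsto.mul h1 (Or.inr (by finiteness)) h2 (Or.inr (by finiteness))).liminf_eq.ge
  refine absurd (hle.trans (liminf_le_of_frequently_le' (x := c) ?_)) hc2.not_ge
  exact (Eventually.of_forall fun n => (hφc _).le).frequently

lemma pair_congr {f f' g g' : Torus → ℂ} (hf : f =ᵐ[AddCircle.haarAddCircle] f')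
    (hg : g =ᵐ[AddCircle.haarAddCircle] g') : pair f g = pair f' g' :=
  lintegral_congr_ae (by filter_upwards [hf, hg] with x h1 h2; rw [h1, h2])

lemma coeFn_ofCoeff (n : ℕ) (c : ℤ → ℂ) :
    (ofCoeff (Finset.Icc (-(n : ℤ)) n) c : L2) =ᵐ[AddCircle.haarAddCircle] trigSum n c := by
  have h : ∀ S : Finset ℤ, (ofCoeff S c : L2) =ᵐ[AddCircle.haarAddCircle]
      fun x => ∑ k ∈ S, c k * fourier k x := by
    intro S
    classical
    induction S using Finset.induction_on with
    | empty =>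
      simp only [ofCoeff, Finset.sum_empty]
      exact Lp.coeFn_zero _ _ _
    | insert k S hk ih =>
      have h1 : ofCoeff (insert k S) c = c k • (fourierLp 2 k : L2) + ofCoeff S c := by
        simp only [ofCoeff, Finset.sum_insert hk]
      rw [h1]
      filter_upwards [Lp.coeFn_add (c k • (fourierLp 2 k : L2)) (ofCoeff S c),
        Lp.coeFn_smul (c k) (fourierLp 2 k : L2), coeFn_fourierLp 2 k, ih] with x h2 h3 h4 h5
      rw [h2, Pi.add_apply, h3, Pi.smul_apply, h4, h5, Finset.sum_insert hk, smul_eq_mul]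
  exact h _

lemma pair_le_liminf_trigSum (f g : L2) : pair f g ≤
    liminf (fun n => pair (trigSum n (fourierCoeff f)) (trigSum n (fourierCoeff g))) atTop := by
  have h : ∀ f : L2, Tendsto (fun n : ℕ => ofCoeff (Finset.Icc (-(n : ℤ)) n) (fourierCoeff f))
      atTop (𝓝 f) := fun f =>
    (hasSum_fourier_series_L2 f).comp Finset.tendsto_Icc_neg
  refine (pair_le_liminf (h f) (h g)).trans_eq ?_
  simp only [pair_congr (coeFn_ofCoeff _ (fourierCoeff f)) (coeFn_ofCoeff _ (fourierCoeff g))]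

lemma measurable_pair_trigSum (n : ℕ) {c d : ℝ → ℤ → ℂ} (hc : ∀ k, Measurable fun t => c t k)
    (hd : ∀ k, Measurable fun t => d t k) :
    Measurable fun t => pair (trigSum n (c t)) (trigSum n (d t)) :=
  Measurable.lintegral_prod_right' (f := fun z : ℝ × Torus =>
    ‖trigSum n (c z.1) z.2‖ₑ ^ 2 * ‖trigSum n (d z.1) z.2‖ₑ ^ 2)
    (((measurable_trigSum n hc).enorm.pow_const 2).mul ((measurable_trigSum n hd).enorm.pow_const 2))

/-- Bilinear bounds are proved for trigonometric truncations uniformly in `n`. Lower semicontinuity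
in space and Fatou's lemma in time carry them to the limit, without any measurability of `pair (u t)
(v t)`. -/
lemma lintegral_pair_le_of_trigSum {T : ℝ} {u v : ℝ → L2} {c d : ℝ → ℤ → ℂ} {ρ : ℝ → ℝ≥0∞}
    {B : ℝ≥0∞} (hc : ∀ k, Measurable fun t => c t k) (hd : ∀ k, Measurable fun t => d t k)
    (hρ : Measurable ρ) (hρ' : ∀ t, ρ t ≠ ⊤)
    (hu : ∀ t ∈ Icc 0 T, ∀ k, fourierCoeff (u t) k = c t k)
    (hv : ∀ t ∈ Icc 0 T, ∀ k, fourierCoeff (v t) k = d t k)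
    (h : ∀ n, ∫⁻ t in Icc 0 T, ρ t * pair (trigSum n (c t)) (trigSum n (d t)) ≤ B) :
    ∫⁻ t in Icc 0 T, ρ t * pair (u t) (v t) ≤ B := by
  calc ∫⁻ t in Icc 0 T, ρ t * pair (u t) (v t)
      ≤ ∫⁻ t in Icc 0 T,
          liminf (fun n => ρ t * pair (trigSum n (c t)) (trigSum n (d t))) atTop := by
        refine setLIntegral_mono' measurableSet_Icc fun t ht => ?_
        rw [ENNReal.liminf_const_mul_of_ne_top (hρ' t), ← funext (hu t ht), ← funext (hv t ht)]
        exact mul_le_mul_right (pair_le_liminf_trigSum (u t) (v t)) _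
    _ ≤ liminf (fun n => ∫⁻ t in Icc 0 T, ρ t * pair (trigSum n (c t)) (trigSum n (d t))) atTop :=
        lintegral_liminf_le fun n => hρ.mul (measurable_pair_trigSum n hc hd)
    _ ≤ B := liminf_le_of_frequently_le' (Eventually.of_forall h).frequently

/-- The bilinear Strichartz estimate in Bourgain spaces. -/
lemma IsProfile.lintegral_pair_le {u w w' : ℝ → L2} {c : ℝ → ℤ → ℂ} {g : ℝ → ℤ → ℂ} {T : ℝ}
    {M : ℝ≥0∞} (hc : StrichartzBound T M c)
    (hu : ∀ t ∈ Icc 0 T, ∀ k, fourierCoeff (u t) k = c t k) (hg : IsProfile w g)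
    (hw : EqOn w w' (Icc 0 T)) (b : ℝ) :
    ∫⁻ t in Icc 0 T, pair (u t) (w' t) ≤ M * (weightConst b * profNorm 0 b g) := by
  have key := lintegral_pair_le_of_trigSum (ρ := fun _ => 1) (v := w')
    (B := M * (weightConst b * profNorm 0 b g)) hc.measurable
    (fun k => (hg.continuous_fourierCoeff k).measurable) measurable_const
    (by simp) hu (fun t ht k => by rw [hw ht]) fun n => ?_
  · simpa only [one_mul] using key
  · rw [← lintegral_profWeight b hg.measurable]
    exact hc.lintegral_superposition_le hg.measurable (by simp) (measurable_profWeight b) n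
      fun t _ x => by simpa only [one_mul] using hg.enorm_trigSum_sq_le b n t x

/-! ### Duhamel terms -/

/-- The Fourier coefficients of `∫₀ᵗ e^{i(t-θ)⟨∂ₓ²⟩} F(θ) dθ`. -/
def duhamel (F : ℝ → ℤ → ℂ) (t : ℝ) (k : ℤ) : ℂ :=
  Complex.exp (Complex.I * t * omega k) *
    ∫ θ in (0 : ℝ)..t, Complex.exp (-(Complex.I * θ * omega k)) * F θ k

/-- `d(t) = ∫₀ᵗ e^{i(t-θ)⟨∂ₓ²⟩} F(θ) dθ` on `[0,T]`. -/
structure IsDuhamel (T : ℝ) (F : ℝ → ℤ → ℂ) (d : ℝ → L2) : Prop where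
  measurable : ∀ k, Measurable fun θ => F θ k
  integrable : ∀ k, Integrable fun θ => F θ k
  eq : ∀ t ∈ Icc 0 T, ∀ k, fourierCoeff (d t) k = duhamel F t k

/-- The weighted energy `∫₀ᵀ e^{-2λθ} ‖F(θ)‖² dθ`. -/
def energy (lam T : ℝ) (F : ℝ → ℤ → ℂ) : ℝ≥0∞ :=
  ∫⁻ θ in Icc 0 T, ENNReal.ofReal (Real.exp (-(2 * lam * θ))) * sqNorm (F θ)

lemma norm_exp_neg_I_mul (a b : ℝ) : ‖Complex.exp (-(Complex.I * a * b))‖ = 1 := by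
  rw [Complex.exp_neg, norm_inv, norm_exp_I_mul, inv_one]

lemma enorm_exp_neg_I_mul (a b : ℝ) : ‖Complex.exp (-(Complex.I * a * b))‖ₑ = 1 := by
  rw [← ofReal_norm, norm_exp_neg_I_mul, ENNReal.ofReal_one]

lemma IsDuhamel.mono {T T' : ℝ} {F : ℝ → ℤ → ℂ} {d : ℝ → L2} (h : IsDuhamel T F d)
    (hT : T' ≤ T) : IsDuhamel T' F d :=
  ⟨h.measurable, h.integrable, fun t ht => h.eq t ⟨ht.1, ht.2.trans hT⟩⟩

lemma integrable_exp_mul {φ : ℝ → ℂ} (hφ : Integrable φ) (w : ℝ) :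
    Integrable fun θ : ℝ => Complex.exp (-(Complex.I * θ * w)) * φ θ :=
  hφ.bdd_mul (c := 1) (by fun_prop) (ae_of_all _ fun θ => (norm_exp_neg_I_mul θ w).le)

lemma continuous_duhamel {F : ℝ → ℤ → ℂ} {k : ℤ} (h : Integrable fun θ => F θ k) :
    Continuous fun t => duhamel F t k := by
  unfold duhamel
  refine Continuous.mul (by fun_prop) ?_
  exact intervalIntegral.continuous_primitive
    (fun a b => (integrable_exp_mul h (omega k)).intervalIntegrable) 0

/-- A weighted bound for a primitive. -/
lemma enorm_integral_sq_le_weight {lam t T : ℝ} (hlam : 0 < lam) (ht : t ∈ Icc 0 T) {φ : ℝ → ℂ}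
    (hφ : Measurable φ) :
    ENNReal.ofReal (Real.exp (-(2 * lam * t))) * ‖∫ θ in (0 : ℝ)..t, φ θ‖ₑ ^ 2 ≤
      ENNReal.ofReal (1 / (2 * lam)) *
        ∫⁻ θ in Icc 0 T, ENNReal.ofReal (Real.exp (-(2 * lam * θ))) * ‖φ θ‖ₑ ^ 2 := by
  have hm : ∀ r : ℝ, Measurable fun θ : ℝ => ENNReal.ofReal (Real.exp (r * θ)) := fun r => by
    fun_prop
  have hsq : ∀ r θ : ℝ, ENNReal.ofReal (Real.exp (r * θ)) ^ 2 =
      ENNReal.ofReal (Real.exp (2 * r * θ)) := fun r θ => by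
    rw [← ENNReal.ofReal_pow (Real.exp_pos _).le, ← Real.exp_nat_mul]
    congr 2
    push_cast
    ring
  have h1 : ‖∫ θ in (0 : ℝ)..t, φ θ‖ₑ ^ 2 ≤
      (∫⁻ θ in Ioc 0 t, ENNReal.ofReal (Real.exp (2 * lam * θ))) *
      ∫⁻ θ in Ioc 0 t, ENNReal.ofReal (Real.exp (-(2 * lam * θ))) * ‖φ θ‖ₑ ^ 2 := by
    rw [intervalIntegral.integral_of_le ht.1]
    have h := lintegral_mul_sq_le (volume.restrict (Ioc 0 t)) (hm lam).aemeasurable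
      ((hm (-lam)).mul hφ.enorm).aemeasurable
    have h2 : ∀ θ, ENNReal.ofReal (Real.exp (lam * θ)) *
        (ENNReal.ofReal (Real.exp (-lam * θ)) * ‖φ θ‖ₑ) = ‖φ θ‖ₑ := by
      intro θ
      rw [← mul_assoc, ← ENNReal.ofReal_mul (Real.exp_pos _).le, ← Real.exp_add]
      simp
    simp only [Pi.mul_apply, h2, mul_pow, hsq] at h
    refine (pow_le_pow_left' (enorm_integral_le_lintegral_enorm _) 2).trans (h.trans_eq ?_)
    simp only [mul_neg, neg_mul]
  -- The gain: `e^{-2λt} ∫₀ᵗ e^{2λθ} dθ ≤ 1/(2λ)`.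
  have h3 : ENNReal.ofReal (Real.exp (-(2 * lam * t))) *
      ∫⁻ θ in Ioc 0 t, ENNReal.ofReal (Real.exp (2 * lam * θ)) ≤ ENNReal.ofReal (1 / (2 * lam)) := by
    have hint : IntervalIntegrable (fun θ => Real.exp (2 * lam * θ)) volume 0 t :=
      Continuous.intervalIntegrable (by fun_prop) _ _
    rw [← ofReal_integral_eq_lintegral_ofReal
      ((intervalIntegrable_iff_integrableOn_Ioc_of_le ht.1).mp hint)
      (ae_of_all _ fun θ => (Real.exp_pos _).le), ← intervalIntegral.integral_of_le ht.1,
      ← ENNReal.ofReal_mul (Real.exp_pos _).le]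
    refine ENNReal.ofReal_le_ofReal ?_
    rw [intervalIntegral.integral_comp_mul_left (fun x => Real.exp x) (by positivity),
      integral_exp, mul_zero, Real.exp_zero, smul_eq_mul, Real.exp_neg, ← one_div]
    have := Real.exp_pos (2 * lam * t)
    rw [inv_eq_one_div, ← mul_assoc, mul_comm (1 / Real.exp _), mul_assoc]
    refine mul_le_of_le_one_right (by positivity) ?_
    rw [one_div, inv_mul_le_iff₀ this]
    linarith
  calc _ ≤ ENNReal.ofReal (Real.exp (-(2 * lam * t))) *
        ((∫⁻ θ in Ioc 0 t, ENNReal.ofReal (Real.exp (2 * lam * θ))) *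
        ∫⁻ θ in Ioc 0 t, ENNReal.ofReal (Real.exp (-(2 * lam * θ))) * ‖φ θ‖ₑ ^ 2) := by gcongr
    _ ≤ _ := by
        rw [← mul_assoc]
        refine mul_le_mul' h3 (lintegral_mono_set ?_)
        exact fun θ hθ => ⟨hθ.1.le, hθ.2.trans ht.2⟩

/-- The free solutions which make up a Duhamel term. -/
def pullback (F : ℝ → ℤ → ℂ) (θ : ℝ) (k : ℤ) : ℂ :=
  Complex.exp (-(Complex.I * θ * omega k)) * F θ k

lemma sqNorm_pullback (F : ℝ → ℤ → ℂ) (θ : ℝ) : sqNorm (pullback F θ) = sqNorm (F θ) := by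
  simp only [sqNorm, pullback, enorm_mul, enorm_exp_neg_I_mul, one_mul]

lemma measurable_pullback {F : ℝ → ℤ → ℂ} (h : ∀ k, Measurable fun θ => F θ k) (k : ℤ) :
    Measurable fun θ => pullback F θ k :=
  Measurable.mul (by fun_prop) (h k)

/-- The weight in the superposition of free solutions which represents a Duhamel term. -/
def duhamelWeight (lam θ : ℝ) : ℝ≥0∞ :=
  ENNReal.ofReal (1 / (2 * lam)) * ENNReal.ofReal (Real.exp (-(2 * lam * θ)))

lemma measurable_duhamelWeight (lam : ℝ) : Measurable (duhamelWeight lam) := by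
  unfold duhamelWeight
  fun_prop

lemma measurable_exp_weight (lam : ℝ) :
    Measurable fun θ : ℝ => ENNReal.ofReal (Real.exp (-(2 * lam * θ))) := by
  fun_prop

lemma lintegral_duhamelWeight (lam T : ℝ) {F : ℝ → ℤ → ℂ} (h : ∀ k, Measurable fun θ => F θ k) :
    ∫⁻ θ in Icc 0 T, duhamelWeight lam θ * sqNorm (pullback F θ) =
      ENNReal.ofReal (1 / (2 * lam)) * energy lam T F := by
  rw [energy, ← lintegral_const_mul (f := fun θ =>
    ENNReal.ofReal (Real.exp (-(2 * lam * θ))) * sqNorm (F θ)) _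
    ((measurable_exp_weight lam).mul (measurable_sqNorm h))]
  simp only [duhamelWeight, mul_assoc, sqNorm_pullback]

lemma trigSum_duhamel {F : ℝ → ℤ → ℂ} (h : ∀ k, Integrable fun θ => F θ k) (n : ℕ) (t : ℝ)
    (x : Torus) : trigSum n (duhamel F t) x =
      ∫ θ in (0 : ℝ)..t, trigSum n (free (pullback F θ) t) x := by
  have hi : ∀ k, Integrable fun θ => free (pullback F θ) t k * fourier k x := fun k =>
    ((integrable_exp_mul (h k) (omega k)).const_mul _).mul_const _
  simp only [trigSum]
  rw [intervalIntegral.integral_finsetSum fun k _ => (hi k).intervalIntegrable]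
  refine Finset.sum_congr rfl fun k _ => ?_
  rw [duhamel, mul_right_comm, ← intervalIntegral.integral_const_mul]
  exact intervalIntegral.integral_congr fun θ _ => by simp only [free, pullback]; ring

/-- A Duhamel term is an integral over `θ ∈ [0,t]` of the free solutions with data `pullback F θ`.
The weighted primitive bound at each point gives a superposition over the fixed interval `[0,T]`. -/
lemma enorm_trigSum_duhamel_sq_le {F : ℝ → ℤ → ℂ} (hm : ∀ k, Measurable fun θ => F θ k)
    (h : ∀ k, Integrable fun θ => F θ k) {lam t T : ℝ} (hlam : 0 < lam) (ht : t ∈ Icc 0 T)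
    (n : ℕ) (x : Torus) :
    ENNReal.ofReal (Real.exp (-(2 * lam * t))) * ‖trigSum n (duhamel F t) x‖ₑ ^ 2 ≤
      ∫⁻ θ in Icc 0 T, duhamelWeight lam θ * ‖trigSum n (free (pullback F θ) t) x‖ₑ ^ 2 := by
  have hφ : Measurable fun θ => trigSum n (free (pullback F θ) t) x :=
    Finset.measurable_sum _ fun k _ => ((measurable_pullback hm k).const_mul _).mul_const _
  rw [trigSum_duhamel h]
  refine (enorm_integral_sq_le_weight hlam ht hφ).trans_eq ?_
  rw [← lintegral_const_mul (f := fun θ => ENNReal.ofReal (Real.exp (-(2 * lam * θ))) *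
    ‖trigSum n (free (pullback F θ) t) x‖ₑ ^ 2) _
    ((measurable_exp_weight lam).mul (hφ.enorm.pow_const 2))]
  simp only [duhamelWeight, mul_assoc]

lemma IsDuhamel.enorm_sq_le {T : ℝ} {F : ℝ → ℤ → ℂ} {d : ℝ → L2} (h : IsDuhamel T F d)
    {lam t : ℝ} (hlam : 0 < lam) (ht : t ∈ Icc 0 T) :
    ENNReal.ofReal (Real.exp (-(2 * lam * t))) * ‖d t‖ₑ ^ 2 ≤
      ENNReal.ofReal (1 / (2 * lam)) * energy lam T F := by
  rw [enorm_sq_eq_sqNorm, sqNorm, energy, ← ENNReal.tsum_mul_left]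
  simp only [sqNorm, ← ENNReal.tsum_mul_left]
  rw [lintegral_tsum (f := fun k θ => ENNReal.ofReal (Real.exp (-(2 * lam * θ))) * ‖F θ k‖ₑ ^ 2)
    fun k => ((measurable_exp_weight lam).mul ((h.measurable k).enorm.pow_const 2)).aemeasurable,
    ← ENNReal.tsum_mul_left]
  refine ENNReal.tsum_le_tsum fun k => ?_
  have := enorm_integral_sq_le_weight hlam ht (measurable_pullback h.measurable k)
  simp only [pullback, enorm_mul, enorm_exp_neg_I_mul, one_mul] at this
  rw [h.eq t ht, duhamel, enorm_mul, enorm_exp_I_mul, one_mul]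
  exact this

/-- The bilinear estimate for a Duhamel term, with a small constant for large `λ`. -/
lemma IsDuhamel.lintegral_pair_le {T : ℝ} {F : ℝ → ℤ → ℂ} {d u : ℝ → L2} (h : IsDuhamel T F d)
    {c : ℝ → ℤ → ℂ} {M : ℝ≥0∞} (hc : StrichartzBound T M c)
    (hu : ∀ t ∈ Icc 0 T, ∀ k, fourierCoeff (u t) k = c t k) {lam : ℝ} (hlam : 0 < lam) :
    ∫⁻ t in Icc 0 T, ENNReal.ofReal (Real.exp (-(2 * lam * t))) * pair (u t) (d t) ≤
      M * (ENNReal.ofReal (1 / (2 * lam)) * energy lam T F) := by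
  rw [← lintegral_duhamelWeight lam T h.measurable]
  refine lintegral_pair_le_of_trigSum hc.measurable
    (fun k => (continuous_duhamel (h.integrable k)).measurable) (measurable_exp_weight lam)
    (fun t => ENNReal.ofReal_ne_top) hu h.eq fun n => ?_
  exact hc.lintegral_superposition_le (measurable_pullback h.measurable)
    (fun t => ENNReal.ofReal_ne_top) (measurable_duhamelWeight lam) n
    fun t ht x => enorm_trigSum_duhamel_sq_le h.measurable h.integrable hlam ht n x

/-- Removal of the time weight costs `e^{2λT}`. The bound lets a Duhamel term occupy the other slot
of the bilinear estimate, which is needed for the quadratic term in the error equation. -/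
lemma IsDuhamel.strichartzBound {T T' : ℝ} (hT : T ≤ T') {F : ℝ → ℤ → ℂ} {d : ℝ → L2}
    (h : IsDuhamel T F d) {lam : ℝ} (hlam : 0 < lam) :
    StrichartzBound T (strichartzConst T' * (ENNReal.ofReal (Real.exp (2 * lam * T)) *
      (ENNReal.ofReal (1 / (2 * lam)) * energy lam T F))) (duhamel F) := by
  have hW := (measurable_duhamelWeight lam).const_mul (ENNReal.ofReal (Real.exp (2 * lam * T)))
  rw [← lintegral_duhamelWeight lam T h.measurable,
    ← lintegral_const_mul' _ _ ENNReal.ofReal_ne_top]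
  simp only [← mul_assoc (ENNReal.ofReal (Real.exp (2 * lam * T)))]
  refine strichartzBound_of_superposition hT
    (fun k => (continuous_duhamel (h.integrable k)).measurable) (measurable_pullback h.measurable)
    hW fun n t ht x => ?_
  have h1 := enorm_trigSum_duhamel_sq_le h.measurable h.integrable hlam ht n x
  simp only [mul_assoc]
  rw [lintegral_const_mul' _ _ ENNReal.ofReal_ne_top]
  refine le_trans ?_ (mul_le_mul_right h1 _)
  rw [← mul_assoc, ← ENNReal.ofReal_mul (Real.exp_pos _).le, ← Real.exp_add]
  refine le_mul_of_one_le_left' ?_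
  rw [ENNReal.one_le_ofReal]
  refine Real.one_le_exp ?_
  nlinarith [ht.2]

/-- The source is replaced by measurable representatives extended by zero. There are countably many
frequencies, so one null set of times serves for all of them. -/
lemma exists_isDuhamel {T : ℝ} (hT : 0 ≤ T) {F : ℝ → ℤ → ℂ} {d : ℝ → L2}
    (hF : ∀ k, IntervalIntegrable (fun θ => F θ k) volume 0 T)
    (hd : ∀ t ∈ Icc 0 T, ∀ k, fourierCoeff (d t) k =
      ∫ θ in (0 : ℝ)..t, Complex.exp (Complex.I * (t - θ) * omega k) * F θ k) :
    ∃ F' : ℝ → ℤ → ℂ, IsDuhamel T F' d ∧ ∀ᵐ θ ∂volume.restrict (Icc 0 T), F' θ = F θ := by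
  have hI : ∀ k, IntegrableOn (fun θ => F θ k) (Ioc 0 T) := fun k =>
    (intervalIntegrable_iff_integrableOn_Ioc_of_le hT).mp (hF k)
  set F' : ℝ → ℤ → ℂ := fun θ k => (Ioc 0 T).indicator ((hI k).aestronglyMeasurable.mk _) θ
  have hae : ∀ᵐ θ ∂volume.restrict (Ioc 0 T), ∀ k, F' θ k = F θ k := by
    rw [ae_all_iff]
    intro k
    filter_upwards [(hI k).aestronglyMeasurable.ae_eq_mk, ae_restrict_mem measurableSet_Ioc]
      with θ h1 h2
    simp only [F', indicator_of_mem h2, ← h1]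
  have hF'I : ∀ k, Integrable fun θ => F' θ k := fun k =>
    (integrable_indicator_iff measurableSet_Ioc).mpr
      ((hI k).congr (hI k).aestronglyMeasurable.ae_eq_mk)
  refine ⟨F', ⟨fun k => ?_, hF'I, fun t ht k => ?_⟩, ?_⟩
  · exact (hI k).aestronglyMeasurable.stronglyMeasurable_mk.measurable.indicator measurableSet_Ioc
  · rw [hd t ht, duhamel, ← intervalIntegral.integral_const_mul]
    refine intervalIntegral.integral_congr_ae ?_
    rw [uIoc_of_le ht.1, ← ae_restrict_iff' measurableSet_Ioc]
    have := ae_restrict_of_ae_restrict_of_subset (Ioc_subset_Ioc_right ht.2) hae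
    filter_upwards [this] with θ hθ
    rw [hθ, ← mul_assoc, ← Complex.exp_add]
    congr 2
    ring
  · rw [← Measure.restrict_congr_set Ioc_ae_eq_Icc]
    filter_upwards [hae] with θ hθ
    exact funext hθ

/-! ### Uniqueness -/

lemma exp_weight_le_one {lam t : ℝ} (hlam : 0 < lam) (ht : 0 ≤ t) :
    ENNReal.ofReal (Real.exp (-(2 * lam * t))) ≤ 1 := by
  rw [ENNReal.ofReal_le_one]
  exact Real.exp_le_one_iff.mpr (by nlinarith)

lemma IsProfile.sub {v w : ℝ → L2} {g h : ℝ → ℤ → ℂ} (hv : IsProfile v g) (hw : IsProfile w h) :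
    IsProfile (fun t => v t - w t) (fun σ k => g σ k + -1 * h σ k) := by
  have h1 : IsProfile (fun t => -w t) (fun σ k => -1 * h σ k) :=
    hw.multiplier (m := fun _ => -1) fun t k => by
      simp only [← fourierBasis_repr, map_neg, lp.coeFn_neg, Pi.neg_apply, neg_mul, one_mul]
  simpa only [sub_eq_add_neg] using hv.add h1

lemma profNorm_sub_lt_top {s b : ℝ} {g h : ℝ → ℤ → ℂ} (hg : ∀ k, Measurable fun σ => g σ k)
    (hg' : profNorm s b g < ⊤) (hh' : profNorm s b h < ⊤) :
    profNorm s b (fun σ k => g σ k + -1 * h σ k) < ⊤ := by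
  refine (profNorm_add_le s b hg).trans_lt (ENNReal.add_lt_top.mpr
    ⟨ENNReal.mul_lt_top (by norm_num) hg', ENNReal.mul_lt_top (by norm_num) ?_⟩)
  exact (profNorm_multiplier_le s b h (m := fun _ => -1) (by simp)).trans_lt hh'

/-- The difference enters `hle` linearly, multiplied by `u + w`, which lies in `X^{0,b}(T)` and so
obeys a bilinear estimate with finite constant `M`. Estimated as a Duhamel term, the difference
gains `1/(2λ)`, and its energy is absorbed. -/
lemma eqOn_of_isDuhamel {b T : ℝ} (hb : 1 / 2 < b) (hT : 0 < T) {u w : ℝ → L2}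
    (hu : MemLocalBourgain 0 b T u) (hw : MemLocalBourgain 0 b T w) {F : ℝ → ℤ → ℂ}
    (hF : IsDuhamel T F fun t => u t - w t)
    (hle : ∀ᵐ t ∂volume.restrict (Icc 0 T),
      sqNorm (F t) ≤ 2 * ‖u t - w t‖ₑ ^ 2 + 2 * pair (u t - w t : L2) (u t + w t : L2)) :
    EqOn u w (Icc 0 T) := by
  obtain ⟨v₁, g₁, hv₁, hg₁, hfin₁⟩ := hu.exists_profile
  obtain ⟨v₂, g₂, hv₂, hg₂, hfin₂⟩ := hw.exists_profile
  have hS := (hg₁.add hg₂).strichartzBound b T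
  set M := strichartzConst T * (weightConst b * profNorm 0 b fun σ k => g₁ σ k + g₂ σ k) with hM
  have hMfin : M < ⊤ := by
    refine ENNReal.mul_lt_top ENNReal.coe_lt_top (ENNReal.mul_lt_top (weightConst_lt_top hb) ?_)
    exact (profNorm_add_le 0 b hg₁.measurable).trans_lt (ENNReal.add_lt_top.mpr
      ⟨ENNReal.mul_lt_top (by norm_num) hfin₁, ENNReal.mul_lt_top (by norm_num) hfin₂⟩)
  have hsum : ∀ t ∈ Icc 0 T, ∀ k, fourierCoeff (u t + w t : L2) k =
      fourierCoeff (v₁ t + v₂ t : L2) k := fun t ht k => by rw [hv₁ ht, hv₂ ht]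
  have hsplit : ∀ (lam : ℝ) (B P : ℝ≥0∞), 0 < lam →
      (∀ t ∈ Icc 0 T, ENNReal.ofReal (Real.exp (-(2 * lam * t))) * ‖u t - w t‖ₑ ^ 2 ≤ B) →
      (∫⁻ t in Icc 0 T, ENNReal.ofReal (Real.exp (-(2 * lam * t))) *
        pair (u t + w t : L2) (u t - w t : L2)) ≤ P →
      energy lam T F ≤ 2 * B * ENNReal.ofReal T + 2 * P := by
    intro lam B P hlam hB hP
    calc energy lam T F ≤ ∫⁻ t in Icc 0 T, (2 * B + 2 * (ENNReal.ofReal (Real.exp (-(2 * lam * t))) *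
          pair (u t + w t : L2) (u t - w t : L2))) := by
          refine lintegral_mono_ae ?_
          filter_upwards [hle, ae_restrict_mem measurableSet_Icc] with t h1 ht
          refine (mul_le_mul_right h1 _).trans ?_
          rw [mul_add, pair_comm]
          refine add_le_add ((le_of_eq (by ring)).trans (mul_le_mul_right (hB t ht) 2))
            (le_of_eq (by ring))
      _ = 2 * B * ENNReal.ofReal T + 2 * ∫⁻ t in Icc 0 T,
          ENNReal.ofReal (Real.exp (-(2 * lam * t))) *
          pair (u t + w t : L2) (u t - w t : L2) := by
          rw [lintegral_add_left measurable_const, setLIntegral_const, Real.volume_Icc, sub_zero,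
            lintegral_const_mul' _ _ (by norm_num)]
      _ ≤ _ := by gcongr
  -- Chosen so that the absorption factor `(T + M)/λ` is at most `1/2`.
  set lam : ℝ := 2 * T + 2 * M.toReal + 1 with hlam_def
  have hMt : 0 ≤ M.toReal := ENNReal.toReal_nonneg
  have hlam : 0 < lam := by positivity
  -- Absorption requires finiteness a priori; it comes from the difference being itself in
  -- `X^{0,b}(T)`.
  have hfin : energy lam T F < ⊤ := by
    have hd := hg₁.sub hg₂
    have hdfin := profNorm_sub_lt_top hg₁.measurable hfin₁ hfin₂
    have hdeq : EqOn (fun t => v₁ t - v₂ t) (fun t => u t - w t) (Icc 0 T) := fun t ht => by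
      simp only [hv₁ ht, hv₂ ht]
    refine (hsplit lam _ _ hlam (fun t ht => ?_)
      ((setLIntegral_mono' measurableSet_Icc fun t ht =>
        mul_le_of_le_one_left' (exp_weight_le_one hlam ht.1)).trans
        (IsProfile.lintegral_pair_le hS hsum hd hdeq b))).trans_lt
      (b := 2 * (weightConst b * profNorm 0 b fun σ k => g₁ σ k + -1 * g₂ σ k) *
        ENNReal.ofReal T + _) ?_
    · refine (mul_le_of_le_one_left' (exp_weight_le_one hlam ht.1)).trans ?_
      rw [← hv₁ ht, ← hv₂ ht]
      exact hd.enorm_sq_le b t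
    · have h1 := ENNReal.mul_lt_top (weightConst_lt_top hb) hdfin
      exact ENNReal.add_lt_top.mpr ⟨ENNReal.mul_lt_top (ENNReal.mul_lt_top (by norm_num) h1)
        ENNReal.ofReal_lt_top, ENNReal.mul_lt_top (by norm_num) (ENNReal.mul_lt_top hMfin h1)⟩
  have hhalf : energy lam T F ≤ ENNReal.ofReal (1 / 2) * energy lam T F := by
    refine (hsplit lam _ _ hlam (fun t ht => hF.enorm_sq_le hlam ht)
      (hF.lintegral_pair_le hS hsum hlam)).trans ?_
    set y := energy lam T F
    have e : 2 * (ENNReal.ofReal (1 / (2 * lam)) * y) * ENNReal.ofReal T +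
        2 * (M * (ENNReal.ofReal (1 / (2 * lam)) * y)) =
        (2 * ENNReal.ofReal (1 / (2 * lam)) * (ENNReal.ofReal T + M)) * y := by ring
    rw [e]
    refine mul_le_mul_left ?_ y
    rw [← ENNReal.ofReal_toReal hMfin.ne, ← ENNReal.ofReal_add hT.le hMt,
      show (2 : ℝ≥0∞) = ENNReal.ofReal 2 by norm_num, ← ENNReal.ofReal_mul (by norm_num),
      ← ENNReal.ofReal_mul (by positivity)]
    refine ENNReal.ofReal_le_ofReal ?_
    rw [mul_one_div, div_mul_eq_mul_div, div_le_div_iff₀ (by positivity) (by norm_num)]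
    linarith
  have hzero : energy lam T F = 0 := by
    by_contra hne
    have h1 : ENNReal.ofReal (1 / 2) * energy lam T F < 1 * energy lam T F := by
      refine (ENNReal.mul_lt_mul_iff_left hne hfin.ne).mpr ?_
      rw [ENNReal.ofReal_lt_one]
      norm_num
    rw [one_mul] at h1
    exact absurd hhalf h1.not_ge
  intro t ht
  have h0 := hF.enorm_sq_le hlam ht
  rw [hzero, mul_zero, nonpos_iff_eq_zero, mul_eq_zero] at h0
  rcases h0 with h0 | h0
  · exact absurd h0 (by simpa using Real.exp_pos _)
  · simpa [sub_eq_zero] using h0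

lemma MemLocalBourgain.mono_s {s s' b T : ℝ} (hs : s' ≤ s) {u : ℝ → L2}
    (h : MemLocalBourgain s b T u) : MemLocalBourgain s' b T u := by
  obtain ⟨v, g, hv, hg, hfin⟩ := h.exists_profile
  exact hg.memLocalBourgain hv ((profNorm_mono hs b g).trans_lt hfin)

lemma MemLocalBourgain.mono_T {s b T T' : ℝ} (hT : T' ≤ T) {u : ℝ → L2}
    (h : MemLocalBourgain s b T u) : MemLocalBourgain s b T' u := by
  obtain ⟨v, g, hv, hg, hfin⟩ := h.exists_profile
  exact hg.memLocalBourgain (hv.mono (Icc_subset_Icc_right hT)) hfin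

lemma IsMildSolution.mono {N : L2 → ℤ → ℂ} {u₀ : L2} {T T' : ℝ} {u : ℝ → L2} (hT' : 0 ≤ T')
    (hT : T' ≤ T) (h : IsMildSolution N u₀ T u) : IsMildSolution N u₀ T' u := fun k =>
  ⟨(h k).1.mono_set (by
    rw [uIcc_of_le hT', uIcc_of_le (hT'.trans hT)]; exact Icc_subset_Icc_right hT),
    fun t ht => (h k).2 t ⟨ht.1, ht.2.trans hT⟩⟩

lemma integrable_exp_duhamel {T t w : ℝ} (ht : t ∈ Icc 0 T) {φ : ℝ → ℂ}
    (hφ : IntervalIntegrable φ volume 0 T) : IntervalIntegrable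
      (fun θ : ℝ => Complex.exp (Complex.I * (t - θ) * w) * φ θ) volume 0 t := by
  refine IntervalIntegrable.continuousOn_mul (hφ.mono_set ?_) (by fun_prop)
  rw [uIcc_of_le ht.1, uIcc_of_le (ht.1.trans ht.2)]
  exact Icc_subset_Icc_right ht.2

lemma IsMildSolution.fourierCoeff_sub {N : L2 → ℤ → ℂ} {u₀ : L2} {T : ℝ} {u w : ℝ → L2}
    (hu : IsMildSolution N u₀ T u) (hw : IsMildSolution N u₀ T w) {t : ℝ} (ht : t ∈ Icc 0 T)
    (k : ℤ) : fourierCoeff (u t - w t : L2) k =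
      ∫ θ in (0 : ℝ)..t, Complex.exp (Complex.I * (t - θ) * omega k) *
        (N (u θ) k - N (w θ) k) := by
  rw [GoodBoussinesq.fourierCoeff_sub, (hu k).2 t ht, (hw k).2 t ht]
  simp only [mul_sub (Complex.exp _)]
  rw [intervalIntegral.integral_sub (integrable_exp_duhamel ht (hu k).1)
    (integrable_exp_duhamel ht (hw k).1)]
  ring

lemma IsSolution.eqOn {s b T : ℝ} (hb : 1 / 2 < b) (hs : 0 ≤ s) (hT : 0 < T) {u₀ : L2}
    {u w : ℝ → L2} (hu : IsSolution s b u₀ T u) (hw : IsSolution s b u₀ T w) :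
    EqOn w u (Icc 0 T) := by
  obtain ⟨F, hF, hae⟩ := exists_isDuhamel hT.le (d := fun t => u t - w t)
    (F := fun θ k => forcing (u θ) k - forcing (w θ) k)
    (fun k => (hu.2 k).1.sub (hw.2 k).1) fun t ht k => hu.2.fourierCoeff_sub hw.2 ht k
  refine (eqOn_of_isDuhamel hb hT (hu.1.mono_s hs) (hw.1.mono_s hs) hF ?_).symm
  filter_upwards [hae] with t ht
  rw [ht]
  exact sqNorm_forcing_sub_le _ _

/-- Both the initial datum and the forcing in the Duhamel formula carry the idempotent factor
`cutoff τ k`. -/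
lemma IsProjSolution.proj_eq {s b τ T : ℝ} (hτ : 0 < τ) {u₀ : L2} {u : ℝ → L2}
    (hu : IsProjSolution s b τ u₀ T u) {t : ℝ} (ht : t ∈ Icc 0 T) : proj τ (u t) = u t := by
  refine fourierCoeff_injective fun k => ?_
  rw [fourierCoeff_proj hτ, (hu.2 k).2 t ht, fourierCoeff_proj hτ]
  simp only [projForcing_eq hτ]
  rcases cutoff_eq_zero_or_one τ k with h | h <;> simp [h]

lemma IsProjSolution.eqOn {s b τ T : ℝ} (hb : 1 / 2 < b) (hs : 0 ≤ s) (hτ : 0 < τ) (hT : 0 < T)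
    {u₀ : L2} {u w : ℝ → L2} (hu : IsProjSolution s b τ u₀ T u)
    (hw : IsProjSolution s b τ u₀ T w) : EqOn w u (Icc 0 T) := by
  obtain ⟨F, hF, hae⟩ := exists_isDuhamel hT.le (d := fun t => u t - w t)
    (F := fun θ k => projForcing τ (u θ) k - projForcing τ (w θ) k)
    (fun k => (hu.2 k).1.sub (hw.2 k).1) fun t ht k => hu.2.fourierCoeff_sub hw.2 ht k
  refine (eqOn_of_isDuhamel hb hT (hu.1.mono_s hs) (hw.1.mono_s hs) hF ?_).symm
  filter_upwards [hae, ae_restrict_mem measurableSet_Icc] with t h1 ht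
  rw [h1]
  refine le_trans (sqNorm_mono fun k => ?_) (sqNorm_forcing_sub_le (u t) (w t))
  rw [projForcing_eq hτ, projForcing_eq hτ, hu.proj_eq hτ ht, hw.proj_eq hτ ht, ← mul_sub,
    enorm_mul]
  refine mul_le_of_le_one_left' ?_
  rw [← ofReal_norm, ENNReal.ofReal_le_one]
  exact norm_cutoff_le τ k

/-! ### Plancherel on the line, and Duhamel terms as elements of Bourgain spaces -/

/-- The `L²` transform and the integral transform have the same pairings with test functions: the
first through tempered distributions, the second by the self-adjointness of the transform. -/
lemma fourier_toLp_ae_eq {f : ℝ → ℂ} (h1 : Integrable f) (h2 : MemLp f 2 volume) :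
    ((𝓕 (h2.toLp f) : Lp ℂ 2 (volume : Measure ℝ)) : ℝ → ℂ) =ᵐ[volume] 𝓕 f := by
  refine ae_eq_of_integral_contDiff_smul_eq ((Lp.memLp _).locallyIntegrable (by norm_num))
    ((VectorFourier.fourierIntegral_continuous Real.continuous_fourierChar
      (by fun_prop) h1).locallyIntegrable) ?_
  intro ψ hψ hψc
  have hc : HasCompactSupport (fun x => (ψ x : ℂ)) := hψc.comp_left (g := Complex.ofReal) rfl
  have hd : ContDiff ℝ (⊤ : ℕ∞) (fun x => (ψ x : ℂ)) := Complex.ofRealCLM.contDiff.comp hψ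
  set φ : SchwartzMap ℝ ℂ := hc.toSchwartzMap hd
  have e1 := DFunLike.congr_fun (Lp.fourier_toTemperedDistribution_eq (h2.toLp f)) φ
  rw [TemperedDistribution.fourier_apply, Lp.toTemperedDistribution_apply,
    Lp.toTemperedDistribution_apply] at e1
  have e2 := VectorFourier.integral_fourierIntegral_smul_eq_flip (μ := volume) (ν := volume)
    (L := innerₗ ℝ) Real.continuous_fourierChar (by fun_prop) φ.integrable h1
  have e3 : ∫ x, (𝓕 φ) x • (h2.toLp f) x = ∫ x, (𝓕 φ) x • f x :=
    integral_congr_ae (h2.coeFn_toLp.mono fun x hx => by simp only [hx])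
  rw [e3] at e1
  have e4 : ∫ x, (𝓕 φ) x • f x = ∫ x, φ x • (𝓕 f) x := by
    simpa only [flip_innerₗ] using! e2
  rw [e4] at e1
  simpa using! e1.symm

lemma lintegral_fourier_sq {f : ℝ → ℂ} (h1 : Integrable f) (h2 : MemLp f 2 volume) :
    ∫⁻ w, ‖(𝓕 f) w‖ₑ ^ 2 = ∫⁻ t, ‖f t‖ₑ ^ 2 := by
  have h := Lp.norm_fourier_eq (h2.toLp f)
  have hsq : ∀ φ : ℝ → ℂ, eLpNorm φ 2 volume ^ 2 = ∫⁻ t, ‖φ t‖ₑ ^ 2 := by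
    intro φ
    rw [eLpNorm_eq_lintegral_rpow_enorm_toReal (by norm_num) (by norm_num)]
    simp only [ENNReal.toReal_ofNat, ENNReal.rpow_two, one_div]
    rw [← ENNReal.rpow_two, ← ENNReal.rpow_mul]
    norm_num
  rw [← hsq, ← hsq, ← eLpNorm_congr_ae (fourier_toLp_ae_eq h1 h2),
    ← eLpNorm_congr_ae h2.coeFn_toLp, ← Lp.enorm_def, ← Lp.enorm_def, ← ofReal_norm, h, ofReal_norm]

/-- Integration by parts for `H + H' = m`. The countable exceptional set allows for corners of `H`,
where continuity is enough. -/
lemma fourier_eq_mul_of_hasDerivAt {H m : ℝ → ℂ} (hc : Continuous H) (hH : Integrable H)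
    (hm : Integrable m) {S : Set ℝ} (hS : S.Countable)
    (hd : ∀ x ∉ S, HasDerivAt H (m x - H x) x) (hbot : Tendsto H atBot (𝓝 0))
    (htop : Tendsto H atTop (𝓝 0)) (w : ℝ) :
    (𝓕 m) w = (1 + 2 * Real.pi * w * Complex.I) * (𝓕 H) w := by
  set E : ℝ → ℂ := fun v => Complex.exp (((-2 * Real.pi * v * w : ℝ) : ℂ) * Complex.I) with hE
  have hEc : Continuous E := by rw [hE]; fun_prop
  have hEn : ∀ v, ‖E v‖ = 1 := fun v => Complex.norm_exp_ofReal_mul_I _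
  have hEd : ∀ v, HasDerivAt E (E v * (-(2 * Real.pi * w) * Complex.I)) v := by
    intro v
    have h0 : HasDerivAt (fun v : ℝ => (((-2 * Real.pi * v * w : ℝ) : ℂ) * Complex.I))
        (-(2 * Real.pi * w) * Complex.I) v := by
      have := (((hasDerivAt_id v).const_mul (-2 * Real.pi)).mul_const w).ofReal_comp.mul_const
        Complex.I
      refine this.congr_deriv ?_
      push_cast
      ring
    exact h0.cexp
  have hi : ∀ {φ : ℝ → ℂ}, Integrable φ → Integrable fun v => E v * φ v := fun h =>
    h.bdd_mul (c := 1) hEc.aestronglyMeasurable (ae_of_all _ fun v => (hEn v).le)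
  have hI : Integrable fun v => E v * (-(2 * Real.pi * w) * Complex.I) * H v + E v * (m v - H v) := by
    refine Integrable.add ?_ (hi (hm.sub hH))
    refine ((hi hH).const_mul (-(2 * Real.pi * w) * Complex.I)).congr (ae_of_all _ fun v => ?_)
    simp only
    ring
  have hFTC : ∀ A : ℝ, 0 ≤ A → ∫ v in (-A)..A, (E v * (-(2 * Real.pi * w) * Complex.I) * H v
      + E v * (m v - H v)) = E A * H A - E (-A) * H (-A) := fun A hA =>
    integral_eq_of_hasDerivAt_off_countable_of_le (fun v => E v * H v) _ (by linarith) hS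
      (hEc.mul hc).continuousOn (fun x hx => (hEd x).mul (hd x hx.2)) hI.intervalIntegrable
  have hlim := intervalIntegral_tendsto_integral hI tendsto_neg_atTop_atBot tendsto_id
  have hz : ∀ {l : Filter ℝ}, Tendsto H l (𝓝 0) → Tendsto (fun v => E v * H v) l (𝓝 0) := by
    intro l h
    rw [tendsto_zero_iff_norm_tendsto_zero] at h ⊢
    simpa only [norm_mul, hEn, one_mul] using h
  have h0 : Tendsto (fun A => E A * H A - E (-A) * H (-A)) atTop (𝓝 0) := by
    simpa using (hz htop).sub ((hz hbot).comp tendsto_neg_atTop_atBot)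
  have hint := tendsto_nhds_unique
    (hlim.congr' ((eventually_ge_atTop 0).mono fun A hA => hFTC A hA)) h0
  have e1 : ∫ v, E v * (-(2 * Real.pi * w) * Complex.I) * H v + E v * (m v - H v)
      = (∫ v, E v * m v) - (1 + 2 * Real.pi * w * Complex.I) * ∫ v, E v * H v := by
    rw [← integral_const_mul, ← integral_sub (hi hm) ((hi hH).const_mul _)]
    exact integral_congr_ae (ae_of_all _ fun v => by simp only; ring)
  rw [e1, sub_eq_zero] at hint
  rw [Real.fourier_real_eq_integral_exp_smul, Real.fourier_real_eq_integral_exp_smul]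
  exact hint

/-- An extension of a primitive to the line. -/
def extendPrimitive (T : ℝ) (h : ℝ → ℂ) (t : ℝ) : ℂ :=
  Real.exp (max 0 (min t T) - t) * h (max 0 (min t T))

section

variable {T : ℝ} {h : ℝ → ℂ}

lemma continuous_extendPrimitive (hc : Continuous h) : Continuous (extendPrimitive T h) := by
  unfold extendPrimitive
  fun_prop

lemma extendPrimitive_of_nonpos (hT : 0 < T) (h0 : h 0 = 0) {t : ℝ} (ht : t ≤ 0) :
    extendPrimitive T h t = 0 := by
  rw [extendPrimitive, min_eq_left (ht.trans hT.le), max_eq_left ht, h0, mul_zero]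

lemma extendPrimitive_of_mem {t : ℝ} (ht : t ∈ Icc 0 T) : extendPrimitive T h t = h t := by
  rw [extendPrimitive, min_eq_left ht.2, max_eq_right ht.1]
  simp

lemma extendPrimitive_of_ge (hT : 0 < T) {t : ℝ} (ht : T ≤ t) :
    extendPrimitive T h t = Real.exp (T - t) * h T := by
  rw [extendPrimitive, min_eq_right ht, max_eq_right hT.le]

lemma integrable_extendPrimitive (hT : 0 < T) (hc : Continuous h) (h0 : h 0 = 0) :
    Integrable (extendPrimitive T h) := by
  rw [← integrableOn_univ, ← Iic_union_Ioi (a := T), integrableOn_union]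
  constructor
  · have h1 : IntegrableOn (extendPrimitive T h) (Icc 0 T) :=
      (continuous_extendPrimitive hc).continuousOn.integrableOn_Icc
    have h2 : IntegrableOn (extendPrimitive T h) (Iio 0) :=
      integrableOn_zero.congr_fun (fun t ht => (extendPrimitive_of_nonpos hT h0 ht.le).symm)
        measurableSet_Iio
    rw [← Iio_union_Icc_eq_Iic hT.le]
    exact h2.union h1
  · have h1 : IntegrableOn (fun t : ℝ => ((Real.exp T * Real.exp (-t) : ℝ) : ℂ) * h T) (Ioi T) :=
      (((integrableOn_exp_neg_Ioi T).const_mul _).ofReal).mul_const _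
    refine h1.congr_fun (fun t ht => ?_) measurableSet_Ioi
    simp only
    rw [extendPrimitive_of_ge hT (le_of_lt ht), ← Real.exp_add, sub_eq_add_neg]

lemma tendsto_extendPrimitive_atBot (hT : 0 < T) (h0 : h 0 = 0) :
    Tendsto (extendPrimitive T h) atBot (𝓝 0) :=
  tendsto_const_nhds.congr' ((eventually_le_atBot 0).mono fun _ ht =>
    (extendPrimitive_of_nonpos hT h0 ht).symm)

lemma tendsto_extendPrimitive_atTop (hT : 0 < T) :
    Tendsto (extendPrimitive T h) atTop (𝓝 0) := by
  have h1 : Tendsto (fun t : ℝ => ((Real.exp (T - t) : ℝ) : ℂ) * h T) atTop (𝓝 ((0 : ℝ) * h T)) := by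
    refine Tendsto.mul_const _ ((Complex.continuous_ofReal.tendsto _).comp ?_)
    exact Real.tendsto_exp_atBot.comp (tendsto_atBot_add_const_left _ T tendsto_neg_atTop_atBot)
  simp only [Complex.ofReal_zero, zero_mul] at h1
  exact h1.congr' ((eventually_ge_atTop T).mono fun t ht => (extendPrimitive_of_ge hT ht).symm)

lemma hasDerivAt_extendPrimitive (hT : 0 < T) {f : ℝ → ℂ} (h0 : h 0 = 0)
    (hd : ∀ t, HasDerivAt h (f t) t) {t : ℝ} (ht : t ∉ ({0, T} : Set ℝ)) :
    HasDerivAt (extendPrimitive T h)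
      ((Icc 0 T).indicator (fun t => f t + h t) t - extendPrimitive T h t) t := by
  simp only [mem_insert_iff, mem_singleton_iff, not_or] at ht
  rcases lt_or_gt_of_ne ht.1 with h1 | h1
  · rw [indicator_of_notMem (fun h => h1.not_ge h.1), extendPrimitive_of_nonpos hT h0 h1.le, sub_zero]
    exact (hasDerivAt_const t (0 : ℂ)).congr_of_eventuallyEq
      ((eventually_lt_nhds h1).mono fun x hx => extendPrimitive_of_nonpos hT h0 hx.le)
  rcases lt_or_gt_of_ne ht.2 with h2 | h2
  · have h3 : t ∈ Icc 0 T := ⟨h1.le, h2.le⟩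
    rw [indicator_of_mem h3, extendPrimitive_of_mem h3, add_sub_cancel_right]
    refine (hd t).congr_of_eventuallyEq ?_
    filter_upwards [Ioo_mem_nhds h1 h2] with x hx
    exact extendPrimitive_of_mem ⟨hx.1.le, hx.2.le⟩
  · rw [indicator_of_notMem (fun h => h2.not_ge h.2), extendPrimitive_of_ge hT h2.le, zero_sub]
    have := ((((hasDerivAt_id t).const_sub T).exp).ofReal_comp).mul_const (h T)
    refine (this.congr_deriv ?_).congr_of_eventuallyEq
      ((eventually_gt_nhds h2).mono fun x hx => extendPrimitive_of_ge hT (le_of_lt hx))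
    simp
end

lemma enorm_primitive_sq_le {T t : ℝ} (ht : t ∈ Icc 0 T) {f : ℝ → ℂ} (hf : Continuous f) :
    ‖∫ θ in (0 : ℝ)..t, f θ‖ₑ ^ 2 ≤ ENNReal.ofReal T * ∫⁻ θ in Icc 0 T, ‖f θ‖ₑ ^ 2 := by
  have h1 : ‖∫ θ in (0 : ℝ)..t, f θ‖ₑ ≤ ∫⁻ θ in Icc 0 T, ‖f θ‖ₑ := by
    rw [intervalIntegral.integral_of_le ht.1]
    exact (enorm_integral_le_lintegral_enorm _).trans
      (lintegral_mono_set fun x hx => ⟨hx.1.le, hx.2.trans ht.2⟩)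
  have h2 := lintegral_mul_sq_le (volume.restrict (Icc 0 T)) (f := fun _ => 1) (g := fun θ => ‖f θ‖ₑ)
    aemeasurable_const hf.measurable.enorm.aemeasurable
  simp only [one_mul, one_pow, lintegral_const, Measure.restrict_apply MeasurableSet.univ,
    univ_inter, Real.volume_Icc, sub_zero] at h2
  exact (pow_le_pow_left' h1 2).trans h2

lemma memLp_two_Icc {f : ℝ → ℂ} (hf : Continuous f) (a b : ℝ) :
    MemLp f 2 (volume.restrict (Icc a b)) := by
  rw [memLp_two_iff_integrable_sq_norm hf.aestronglyMeasurable]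
  exact (hf.norm.pow 2).continuousOn.integrableOn_Icc

lemma lintegral_enorm_sq_Icc_lt_top {f : ℝ → ℂ} (hf : Continuous f) (a b : ℝ) :
    ∫⁻ θ in Icc a b, ‖f θ‖ₑ ^ 2 < ⊤ := by
  have := (memLp_two_Icc hf a b).eLpNorm_lt_top
  rw [eLpNorm_lt_top_iff_lintegral_rpow_enorm_lt_top (by norm_num) (by norm_num)] at this
  simpa using this

/-- The primitive `h` of `f` is extended by zero before 0 and by `e^{T-t}h(T)` after `T`, both
solutions of `H + H' = 0`. Hence `H + H' = m` with `m = f + h` supported in `[0,T]`. On the Fourier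
side this reads `(1 + iσ)Ĥ = m̂` with `|1 + iσ| = ⟨σ⟩`, so Plancherel bounds the weighted norm for
every `b ≤ 1`. -/
lemma exists_mode {T : ℝ} (hT : 0 < T) {f : ℝ → ℂ} (hf : Continuous f) :
    ∃ γ : ℝ → ℂ, Measurable γ ∧ Integrable γ ∧
      (∀ t ∈ Icc 0 T, ∫ σ : ℝ, γ σ * Complex.exp (Complex.I * σ * t) = ∫ θ in (0 : ℝ)..t, f θ) ∧
      ∀ b ≤ (1 : ℝ), modeNorm b γ ≤ ENNReal.ofReal (2 + 2 * T ^ 2) * ∫⁻ θ in Icc 0 T, ‖f θ‖ₑ ^ 2 := by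
  set h : ℝ → ℂ := fun t => ∫ θ in (0 : ℝ)..t, f θ with hh
  have h0 : h 0 = 0 := intervalIntegral.integral_same
  have hd : ∀ t, HasDerivAt h (f t) t := fun t => (hf.integral_hasStrictDerivAt 0 t).hasDerivAt
  have hc : Continuous h := continuous_iff_continuousAt.mpr fun t => (hd t).continuousAt
  set H := extendPrimitive T h
  have hHc : Continuous H := continuous_extendPrimitive hc
  have hHi : Integrable H := integrable_extendPrimitive hT hc h0
  set m : ℝ → ℂ := (Icc 0 T).indicator fun t => f t + h t with hm
  have hmi : Integrable m :=
    (hf.add hc).continuousOn.integrableOn_Icc.integrable_indicator measurableSet_Icc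
  have hm2 : MemLp m 2 volume := by
    rw [hm, memLp_indicator_iff_restrict measurableSet_Icc]
    exact memLp_two_Icc (hf.add hc) 0 T
  have hF := fourier_eq_mul_of_hasDerivAt hHc hHi hmi (Set.toFinite ({0, T} : Set ℝ)).countable
    (fun x hx => hasDerivAt_extendPrimitive hT h0 hd hx) (tendsto_extendPrimitive_atBot hT h0)
    (tendsto_extendPrimitive_atTop hT)
  have hFc : ∀ {φ : ℝ → ℂ}, Integrable φ → Continuous (𝓕 φ) := fun hφ =>
    VectorFourier.fourierIntegral_continuous Real.continuous_fourierChar (by fun_prop) hφ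
  -- The dilation passes from the kernel `e^{-2πiwt}` of `𝓕` to the kernel `e^{iσt}` of profiles.
  set γ : ℝ → ℂ := fun σ => (1 / (2 * Real.pi) : ℝ) * (𝓕 H) (σ / (2 * Real.pi)) with hγ
  have hγc : Continuous γ := continuous_const.mul ((hFc hHi).comp (continuous_id.div_const _))
  have hle : ∀ b ≤ (1 : ℝ), ∀ σ, ENNReal.ofReal (bracket σ ^ b) ^ 2 * ‖γ σ‖ₑ ^ 2 ≤
      ENNReal.ofReal (1 / (2 * Real.pi)) ^ 2 * ‖(𝓕 m) (σ / (2 * Real.pi))‖ₑ ^ 2 := by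
    intro b hb σ
    have e1 : bracket σ = ‖(1 + σ * Complex.I : ℂ)‖ := by
      have := Complex.norm_add_mul_I 1 σ
      rw [Complex.ofReal_one] at this
      rw [this, bracket, one_pow]
    have e2 : (1 + 2 * Real.pi * ((σ / (2 * Real.pi) : ℝ) : ℂ) * Complex.I : ℂ)
        = 1 + σ * Complex.I := by
      push_cast
      field_simp
    rw [hF, e2, hγ, enorm_mul, enorm_mul, ← ofReal_norm (1 + σ * Complex.I : ℂ), ← e1,
      enorm_ofReal (by positivity), mul_pow, mul_pow, mul_left_comm]
    have : bracket σ ^ b ≤ bracket σ := by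
      simpa using Real.rpow_le_rpow_of_exponent_le (one_le_bracket σ) hb
    gcongr
  have hmm : ∫⁻ t, ‖m t‖ₑ ^ 2 ≤ ENNReal.ofReal (2 + 2 * T ^ 2) * ∫⁻ θ in Icc 0 T, ‖f θ‖ₑ ^ 2 := by
    have e1 : ∀ t, ‖m t‖ₑ ^ 2 = (Icc 0 T).indicator (fun t => ‖f t + h t‖ₑ ^ 2) t := by
      intro t
      by_cases ht : t ∈ Icc 0 T
      · simp only [hm, indicator_of_mem ht]
      · simp only [hm, indicator_of_notMem ht]; simp
    simp only [e1]
    rw [lintegral_indicator measurableSet_Icc]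
    set J := ∫⁻ θ in Icc 0 T, ‖f θ‖ₑ ^ 2
    calc ∫⁻ t in Icc 0 T, ‖f t + h t‖ₑ ^ 2
        ≤ ∫⁻ t in Icc 0 T, (2 * ‖f t‖ₑ ^ 2 + 2 * (ENNReal.ofReal T * J)) := by
          refine setLIntegral_mono' measurableSet_Icc fun t ht => ?_
          refine (enorm_add_sq_le _ _).trans ?_
          gcongr
          exact enorm_primitive_sq_le ht hf
      _ = 2 * J + 2 * (ENNReal.ofReal T * J) * ENNReal.ofReal T := by
          rw [lintegral_add_right _ measurable_const, lintegral_const_mul' _ _ (by norm_num)]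
          simp [J]
      _ = (2 + 2 * (ENNReal.ofReal T * ENNReal.ofReal T)) * J := by ring
      _ = _ := by
          rw [← ENNReal.ofReal_mul hT.le, ENNReal.ofReal_add (by norm_num) (by positivity),
            ENNReal.ofReal_mul zero_le_two, sq, ENNReal.ofReal_ofNat]
  have hmode : ∀ b ≤ (1 : ℝ), modeNorm b γ ≤
      ENNReal.ofReal (2 + 2 * T ^ 2) * ∫⁻ θ in Icc 0 T, ‖f θ‖ₑ ^ 2 := by
    intro b hb
    have e1 : ∫⁻ σ : ℝ, ‖(𝓕 m) (σ / (2 * Real.pi))‖ₑ ^ 2 =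
        ENNReal.ofReal (2 * Real.pi) * ∫⁻ w, ‖(𝓕 m) w‖ₑ ^ 2 := by
      have hmap := Real.map_volume_mul_left (a := (2 * Real.pi)⁻¹) (by positivity)
      have e2 := lintegral_map (μ := volume) (f := fun w => ‖(𝓕 m) w‖ₑ ^ 2)
        (g := fun σ : ℝ => (2 * Real.pi)⁻¹ * σ)
        ((hFc hmi).measurable.enorm.pow_const 2) (measurable_const_mul _)
      rw [hmap, lintegral_smul_measure, inv_inv, abs_of_pos Real.two_pi_pos, smul_eq_mul] at e2
      rw [e2]
      simp only [div_eq_inv_mul]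
    calc modeNorm b γ ≤ _ := lintegral_mono (hle b hb)
      _ = ENNReal.ofReal (1 / (2 * Real.pi)) ^ 2 * (ENNReal.ofReal (2 * Real.pi) *
          ∫⁻ t, ‖m t‖ₑ ^ 2) := by
          rw [lintegral_const_mul' _ _ (by finiteness), e1, lintegral_fourier_sq hmi hm2]
      _ ≤ 1 * ∫⁻ t, ‖m t‖ₑ ^ 2 := by
          rw [← mul_assoc, ← ENNReal.ofReal_pow (by positivity), ← ENNReal.ofReal_mul (by positivity)]
          gcongr
          rw [ENNReal.ofReal_le_one]
          have := Real.two_le_pi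
          rw [div_pow, div_mul_eq_mul_div, div_le_one (by positivity)]
          nlinarith
      _ ≤ _ := by rw [one_mul]; exact hmm
  have hfin := lintegral_enorm_sq_Icc_lt_top hf 0 T
  -- The weighted bound at `b = 1` and Cauchy-Schwarz give integrability, which justifies Fourier
  -- inversion.
  have hγi : Integrable γ := by
    refine ⟨hγc.aestronglyMeasurable, lt_top_of_sq_lt_top ?_⟩
    exact (lintegral_enorm_sq_le_weight 1 hγc.measurable).trans_lt
      (ENNReal.mul_lt_top (weightConst_lt_top (by norm_num))
        ((hmode 1 le_rfl).trans_lt (ENNReal.mul_lt_top ENNReal.ofReal_lt_top hfin)))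
  refine ⟨γ, hγc.measurable, hγi, fun t ht => ?_, hmode⟩
  have hFi : Integrable (𝓕 H) := by
    have := (hγi.comp_mul_left' (R := 2 * Real.pi) (by positivity)).const_mul ((2 * Real.pi : ℝ) : ℂ)
    refine this.congr (ae_of_all _ fun w => ?_)
    simp only [hγ]
    rw [← mul_assoc, ← Complex.ofReal_mul, mul_one_div_cancel (by positivity),
      mul_div_cancel_left₀ _ (by positivity)]
    simp
  have hinv := congrFun (hHc.fourierInv_fourier_eq hHi hFi) t
  rw [Real.fourierInv_eq', show H t = h t from extendPrimitive_of_mem ht] at hinv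
  refine Eq.trans ?_ hinv
  set G : ℝ → ℂ := fun w => Complex.exp (((2 * Real.pi * (inner ℝ w t) : ℝ) : ℂ) * Complex.I) •
    (𝓕 H) w
  have e1 := Measure.integral_comp_div G (2 * Real.pi)
  rw [abs_of_pos Real.two_pi_pos, Complex.real_smul] at e1
  have e2 : ∫ σ : ℝ, γ σ * Complex.exp (Complex.I * σ * t) =
      (1 / (2 * Real.pi) : ℝ) * ∫ σ : ℝ, G (σ / (2 * Real.pi)) := by
    rw [← integral_const_mul]
    refine integral_congr_ae (ae_of_all _ fun σ => ?_)
    have hp : (Real.pi : ℂ) ≠ 0 := by exact_mod_cast Real.pi_ne_zero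
    simp only [hγ, G, smul_eq_mul]
    rw [mul_assoc, mul_comm _ (Complex.exp (Complex.I * σ * t))]
    congr 3
    rw [show inner ℝ (σ / (2 * Real.pi)) t = t * (σ / (2 * Real.pi)) from rfl]
    push_cast
    field_simp
  rw [e2, e1, ← mul_assoc, ← Complex.ofReal_mul, one_div_mul_cancel (by positivity),
    Complex.ofReal_one, one_mul]

lemma exists_profile_duhamel {T : ℝ} (hT : 0 < T) {b : ℝ} (hb : b ≤ 1) {S : Finset ℤ}
    {F : ℝ → ℤ → ℂ} (hF : ∀ k, Continuous fun θ => F θ k) (hS : ∀ θ, ∀ k ∉ S, F θ k = 0) :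
    ∃ v g, IsProfile v g ∧ (∀ t ∈ Icc 0 T, ∀ k, fourierCoeff (v t) k = duhamel F t k) ∧
      profNorm 0 b g ≤ ENNReal.ofReal (2 + 2 * T ^ 2) * ∫⁻ θ in Icc 0 T, sqNorm (F θ) ∧
      ∀ s, profNorm s b g < ⊤ := by
  have hc : ∀ k, Continuous fun θ : ℝ => Complex.exp (-(Complex.I * θ * omega k)) * F θ k :=
    fun k => Continuous.mul (by fun_prop) (hF k)
  choose γ hm hi he hn using fun k => exists_mode hT (hc k)
  have hmode : ∀ k, modeNorm b (γ k) ≤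
      ENNReal.ofReal (2 + 2 * T ^ 2) * ∫⁻ θ in Icc 0 T, ‖F θ k‖ₑ ^ 2 := fun k => by
    simpa only [enorm_mul, enorm_exp_neg_I_mul, one_mul] using hn k b hb
  have hfin : ∀ k, modeNorm b (γ k) < ⊤ := fun k =>
    (hmode k).trans_lt (ENNReal.mul_lt_top ENNReal.ofReal_lt_top
      (lintegral_enorm_sq_Icc_lt_top (hF k) 0 T))
  have hprof : ∀ s, profNorm s b (fun σ k => if k ∈ S then γ k σ else 0) =
      ∑ k ∈ S, ENNReal.ofReal (bracket k ^ s) ^ 2 * modeNorm b (γ k) := by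
    intro s
    rw [profNorm, tsum_eq_sum (s := S) fun k hk => by simp [modeNorm, hk]]
    exact Finset.sum_congr rfl fun k hk => by simp only [hk, if_true]
  refine ⟨fun t => ofCoeff S fun k => Complex.exp (Complex.I * t * omega k) *
    ∫ σ : ℝ, γ k σ * Complex.exp (Complex.I * σ * t),
    fun σ k => if k ∈ S then γ k σ else 0, ⟨fun k => ?_, fun k => ?_, fun t k => ?_⟩,
    fun t ht k => ?_, ?_, fun s => ?_⟩
  · by_cases hk : k ∈ S
    · simpa only [hk, if_true] using hm k
    · simp only [hk, if_false, measurable_const]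
  · by_cases hk : k ∈ S
    · simpa only [hk, if_true] using hi k
    · simp only [hk, if_false]; exact integrable_zero _ _ _
  · rw [fourierCoeff_ofCoeff]
    by_cases hk : k ∈ S
    · simp only [hk, if_true]
    · simp only [hk, if_false, zero_mul, integral_zero, mul_zero]
  · rw [fourierCoeff_ofCoeff, duhamel]
    by_cases hk : k ∈ S
    · simp only [hk, if_true]
      rw [he k t ht]
    · simp [hk, hS]
  · rw [hprof]
    simp only [Real.rpow_zero, ENNReal.ofReal_one, one_pow, one_mul, sqNorm]
    rw [lintegral_tsum fun k => ((hF k).measurable.enorm.pow_const 2).aemeasurable,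
      ← ENNReal.tsum_mul_left]
    exact (Finset.sum_le_sum fun k _ => hmode k).trans (ENNReal.sum_le_tsum S)
  · rw [hprof]
    exact ENNReal.sum_lt_top.mpr fun k _ =>
      ENNReal.mul_lt_top (ENNReal.pow_lt_top ENNReal.ofReal_lt_top) (hfin k)

/-! ### Truncated equations with finitely many frequencies -/

lemma norm_fourierCoeff_le (f : L2) (k : ℤ) : ‖fourierCoeff f k‖ ≤ ‖f‖ := by
  rw [← ENNReal.ofReal_le_ofReal_iff (norm_nonneg _), ofReal_norm, ofReal_norm,
    ← ENNReal.pow_le_pow_left_iff two_ne_zero, enorm_sq_eq_sqNorm]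
  exact le_sqNorm _ k

lemma norm_fourierCoeff_sub_le (f g : L2) (k : ℤ) :
    ‖fourierCoeff f k - fourierCoeff g k‖ ≤ ‖f - g‖ := by
  rw [← fourierCoeff_sub]
  exact norm_fourierCoeff_le _ k

lemma norm_ofCoeff_le (S : Finset ℤ) (c : ℤ → ℂ) : ‖ofCoeff S c‖ ≤ ∑ k ∈ S, ‖c k‖ := by
  refine (norm_sum_le _ _).trans (Finset.sum_le_sum fun k _ => ?_)
  rw [norm_smul, (orthonormal_fourier (T := 2 * Real.pi)).1 k, mul_one]

lemma ofCoeff_sub (S : Finset ℤ) (c d : ℤ → ℂ) :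
    ofCoeff S c - ofCoeff S d = ofCoeff S fun k => c k - d k := by
  simp only [ofCoeff, sub_smul, Finset.sum_sub_distrib]

lemma continuous_ofCoeff {α : Type*} [TopologicalSpace α] (S : Finset ℤ) {c : α → ℤ → ℂ}
    (hc : ∀ k, Continuous fun x => c x k) : Continuous fun x => ofCoeff S (c x) :=
  continuous_finsetSum S fun k _ => (hc k).smul continuous_const

lemma continuous_fourierCoeff (k : ℤ) : Continuous fun f : L2 => fourierCoeff f k :=
  (LipschitzWith.of_dist_le' (K := 1) fun f g => by
    rw [dist_eq_norm, dist_eq_norm, one_mul]; exact norm_fourierCoeff_sub_le f g k).continuous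

/-- The free evolution `e^{it⟨∂ₓ²⟩}` on the frequencies in `S`. -/
def evolve (S : Finset ℤ) (t : ℝ) (f : L2) : L2 :=
  ofCoeff S fun k => Complex.exp (Complex.I * t * omega k) * fourierCoeff f k

lemma norm_evolve_sub_le (S : Finset ℤ) (t : ℝ) (f g : L2) :
    ‖evolve S t f - evolve S t g‖ ≤ S.card * ‖f - g‖ := by
  rw [evolve, evolve, ofCoeff_sub]
  refine (norm_ofCoeff_le _ _).trans ?_
  refine (Finset.sum_le_card_nsmul _ _ _ fun k _ => ?_).trans_eq (nsmul_eq_mul _ _)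
  rw [← mul_sub, norm_mul, norm_exp_I_mul, one_mul]
  exact norm_fourierCoeff_sub_le f g k

lemma continuous_evolve (S : Finset ℤ) {α : ℝ → L2} (hα : Continuous α) :
    Continuous fun t => evolve S t (α t) :=
  continuous_ofCoeff S fun k => Continuous.mul (by fun_prop) ((continuous_fourierCoeff k).comp hα)

lemma hasDerivAt_fourierCoeff {α : ℝ → L2} {α' : L2} {t : ℝ} (h : HasDerivAt α α' t) (k : ℤ) :
    HasDerivAt (fun t => fourierCoeff (α t) k) (fourierCoeff α' k) t := by
  have h1 := ((innerSL ℂ (fourierLp 2 k : L2)).restrictScalars ℝ).hasFDerivAt.comp_hasDerivAt t h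
  have h2 : ∀ f : L2, inner ℂ (fourierLp 2 k : L2) f = fourierCoeff f k := fun f => by
    rw [← fourierBasis_repr, HilbertBasis.repr_apply_apply, coe_fourierBasis]
  simpa only [Function.comp_def, ContinuousLinearMap.coe_restrictScalars', innerSL_apply_apply,
    h2] using h1

/-- With the free flow factored out, the equation is an ODE in `L²` whose field `V` is bounded and
Lipschitz on the whole space. Picard-Lindelöf then reaches time `T` in one application. -/
lemma exists_truncated_mild {S : Finset ℤ} {N : L2 → ℤ → ℂ} {B K : ℝ} (hK : 0 ≤ K)
    (hS : ∀ f, ∀ k ∉ S, N f k = 0) (hB : ∀ f, ∀ k ∈ S, ‖N f k‖ ≤ B)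
    (hN : ∀ f g, ∀ k ∈ S, ‖N f k - N g k‖ ≤ K * ‖f - g‖) {f₀ : L2}
    (h₀ : ∀ k ∉ S, fourierCoeff f₀ k = 0) {T : ℝ} (hT : 0 < T) :
    ∃ w : ℝ → L2, Continuous w ∧ ∀ t ∈ Icc 0 T, ∀ k, fourierCoeff (w t) k =
      Complex.exp (Complex.I * t * omega k) * fourierCoeff f₀ k
        + ∫ θ in (0 : ℝ)..t, Complex.exp (Complex.I * (t - θ) * omega k) * N (w θ) k := by
  have hNc : ∀ k, Continuous fun f => N f k := fun k => by
    by_cases hk : k ∈ S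
    · exact (LipschitzWith.of_dist_le' (K := K) fun f g => by
        rw [dist_eq_norm, dist_eq_norm]; exact hN f g k hk).continuous
    · simp only [hS _ k hk]
      exact continuous_const
  set V : ℝ → L2 → L2 := fun t x => ofCoeff S fun k =>
    Complex.exp (-(Complex.I * t * omega k)) * N (evolve S t x) k with hV
  have hVc : ∀ {α : ℝ → L2}, Continuous α → Continuous fun t => V t (α t) := fun hα =>
    continuous_ofCoeff S fun k =>
      Continuous.mul (by fun_prop) ((hNc k).comp (continuous_evolve S hα))
  have hPL : IsPicardLindelof V (tmin := 0) (tmax := T) ⟨0, ⟨le_rfl, hT.le⟩⟩ f₀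
      -- The ball has radius equal to the bound on `V` times `T`, so no trajectory leaves it before
      -- time `T`.
      (Real.toNNReal (S.card * B) * T.toNNReal) 0 (Real.toNNReal (S.card * B))
      (S.card * (K * S.card)).toNNReal := by
    refine ⟨fun t _ => ?_, fun x _ => (hVc continuous_const).continuousOn, fun t _ x _ => ?_, ?_⟩
    · refine (LipschitzWith.of_dist_le' fun x y => ?_).lipschitzOnWith
      rw [dist_eq_norm, dist_eq_norm, hV]
      simp only
      rw [ofCoeff_sub]
      refine (norm_ofCoeff_le _ _).trans ?_
      refine (Finset.sum_le_card_nsmul _ _ _ fun k hk => ?_).trans_eq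
        ((nsmul_eq_mul _ (K * (S.card * ‖x - y‖))).trans (by ring))
      rw [← mul_sub, norm_mul, norm_exp_neg_I_mul, one_mul]
      exact (hN _ _ k hk).trans (mul_le_mul_of_nonneg_left (norm_evolve_sub_le S t x y) hK)
    · refine le_trans ?_ (Real.le_coe_toNNReal _)
      refine (norm_ofCoeff_le _ _).trans ?_
      refine (Finset.sum_le_card_nsmul _ _ B fun k hk => ?_).trans_eq (nsmul_eq_mul _ _)
      rw [norm_mul, norm_exp_neg_I_mul, one_mul]
      exact hB _ k hk
    · simp [hT.le]
  obtain ⟨α, hα0, hα⟩ := hPL.exists_eq_forall_mem_Icc_hasDerivWithinAt₀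
  -- The trajectory is frozen outside `[0,T]` to obtain continuity on the whole line.
  set β : ℝ → L2 := fun t => α (projIcc 0 T hT.le t)
  have hβα : ∀ t ∈ Icc 0 T, β t = α t := fun t ht => by simp only [β, projIcc_of_mem hT.le ht]
  have hβc : Continuous β :=
    ContinuousOn.comp_continuous (fun t ht => (hα t ht).continuousWithinAt)
      (continuous_subtype_val.comp continuous_projIcc) fun t => (projIcc 0 T hT.le t).2
  refine ⟨fun t => evolve S t (β t), continuous_evolve S hβc, fun t ht k => ?_⟩
  simp only [evolve]
  rw [fourierCoeff_ofCoeff]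
  by_cases hk : k ∈ S
  swap
  · simp [hk, hS, h₀]
  have hFTC : ∫ θ in (0 : ℝ)..t, fourierCoeff (V θ (β θ)) k =
      fourierCoeff (β t) k - fourierCoeff (β 0) k := by
    refine intervalIntegral.integral_eq_sub_of_hasDerivAt_of_le ht.1
      ((continuous_fourierCoeff k).comp hβc).continuousOn (fun θ hθ => ?_)
      (((continuous_fourierCoeff k).comp (hVc hβc)).intervalIntegrable _ _)
    have hθ' : θ ∈ Ioo 0 T := ⟨hθ.1, hθ.2.trans_le ht.2⟩
    refine hasDerivAt_fourierCoeff ?_ k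
    rw [hβα θ ⟨hθ'.1.le, hθ'.2.le⟩]
    refine ((hα θ ⟨hθ'.1.le, hθ'.2.le⟩).hasDerivAt (Icc_mem_nhds hθ'.1 hθ'.2)).congr_of_eventuallyEq ?_
    filter_upwards [Icc_mem_nhds hθ'.1 hθ'.2] with r hr using hβα r hr
  have hβ0 : β 0 = f₀ := by rw [hβα 0 ⟨le_rfl, hT.le⟩]; exact hα0
  rw [if_pos hk, ← sub_add_cancel (fourierCoeff (β t) k) (fourierCoeff (β 0) k), ← hFTC, hβ0, mul_add,
    add_comm, ← intervalIntegral.integral_const_mul]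
  congr 1
  refine intervalIntegral.integral_congr fun θ _ => ?_
  simp only [hV, fourierCoeff_ofCoeff, if_pos hk]
  rw [← mul_assoc, ← Complex.exp_add]
  congr 2
  ring

/-- The radial truncation at radius `R`. -/
def radialCut {E : Type*} [NormedAddCommGroup E] [NormedSpace ℝ E] (R : ℝ) (x : E) : E :=
  (R / max R ‖x‖) • x

section

variable {E : Type*} [NormedAddCommGroup E] [NormedSpace ℝ E] {R : ℝ}

lemma radialCut_of_le (hR : 0 < R) {x : E} (hx : ‖x‖ ≤ R) : radialCut R x = x := by
  rw [radialCut, max_eq_left hx, div_self hR.ne', one_smul]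

lemma norm_radialCut_le (hR : 0 < R) (x : E) : ‖radialCut R x‖ ≤ R := by
  have hM : 0 < max R ‖x‖ := lt_max_of_lt_left hR
  rw [radialCut, norm_smul, Real.norm_of_nonneg (by positivity), div_mul_eq_mul_div,
    div_le_iff₀ hM]
  exact mul_le_mul_of_nonneg_left (le_max_right _ _) hR.le

lemma norm_radialCut_sub_le (hR : 0 < R) (x y : E) :
    ‖radialCut R x - radialCut R y‖ ≤ 2 * ‖x - y‖ := by
  have hx : 0 < max R ‖x‖ := lt_max_of_lt_left hR
  have hy : 0 < max R ‖y‖ := lt_max_of_lt_left hR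
  have e : radialCut R x - radialCut R y =
      (R / max R ‖x‖) • (x - y) + (R / max R ‖x‖ - R / max R ‖y‖) • y := by
    simp only [radialCut]
    module
  have h1 : R / max R ‖x‖ ≤ 1 := (div_le_one hx).mpr (le_max_left _ _)
  have h2 : |max R ‖y‖ - max R ‖x‖| ≤ ‖x - y‖ :=
    ((max_comm R ‖y‖ ▸ max_comm R ‖x‖ ▸ abs_max_sub_max_le_abs ‖y‖ ‖x‖ R)).trans
      ((abs_norm_sub_norm_le y x).trans_eq (norm_sub_rev y x))
  have h3 : |R / max R ‖x‖ - R / max R ‖y‖| * ‖y‖ ≤ ‖x - y‖ := by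
    have : R / max R ‖x‖ - R / max R ‖y‖ =
        (R / max R ‖x‖) * ((max R ‖y‖ - max R ‖x‖) / max R ‖y‖) := by
      field_simp
    rw [this, abs_mul, abs_div (_ - _), abs_of_pos hy, abs_of_nonneg (a := R / _) (by positivity),
      mul_assoc,
      div_mul_eq_mul_div]
    have h4 : |max R ‖y‖ - max R ‖x‖| * ‖y‖ / max R ‖y‖ ≤ ‖x - y‖ := by
      rw [div_le_iff₀ hy]
      exact mul_le_mul h2 (le_max_right _ _) (norm_nonneg _) (norm_nonneg _)
    refine le_of_eq_of_le ?_ ((mul_le_of_le_one_left (by positivity) h1).trans h4)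
    ring
  rw [e]
  refine (norm_add_le _ _).trans ?_
  rw [norm_smul, norm_smul, Real.norm_of_nonneg (by positivity), Real.norm_eq_abs]
  have := mul_le_of_le_one_left (norm_nonneg (x - y)) h1
  linarith

end

lemma exists_truncated_projForcing {τ R T : ℝ} (hτ : 0 < τ) (hR : 0 < R) (hT : 0 < T) (u₀ : L2) :
    ∃ w : ℝ → L2, Continuous w ∧ (∀ t ∈ Icc 0 T, proj τ (w t) = w t) ∧
      ∀ t ∈ Icc 0 T, ∀ k, fourierCoeff (w t) k =
      Complex.exp (Complex.I * t * omega k) * fourierCoeff (proj τ u₀) k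
        + ∫ θ in (0 : ℝ)..t, Complex.exp (Complex.I * (t - θ) * omega k) *
          (cutoff τ k * forcing (radialCut R (w θ)) k) := by
  have hcut : ∀ (k : ℤ) (z : ℂ), ‖cutoff τ k * z‖ ≤ ‖z‖ := fun k z => by
    rw [norm_mul]
    exact mul_le_of_le_one_left (norm_nonneg _) (norm_cutoff_le τ k)
  have hB : ∀ f : L2, ∀ k ∈ freq τ, ‖cutoff τ k * forcing (radialCut R f) k‖ ≤
      R * (1 + R) + ∑ k ∈ freq τ, ‖forcing 0 k‖ := by
    intro f k hk
    refine (hcut k _).trans ?_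
    have h1 := norm_forcing_sub_le_mul (radialCut R f) 0 k
    rw [sub_zero, add_zero] at h1
    have h2 := norm_radialCut_le hR f
    have h3 : ‖radialCut R f‖ * (1 + ‖radialCut R f‖) ≤ R * (1 + R) := by gcongr
    have h4 := norm_le_norm_add_norm_sub' (forcing (radialCut R f) k) (forcing 0 k)
    have h5 := Finset.single_le_sum (f := fun k => ‖forcing 0 k‖) (fun _ _ => norm_nonneg _) hk
    linarith
  have hL : ∀ f g : L2, ∀ k ∈ freq τ, ‖cutoff τ k * forcing (radialCut R f) k -
      cutoff τ k * forcing (radialCut R g) k‖ ≤ 2 * (1 + 2 * R) * ‖f - g‖ := by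
    intro f g k _
    rw [← mul_sub]
    refine (hcut k _).trans ((norm_forcing_sub_le_mul _ _ k).trans ?_)
    have h1 := norm_radialCut_sub_le hR f g
    have h2 : ‖radialCut R f + radialCut R g‖ ≤ 2 * R := by
      refine (norm_add_le _ _).trans ?_
      have := norm_radialCut_le hR f
      have := norm_radialCut_le hR g
      linarith
    calc _ ≤ 2 * ‖f - g‖ * (1 + 2 * R) := by gcongr
      _ = _ := by ring
  obtain ⟨w, hw, hwk⟩ := exists_truncated_mild (S := freq τ)
    (N := fun f k => cutoff τ k * forcing (radialCut R f) k) (by positivity)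
    (fun f k hk => by rw [cutoff_eq_zero hτ hk, zero_mul]) hB hL
    (f₀ := proj τ u₀) (fun k hk => by rw [fourierCoeff_proj hτ, cutoff_eq_zero hτ hk, zero_mul]) hT
  refine ⟨w, hw, fun t ht => fourierCoeff_injective fun k => ?_, hwk⟩
  rw [fourierCoeff_proj hτ, hwk t ht, fourierCoeff_proj hτ]
  rcases cutoff_eq_zero_or_one τ k with h | h <;> simp [h]

/-! ### The energy inequality for the error -/

lemma enorm_sq_mul_enorm_sq_le (a q e : ℂ) : ‖q + e‖ₑ ^ 2 * ‖2 * a - (q + e)‖ₑ ^ 2 ≤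
    16 * (‖a‖ₑ ^ 2 * ‖q‖ₑ ^ 2 + ‖a‖ₑ ^ 2 * ‖e‖ₑ ^ 2 + ‖q‖ₑ ^ 2 * ‖q‖ₑ ^ 2 +
      ‖e‖ₑ ^ 2 * ‖e‖ₑ ^ 2) := by
  have h1 : ‖q + e‖ₑ ^ 2 ≤ 2 * ‖q‖ₑ ^ 2 + 2 * ‖e‖ₑ ^ 2 := enorm_add_sq_le q e
  have h2 : ‖2 * a - (q + e)‖ₑ ^ 2 ≤ 8 * ‖a‖ₑ ^ 2 + 2 * ‖q + e‖ₑ ^ 2 := by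
    refine (enorm_sub_sq_le _ _).trans_eq ?_
    rw [enorm_mul, mul_pow, ← mul_assoc]
    congr 2
    rw [← ofReal_norm]
    norm_num
  have h3 : (‖q‖ₑ ^ 2 + ‖e‖ₑ ^ 2) ^ 2 ≤ 2 * (‖q‖ₑ ^ 2) ^ 2 + 2 * (‖e‖ₑ ^ 2) ^ 2 :=
    add_sq_le_two_mul _ _
  calc ‖q + e‖ₑ ^ 2 * ‖2 * a - (q + e)‖ₑ ^ 2
      ≤ (2 * ‖q‖ₑ ^ 2 + 2 * ‖e‖ₑ ^ 2) *
        (8 * ‖a‖ₑ ^ 2 + 2 * (2 * ‖q‖ₑ ^ 2 + 2 * ‖e‖ₑ ^ 2)) := by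
        gcongr
        exact h2.trans (by gcongr)
    _ = 16 * (‖a‖ₑ ^ 2 * ‖q‖ₑ ^ 2 + ‖a‖ₑ ^ 2 * ‖e‖ₑ ^ 2) +
        8 * (‖q‖ₑ ^ 2 + ‖e‖ₑ ^ 2) ^ 2 := by ring
    _ ≤ 16 * (‖a‖ₑ ^ 2 * ‖q‖ₑ ^ 2 + ‖a‖ₑ ^ 2 * ‖e‖ₑ ^ 2) +
        8 * (2 * (‖q‖ₑ ^ 2) ^ 2 + 2 * (‖e‖ₑ ^ 2) ^ 2) := by gcongr
    _ = _ := by ring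

/-- Writing `v + w = 2v - (q + e)` eliminates `w`, for which no Strichartz bound is known in
advance. Only `v`, `q` and `e` remain, each with a bilinear estimate. -/
lemma pair_sub_add_le {v w q e : L2} (h : v - w = q + e) :
    pair (v - w : L2) (v + w : L2) ≤ 16 * (pair v q + pair v e + pair q q + pair e e) := by
  have hm : ∀ f g : L2, AEMeasurable (fun x => ‖f x‖ₑ ^ 2 * ‖g x‖ₑ ^ 2)
      (AddCircle.haarAddCircle : Measure Torus) := fun f g =>
    (aemeasurable_enorm_sq f).mul (aemeasurable_enorm_sq g)
  simp only [pair]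
  rw [← lintegral_add_right' _ (hm v e), ← lintegral_add_right' _ (hm q q),
    ← lintegral_add_right' _ (hm e e), ← lintegral_const_mul' _ _ (by norm_num)]
  refine lintegral_mono_ae ?_
  have h1 := Lp.coeFn_sub v w
  have h2 := Lp.coeFn_add v w
  have h3 := Lp.coeFn_add q e
  rw [← h] at h3
  filter_upwards [h1, h2, h3] with x h1 h2 h3
  have h4 : (v + w : L2) x = 2 * v x - (q x + e x) := by
    rw [h1] at h3
    rw [h2, Pi.add_apply]
    rw [Pi.sub_apply, Pi.add_apply] at h3
    linear_combination -h3
  rw [h3, h4]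
  exact enorm_sq_mul_enorm_sq_le _ _ _

lemma sqNorm_forcing_sub_le_of_eq {v w q e : L2} (h : v - w = q + e) :
    sqNorm (fun k => forcing v k - forcing w k) ≤ 4 * ‖q‖ₑ ^ 2 + 4 * ‖e‖ₑ ^ 2 +
      32 * (pair v q + pair v e + pair q q + pair e e) := by
  refine (sqNorm_forcing_sub_le v w).trans ?_
  have h1 : ‖v - w‖ₑ ^ 2 ≤ 2 * ‖q‖ₑ ^ 2 + 2 * ‖e‖ₑ ^ 2 := by
    rw [h]
    exact enorm_add_sq_le q e
  calc _ ≤ 2 * (2 * ‖q‖ₑ ^ 2 + 2 * ‖e‖ₑ ^ 2) +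
        2 * (16 * (pair v q + pair v e + pair q q + pair e e)) := by
        gcongr
        exact pair_sub_add_le h
    _ = _ := by ring

/-- The function is lower semicontinuous in time, by `pair_le_liminf`. -/
lemma measurable_pair {u v : ℝ → L2} (hu : Continuous u) (hv : Continuous v) :
    Measurable fun t => pair (u t) (v t) := by
  refine LowerSemicontinuous.measurable (lowerSemicontinuous_iff_isClosed_preimage.mpr fun c => ?_)
  refine IsSeqClosed.isClosed fun θ t hθ hlim => ?_
  refine (pair_le_liminf ((hu.tendsto t).comp hlim) ((hv.tendsto t).comp hlim)).trans ?_
  exact liminf_le_of_le (by isBoundedDefault) fun a ha => by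
    obtain ⟨n, hn⟩ := ha.exists
    exact hn.trans (hθ n)

/-- Terms with `q` give a multiple of its squared norm. Terms linear in the energy carry `1/(2λ)`.
The product of `e` with itself is quadratic in the energy and pays `e^{2λT}`. All constants involve
`T` and not the running time `t`. -/
lemma energy_le_of_split {b lam t T : ℝ} (hb : 1 / 2 < b) (hlam : 0 < lam)
    (htT : t ≤ T) {v q e : ℝ → L2} {g h : ℝ → ℤ → ℂ} {F : ℝ → ℤ → ℂ} (hv : IsProfile v g)
    (hg : profNorm 0 b g < ⊤) (hq : IsProfile q h) (hh : profNorm 0 b h ≤ profNorm 0 b g)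
    (hec : Continuous e) (he : IsDuhamel t F e)
    (hF : ∀ᵐ θ ∂volume.restrict (Icc 0 t), sqNorm (F θ) ≤ 4 * ‖q θ‖ₑ ^ 2 + 4 * ‖e θ‖ₑ ^ 2 +
      32 * (pair (v θ) (q θ) + pair (v θ) (e θ) + pair (q θ) (q θ) + pair (e θ) (e θ))) :
    energy lam t F ≤
      (4 * ENNReal.ofReal T * weightConst b +
        64 * (strichartzConst T * (weightConst b * profNorm 0 b g)) * weightConst b) *
          profNorm 0 b h +
      (4 * ENNReal.ofReal T + 32 * (strichartzConst T * (weightConst b * profNorm 0 b g))) *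
        ENNReal.ofReal (1 / (2 * lam)) * energy lam t F +
      32 * (strichartzConst T : ℝ≥0∞) * ENNReal.ofReal (Real.exp (2 * lam * T)) *
        ENNReal.ofReal (1 / (2 * lam)) ^ 2 * energy lam t F ^ 2 := by
  set W := weightConst b
  set G := profNorm 0 b g
  set m := profNorm 0 b h
  set y := energy lam t F
  set L := ENNReal.ofReal (1 / (2 * lam))
  set Sc : ℝ≥0∞ := (strichartzConst T : ℝ≥0∞)
  have hvc := hv.continuous hb hg
  have hqc := hq.continuous hb (hh.trans_lt hg)
  set ω : ℝ → ℝ≥0∞ := fun θ => ENNReal.ofReal (Real.exp (-(2 * lam * θ))) with hω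
  have hωm : Measurable ω := measurable_exp_weight lam
  have hω1 : ∀ θ ∈ Icc 0 t, ω θ ≤ 1 := fun θ hθ => exp_weight_le_one hlam hθ.1
  have hvS : StrichartzBound t (Sc * (W * G)) fun t => fourierCoeff (v t) :=
    (hv.strichartzBound b T).mono htT
  have hqS : StrichartzBound t (Sc * (W * m)) fun t => fourierCoeff (q t) :=
    (hq.strichartzBound b T).mono htT
  have hvol : ∀ c : ℝ≥0∞, ∫⁻ _ in Icc 0 t, c ≤ c * ENNReal.ofReal T := fun c => by
    rw [setLIntegral_const, Real.volume_Icc, sub_zero]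
    gcongr
  have i1 : ∫⁻ θ in Icc 0 t, ω θ * ‖q θ‖ₑ ^ 2 ≤ W * m * ENNReal.ofReal T := by
    refine le_trans (setLIntegral_mono' measurableSet_Icc fun θ hθ => ?_) (hvol _)
    exact (mul_le_of_le_one_left' (hω1 θ hθ)).trans (hq.enorm_sq_le b θ)
  have i2 : ∫⁻ θ in Icc 0 t, ω θ * ‖e θ‖ₑ ^ 2 ≤ L * y * ENNReal.ofReal T := by
    refine le_trans (setLIntegral_mono' measurableSet_Icc fun θ hθ => ?_) (hvol _)
    exact he.enorm_sq_le hlam hθ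
  have i3 : ∫⁻ θ in Icc 0 t, ω θ * pair (v θ) (q θ) ≤ Sc * (W * G) * (W * m) :=
    (setLIntegral_mono' measurableSet_Icc fun θ hθ => mul_le_of_le_one_left' (hω1 θ hθ)).trans
      (hq.lintegral_pair_le hvS (fun _ _ _ => rfl) (eqOn_refl _ _) b)
  have i4 : ∫⁻ θ in Icc 0 t, ω θ * pair (v θ) (e θ) ≤ Sc * (W * G) * (L * y) :=
    he.lintegral_pair_le hvS (fun _ _ _ => rfl) hlam
  have i5 : ∫⁻ θ in Icc 0 t, ω θ * pair (q θ) (q θ) ≤ Sc * (W * G) * (W * m) := by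
    refine ((setLIntegral_mono' measurableSet_Icc fun θ hθ =>
      mul_le_of_le_one_left' (hω1 θ hθ)).trans
      (hq.lintegral_pair_le hqS (fun _ _ _ => rfl) (eqOn_refl _ _) b)).trans ?_
    gcongr
  have i6 : ∫⁻ θ in Icc 0 t, ω θ * pair (e θ) (e θ) ≤
      Sc * (ENNReal.ofReal (Real.exp (2 * lam * T)) * (L * y)) * (L * y) := by
    refine (he.lintegral_pair_le (he.strichartzBound htT hlam) he.eq hlam).trans ?_
    gcongr
  have hmn : ∀ {f : ℝ → L2}, Continuous f → Measurable fun θ => ω θ * ‖f θ‖ₑ ^ 2 := fun hf =>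
    hωm.mul (hf.enorm.measurable.pow_const 2)
  have hmp : ∀ {f f' : ℝ → L2}, Continuous f → Continuous f' →
      Measurable fun θ => ω θ * pair (f θ) (f' θ) := fun hf hf' => hωm.mul (measurable_pair hf hf')
  calc y ≤ ∫⁻ θ in Icc 0 t, (4 * (ω θ * ‖q θ‖ₑ ^ 2) + 4 * (ω θ * ‖e θ‖ₑ ^ 2) +
        32 * (ω θ * pair (v θ) (q θ) + ω θ * pair (v θ) (e θ) + ω θ * pair (q θ) (q θ) +
          ω θ * pair (e θ) (e θ))) := by
        refine lintegral_mono_ae ?_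
        filter_upwards [hF] with θ hθ
        refine (mul_le_mul_right hθ _).trans_eq ?_
        simp only [hω]
        ring
    _ = 4 * (∫⁻ θ in Icc 0 t, ω θ * ‖q θ‖ₑ ^ 2) + 4 * (∫⁻ θ in Icc 0 t, ω θ * ‖e θ‖ₑ ^ 2) +
        32 * ((∫⁻ θ in Icc 0 t, ω θ * pair (v θ) (q θ)) +
          (∫⁻ θ in Icc 0 t, ω θ * pair (v θ) (e θ)) +
          (∫⁻ θ in Icc 0 t, ω θ * pair (q θ) (q θ)) +
          ∫⁻ θ in Icc 0 t, ω θ * pair (e θ) (e θ)) := by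
        rw [← lintegral_add_right _ (hmp hvc hec), ← lintegral_add_right _ (hmp hqc hqc),
          ← lintegral_add_right _ (hmp hec hec), ← lintegral_const_mul' 32 _ (by norm_num),
          ← lintegral_const_mul (f := fun θ => ω θ * ‖q θ‖ₑ ^ 2) 4 (hmn hqc),
          ← lintegral_const_mul (f := fun θ => ω θ * ‖e θ‖ₑ ^ 2) 4 (hmn hec),
          ← lintegral_add_right _ ((hmn hec).const_mul 4),
          ← lintegral_add_left (f := fun θ => 4 * (ω θ * ‖q θ‖ₑ ^ 2) + 4 * (ω θ * ‖e θ‖ₑ ^ 2))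
            (((hmn hqc).const_mul 4).add ((hmn hec).const_mul 4))]
    _ ≤ 4 * (W * m * ENNReal.ofReal T) + 4 * (L * y * ENNReal.ofReal T) +
        32 * (Sc * (W * G) * (W * m) + Sc * (W * G) * (L * y) + Sc * (W * G) * (W * m) +
          Sc * (ENNReal.ofReal (Real.exp (2 * lam * T)) * (L * y)) * (L * y)) := by gcongr
    _ = _ := by ring

/-- If `Y` exceeded `c` it would take the value `c` at an earlier time, where the improved bound `Y
≤ m < c` holds. -/
lemma le_of_bootstrap {T c m : ℝ} {Y : ℝ → ℝ} (hY : Continuous Y) (h0 : Y 0 ≤ c) (hm : m < c)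
    (h : ∀ t ∈ Icc 0 T, Y t ≤ c → Y t ≤ m) : ∀ t ∈ Icc 0 T, Y t ≤ m := by
  intro t ht
  refine h t ht (not_lt.mp fun hlt => ?_)
  obtain ⟨r, hr, hrc⟩ := intermediate_value_Icc ht.1 hY.continuousOn ⟨h0, hlt.le⟩
  have := h r ⟨hr.1, hr.2.trans ht.2⟩ hrc.le
  linarith

/-! ### High frequencies -/

lemma cutoff_eq_one {τ : ℝ} (hτ : 0 < τ) {k : ℤ} (hk : |(k : ℝ)| ≤ τ ^ (-(1 / 2) : ℝ)) :
    cutoff τ k = 1 := by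
  have hM : 0 < τ ^ (-(1 / 2) : ℝ) := Real.rpow_pos_of_pos hτ _
  refine indicator_of_mem ?_ _
  rw [mem_Icc, ← abs_le, abs_div, abs_of_pos hM, div_le_one hM]
  exact hk

/-- Frequencies that survive have `|k| > τ^{-1/2}`, hence `1 ≤ τ⟨k⟩²`. The norms are squared, which
gives `τ^s` here and `τ^{s/2}` in the end. -/
lemma profNorm_highpass_le {τ s : ℝ} (hτ : 0 < τ) (hs : 0 ≤ s) (b : ℝ) (g : ℝ → ℤ → ℂ) :
    profNorm 0 b (fun σ k => (1 - cutoff τ k) * g σ k) ≤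
      ENNReal.ofReal (τ ^ s) * profNorm s b g := by
  rw [profNorm, profNorm, ← ENNReal.tsum_mul_left]
  refine ENNReal.tsum_le_tsum fun k => ?_
  rw [modeNorm_const_mul, ← mul_assoc, ← mul_assoc]
  refine mul_le_mul_left ?_ _
  by_cases hk : |(k : ℝ)| ≤ τ ^ (-(1 / 2) : ℝ)
  · simp [cutoff_eq_one hτ hk]
  have h1 : ‖1 - cutoff τ k‖ₑ ≤ 1 := by
    rcases cutoff_eq_zero_or_one τ k with h | h <;> simp [h]
  have h2 : 1 ≤ τ ^ s * (bracket k ^ s) ^ 2 := by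
    have h3 : |(k : ℝ)| ≤ bracket k := by
      rw [bracket]
      exact Real.abs_le_sqrt (by linarith)
    have h4 : 1 ≤ τ * bracket k ^ 2 := by
      have h5 : τ ^ (-(1 / 2) : ℝ) ≤ bracket k := (not_le.mp hk).le.trans h3
      calc (1 : ℝ) = τ * (τ ^ (-(1 / 2) : ℝ)) ^ 2 := by
            rw [← Real.rpow_natCast, ← Real.rpow_mul hτ.le]
            norm_num
            rw [Real.rpow_neg_one, mul_inv_cancel₀ hτ.ne']
        _ ≤ _ := by gcongr
    have h6 := Real.one_le_rpow h4 hs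
    rw [Real.mul_rpow hτ.le (by positivity), ← Real.rpow_natCast, ← Real.rpow_mul (bracket_pos _).le,
      mul_comm, mul_comm _ s] at h6
    rw [← Real.rpow_natCast, ← Real.rpow_mul (bracket_pos _).le, mul_comm]
    exact h6
  calc _ ≤ (1 : ℝ≥0∞) := by
        simp only [Real.rpow_zero, ENNReal.ofReal_one, one_pow, one_mul]
        exact pow_le_one' h1 2
    _ ≤ _ := by
        rw [← ENNReal.ofReal_pow (Real.rpow_nonneg (bracket_pos _).le _),
          ← ENNReal.ofReal_mul (by positivity), ENNReal.one_le_ofReal]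
        exact h2

/-- The tail of a convergent series is small. No rate is available, but the smallness starts the
bootstrap even for `s = 0`. -/
lemma exists_profNorm_highpass_le {b : ℝ} {g : ℝ → ℤ → ℂ} (hg : profNorm 0 b g < ⊤) {ε : ℝ≥0∞}
    (hε : 0 < ε) : ∃ τ₀ : ℝ, 0 < τ₀ ∧ ∀ τ, 0 < τ → τ ≤ τ₀ →
      profNorm 0 b (fun σ k => (1 - cutoff τ k) * g σ k) ≤ ε := by
  obtain ⟨S, hS⟩ := ((ENNReal.tendsto_tsum_compl_atTop_zero hg.ne).eventually_le_const hε).exists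
  set N : ℝ := 1 + ∑ k ∈ S, |(k : ℝ)| with hN
  have hNpos : 0 < N := by positivity
  -- For `τ ≤ N^{-2}` the projection keeps all frequencies up to `N`, in particular those in `S`.
  refine ⟨N ^ (-2 : ℝ), by positivity, fun τ hτ hle => le_trans ?_ hS⟩
  have hcut : ∀ k ∈ S, cutoff τ k = 1 := by
    intro k hk
    refine cutoff_eq_one hτ ?_
    have h1 : |(k : ℝ)| ≤ N := by
      have := Finset.single_le_sum (f := fun k : ℤ => |(k : ℝ)|) (fun _ _ => abs_nonneg _) hk
      linarith
    refine h1.trans ?_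
    calc N = (N ^ (-2 : ℝ)) ^ (-(1 / 2) : ℝ) := by
          rw [← Real.rpow_mul hNpos.le]
          norm_num
      _ ≤ _ := Real.rpow_le_rpow_of_nonpos hτ hle (by norm_num)
  refine le_of_le_of_eq (ENNReal.tsum_le_tsum fun k => ?_) (tsum_subtype {k | k ∉ S}
    fun k : ℤ => ENNReal.ofReal (bracket k ^ (0 : ℝ)) ^ 2 * modeNorm b fun σ => g σ k).symm
  rw [modeNorm_const_mul]
  by_cases hk : k ∈ S
  · simp [hcut k hk]
  · rw [indicator_of_mem (by exact hk)]
    refine mul_le_mul_right (mul_le_of_le_one_left' (pow_le_one' ?_ 2)) _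
    rcases cutoff_eq_zero_or_one τ k with h | h <;> simp [h]

/-! ### Energies of finitely many frequencies -/

lemma sqNorm_eq_sum {S : Finset ℤ} {c : ℤ → ℂ} (hc : ∀ k ∉ S, c k = 0) :
    sqNorm c = ENNReal.ofReal (∑ k ∈ S, ‖c k‖ ^ 2) := by
  rw [sqNorm, tsum_eq_sum (s := S) fun k hk => by simp [hc k hk],
    ENNReal.ofReal_sum_of_nonneg fun k _ => by positivity]
  exact Finset.sum_congr rfl fun k _ => by rw [ENNReal.ofReal_pow (norm_nonneg _), ofReal_norm]

lemma energy_eq_ofReal {S : Finset ℤ} {F : ℝ → ℤ → ℂ} (hF : ∀ k, Continuous fun θ => F θ k)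
    (hS : ∀ θ, ∀ k ∉ S, F θ k = 0) (lam : ℝ) {t : ℝ} (ht : 0 ≤ t) :
    energy lam t F = ENNReal.ofReal (∫ θ in (0 : ℝ)..t,
      Real.exp (-(2 * lam * θ)) * ∑ k ∈ S, ‖F θ k‖ ^ 2) := by
  have hc : Continuous fun θ => Real.exp (-(2 * lam * θ)) * ∑ k ∈ S, ‖F θ k‖ ^ 2 :=
    Continuous.mul (by fun_prop) (continuous_finsetSum S fun k _ => (hF k).norm.pow 2)
  rw [intervalIntegral.integral_of_le ht, ← integral_Icc_eq_integral_Ioc,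
    ofReal_integral_eq_lintegral_ofReal hc.continuousOn.integrableOn_Icc
      (ae_of_all _ fun θ => by positivity), energy]
  refine lintegral_congr fun θ => ?_
  rw [sqNorm_eq_sum (hS θ), ENNReal.ofReal_mul (Real.exp_pos _).le]

lemma energy_congr {lam t T : ℝ} (htT : t ≤ T) {F F' : ℝ → ℤ → ℂ}
    (h : ∀ᵐ θ ∂volume.restrict (Icc 0 T), F' θ = F θ) : energy lam t F' = energy lam t F := by
  refine lintegral_congr_ae ?_
  filter_upwards [ae_restrict_of_ae_restrict_of_subset (Icc_subset_Icc_right htT) h] with θ hθ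
  rw [hθ]

/-- The linear term is at most `Y/2` and, while `Y ≤ c`, the quadratic one at most `Y/4`; a quarter
of `Y` remains on the left. -/
lemma le_four_mul_of_quadratic {A B D m : ℝ≥0∞} {L c Y : ℝ} (hA : A < ⊤) (hB : B < ⊤) (hD : D < ⊤)
    (hm : m < ⊤) (hL : 0 ≤ L) (hBL : B.toReal * L ≤ 1 / 2) (hY : 0 ≤ Y) (hYc : Y ≤ c)
    (hc : D.toReal * c ≤ 1 / 4)
    (h : ENNReal.ofReal Y ≤ A * m + B * ENNReal.ofReal L * ENNReal.ofReal Y +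
      D * ENNReal.ofReal Y ^ 2) : Y ≤ 4 * A.toReal * m.toReal := by
  rw [← ENNReal.ofReal_toReal hA.ne, ← ENNReal.ofReal_toReal hB.ne, ← ENNReal.ofReal_toReal hD.ne,
    ← ENNReal.ofReal_toReal hm.ne, ← ENNReal.ofReal_pow hY, ← ENNReal.ofReal_mul (by positivity),
    ← ENNReal.ofReal_mul (by positivity), ← ENNReal.ofReal_mul (by positivity),
    ← ENNReal.ofReal_mul (by positivity), ← ENNReal.ofReal_add (by positivity) (by positivity),
    ← ENNReal.ofReal_add (by positivity) (by positivity),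
    ENNReal.ofReal_le_ofReal_iff (by positivity)] at h
  have h1 : B.toReal * L * Y ≤ 1 / 2 * Y := mul_le_mul_of_nonneg_right hBL hY
  have h2 : D.toReal * Y ^ 2 ≤ 1 / 4 * Y := by
    have : D.toReal * Y ≤ 1 / 4 := (mul_le_mul_of_nonneg_left hYc ENNReal.toReal_nonneg).trans hc
    calc D.toReal * Y ^ 2 = D.toReal * Y * Y := by ring
      _ ≤ _ := mul_le_mul_of_nonneg_right this hY
  linarith

lemma IsDuhamel.norm_le_one {T lam t θ c : ℝ} {F : ℝ → ℤ → ℂ} {e : ℝ → L2} (h : IsDuhamel t F e)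
    (hlam : 0 < lam) (htT : t ≤ T) (hθ : θ ∈ Icc 0 t)
    (hc : c ≤ 2 * lam * Real.exp (-(2 * lam * T))) (hF : energy lam t F ≤ ENNReal.ofReal c) :
    ‖e θ‖ ≤ 1 := by
  have h1 := (h.enorm_sq_le hlam hθ).trans (mul_le_mul_right hF _)
  rw [← ofReal_norm, ← ENNReal.ofReal_pow (norm_nonneg _), ← ENNReal.ofReal_mul (Real.exp_pos _).le,
    ← ENNReal.ofReal_mul (by positivity)] at h1
  have h2 : ENNReal.ofReal (1 / (2 * lam) * c) ≤ ENNReal.ofReal (Real.exp (-(2 * lam * θ))) := by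
    refine ENNReal.ofReal_le_ofReal ?_
    rw [one_div_mul_eq_div, div_le_iff₀ (by positivity), mul_comm]
    refine hc.trans (mul_le_mul_of_nonneg_left (Real.exp_le_exp.mpr ?_) (by positivity))
    nlinarith [hθ.2]
  have h3 := h1.trans h2
  rw [ENNReal.ofReal_le_ofReal_iff (Real.exp_pos _).le, mul_le_iff_le_one_right (Real.exp_pos _)] at h3
  exact (sq_le_one_iff₀ (norm_nonneg _)).mp h3

/-- The constants depend only on `b`, `T` and the norm of `v`, before `τ` is fixed. The estimate on
`F` is assumed only where `‖e‖ ≤ 1`, that is, where the radial truncation will be inactive; the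
bootstrap proves that this is everywhere. -/
lemma exists_energy_bootstrap {b T : ℝ} (hb : 1 / 2 < b) (hT : 0 < T) {v : ℝ → L2}
    {g : ℝ → ℤ → ℂ} (hv : IsProfile v g) (hg : profNorm 0 b g < ⊤) :
    ∃ lam a ε : ℝ, 0 < lam ∧ 0 ≤ a ∧ 0 < ε ∧ ∀ (S : Finset ℤ) (q e : ℝ → L2)
      (h F F' : ℝ → ℤ → ℂ), IsProfile q h → profNorm 0 b h ≤ profNorm 0 b g →
      profNorm 0 b h ≤ ENNReal.ofReal ε → Continuous e → IsDuhamel T F' e →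
      (∀ᵐ θ ∂volume.restrict (Icc 0 T), F' θ = F θ) → (∀ k, Continuous fun θ => F θ k) →
      (∀ θ, ∀ k ∉ S, F θ k = 0) →
      (∀ θ ∈ Icc 0 T, ‖e θ‖ ≤ 1 → sqNorm (F θ) ≤ 4 * ‖q θ‖ₑ ^ 2 + 4 * ‖e θ‖ₑ ^ 2 +
        32 * (pair (v θ) (q θ) + pair (v θ) (e θ) + pair (q θ) (q θ) + pair (e θ) (e θ))) →
      energy lam T F ≤ ENNReal.ofReal a * profNorm 0 b h ∧ ∀ t ∈ Icc 0 T, ‖e t‖ ≤ 1 := by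
  have hW := weightConst_lt_top hb
  have hSc : (strichartzConst T : ℝ≥0∞) < ⊤ := ENNReal.coe_lt_top
  set A : ℝ≥0∞ := 4 * ENNReal.ofReal T * weightConst b +
    64 * (strichartzConst T * (weightConst b * profNorm 0 b g)) * weightConst b with hA_def
  set B : ℝ≥0∞ := 4 * ENNReal.ofReal T +
    32 * (strichartzConst T * (weightConst b * profNorm 0 b g)) with hB_def
  have hA : A < ⊤ := by rw [hA_def]; finiteness
  have hB : B < ⊤ := by rw [hB_def]; finiteness
  -- This makes `B/(2λ) ≤ 1/2`; only then is `D`, which depends on `λ`, defined.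
  set lam : ℝ := B.toReal + 1
  have hlam : 0 < lam := add_pos_of_nonneg_of_pos ENNReal.toReal_nonneg one_pos
  set D : ℝ≥0∞ := 32 * (strichartzConst T : ℝ≥0∞) * ENNReal.ofReal (Real.exp (2 * lam * T)) *
    ENNReal.ofReal (1 / (2 * lam)) ^ 2 with hD_def
  have hD : D < ⊤ := by rw [hD_def]; finiteness
  -- The first threshold makes the quadratic term absorbable, the second forces `‖e‖ ≤ 1` while the
  -- energy is below `c`.
  set c : ℝ := min (1 / (4 * (D.toReal + 1))) (2 * lam * Real.exp (-(2 * lam * T)))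
  have hD0 : 0 ≤ D.toReal := ENNReal.toReal_nonneg
  have hA0 : 0 ≤ A.toReal := ENNReal.toReal_nonneg
  have hc : 0 < c := lt_min (by positivity) (by positivity)
  have hDc : D.toReal * c ≤ 1 / 4 := by
    refine (mul_le_mul_of_nonneg_left (min_le_left _ _) hD0).trans ?_
    rw [mul_one_div, div_le_div_iff₀ (by positivity) (by norm_num)]
    linarith
  have hBL : B.toReal * (1 / (2 * lam)) ≤ 1 / 2 := by
    rw [mul_one_div, div_le_div_iff₀ (by positivity) (by norm_num)]
    simp only [lam]
    linarith
  refine ⟨lam, 4 * A.toReal, c / (8 * (A.toReal + 1)), hlam, by positivity, by positivity, ?_⟩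
  intro S q e h F F' hq hh hhε hec he hae hFc hFS hF
  set Y : ℝ → ℝ := fun t => ∫ θ in (0 : ℝ)..t, Real.exp (-(2 * lam * θ)) * ∑ k ∈ S, ‖F θ k‖ ^ 2
  have hφ : Continuous fun θ => Real.exp (-(2 * lam * θ)) * ∑ k ∈ S, ‖F θ k‖ ^ 2 :=
    Continuous.mul (by fun_prop) (continuous_finsetSum S fun k _ => (hFc k).norm.pow 2)
  have hYc : Continuous Y := intervalIntegral.continuous_primitive
    (fun _ _ => hφ.intervalIntegrable _ _) 0
  have hYe : ∀ t ∈ Icc 0 T, energy lam t F' = ENNReal.ofReal (Y t) := fun t ht => by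
    rw [energy_congr ht.2 hae, energy_eq_ofReal hFc hFS lam ht.1]
  have hY0 : ∀ t ∈ Icc 0 T, 0 ≤ Y t := fun t ht =>
    intervalIntegral.integral_nonneg ht.1 fun θ _ => by positivity
  have hm : profNorm 0 b h < ⊤ := hh.trans_lt hg
  have hmε : (profNorm 0 b h).toReal ≤ c / (8 * (A.toReal + 1)) :=
    ENNReal.toReal_le_of_le_ofReal (by positivity) hhε
  have hmc : 4 * A.toReal * (profNorm 0 b h).toReal < c := by
    calc _ ≤ 4 * A.toReal * (c / (8 * (A.toReal + 1))) := by gcongr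
      _ < c := by
        rw [mul_div_assoc', div_lt_iff₀ (by positivity)]
        nlinarith
  have he1 : ∀ t ∈ Icc 0 T, Y t ≤ c → ∀ θ ∈ Icc 0 t, ‖e θ‖ ≤ 1 := fun t ht hle θ hθ =>
    (he.mono ht.2).norm_le_one hlam ht.2 hθ (min_le_right _ _)
      ((hYe t ht).trans_le (ENNReal.ofReal_le_ofReal hle))
  have hstep : ∀ t ∈ Icc 0 T, Y t ≤ c → Y t ≤ 4 * A.toReal * (profNorm 0 b h).toReal := by
    intro t ht hle
    refine le_four_mul_of_quadratic hA hB hD hm (by positivity) hBL (hY0 t ht) hle hDc ?_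
    rw [← hYe t ht]
    refine energy_le_of_split hb hlam ht.2 hv hg hq hh hec (he.mono ht.2) ?_
    filter_upwards [ae_restrict_of_ae_restrict_of_subset (Icc_subset_Icc_right ht.2) hae,
      ae_restrict_mem measurableSet_Icc] with θ h1 hθ
    rw [h1]
    exact hF θ ⟨hθ.1, hθ.2.trans ht.2⟩ (he1 t ht hle θ hθ)
  have hfinal := le_of_bootstrap hYc
    (by simp only [Y, intervalIntegral.integral_same]; exact hc.le) hmc hstep
  have hTT : T ∈ Icc 0 T := ⟨hT.le, le_rfl⟩
  refine ⟨?_, he1 T hTT ((hfinal T hTT).trans hmc.le)⟩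
  rw [← energy_congr le_rfl hae, hYe T hTT]
  refine (ENNReal.ofReal_le_ofReal (hfinal T hTT)).trans ?_
  rw [ENNReal.ofReal_mul (by positivity), ENNReal.ofReal_toReal hm.ne]

lemma lintegral_sqNorm_le_energy {lam T : ℝ} (hlam : 0 < lam) (F : ℝ → ℤ → ℂ) :
    ∫⁻ θ in Icc 0 T, sqNorm (F θ) ≤ ENNReal.ofReal (Real.exp (2 * lam * T)) * energy lam T F := by
  rw [energy, ← lintegral_const_mul' _ _ ENNReal.ofReal_ne_top]
  refine setLIntegral_mono' measurableSet_Icc fun θ hθ => ?_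
  rw [← mul_assoc, ← ENNReal.ofReal_mul (Real.exp_pos _).le, ← Real.exp_add]
  refine le_mul_of_one_le_left' ?_
  rw [ENNReal.one_le_ofReal]
  refine Real.one_le_exp ?_
  nlinarith [hθ.2]

lemma continuous_radialCut {R : ℝ} (hR : 0 < R) : Continuous (radialCut R : L2 → L2) :=
  (LipschitzWith.of_dist_le' (K := 2) fun f g => by
    rw [dist_eq_norm, dist_eq_norm]; exact norm_radialCut_sub_le hR f g).continuous

/-! ### The projected equation -/

lemma norm_proj_le {τ : ℝ} (hτ : 0 < τ) (f : L2) : ‖proj τ f‖ ≤ ‖f‖ := by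
  rw [← ENNReal.ofReal_le_ofReal_iff (norm_nonneg _), ofReal_norm, ofReal_norm,
    ← ENNReal.pow_le_pow_left_iff two_ne_zero, enorm_sq_eq_sqNorm, enorm_sq_eq_sqNorm]
  refine sqNorm_mono fun k => ?_
  rw [fourierCoeff_proj hτ, enorm_mul]
  refine mul_le_of_le_one_left' ?_
  rw [← ofReal_norm, ENNReal.ofReal_le_one]
  exact norm_cutoff_le τ k

lemma integral_exp_mul_eq_duhamel (F : ℝ → ℤ → ℂ) (t : ℝ) (k : ℤ) :
    ∫ θ in (0 : ℝ)..t, Complex.exp (Complex.I * (t - θ) * omega k) * F θ k = duhamel F t k := by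
  rw [duhamel, ← intervalIntegral.integral_const_mul]
  refine intervalIntegral.integral_congr fun θ _ => ?_
  rw [← mul_assoc, ← Complex.exp_add]
  congr 2
  ring

/-- The projected difference of the forcing terms along two functions. -/
def forcingError (τ : ℝ) (v w : ℝ → L2) (θ : ℝ) (k : ℤ) : ℂ :=
  cutoff τ k * (forcing (v θ) k - forcing (w θ) k)

lemma continuous_forcingError (τ : ℝ) {v w : ℝ → L2} (hv : Continuous v) (hw : Continuous w)
    (k : ℤ) : Continuous fun θ => forcingError τ v w θ k :=
  continuous_const.mul (((continuous_forcing k).comp hv).sub ((continuous_forcing k).comp hw))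

lemma sqNorm_forcingError_le (τ : ℝ) {v w : ℝ → L2} {θ : ℝ} {q e : L2} (h : v θ - w θ = q + e) :
    sqNorm (forcingError τ v w θ) ≤ 4 * ‖q‖ₑ ^ 2 + 4 * ‖e‖ₑ ^ 2 +
      32 * (pair (v θ) q + pair (v θ) e + pair q q + pair e e) := by
  refine (sqNorm_mono fun k => ?_).trans (sqNorm_forcing_sub_le_of_eq h)
  rw [forcingError, enorm_mul]
  refine mul_le_of_le_one_left' ?_
  rw [← ofReal_norm, ENNReal.ofReal_le_one]
  exact norm_cutoff_le τ k

lemma fourierCoeff_proj_sub {τ T t : ℝ} (hτ : 0 < τ) (ht : t ∈ Icc 0 T) {u₀ : L2}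
    {v w w' : ℝ → L2} (hv : IsMildSolution forcing u₀ T v)
    (hw' : ∀ k, Continuous fun θ => forcing (w' θ) k) {k : ℤ}
    (hw : fourierCoeff (w t) k = Complex.exp (Complex.I * t * omega k) * fourierCoeff (proj τ u₀) k
      + ∫ θ in (0 : ℝ)..t, Complex.exp (Complex.I * (t - θ) * omega k) *
        (cutoff τ k * forcing (w' θ) k)) :
    fourierCoeff (proj τ (v t) - w t : L2) k =
      ∫ θ in (0 : ℝ)..t, Complex.exp (Complex.I * (t - θ) * omega k) * forcingError τ v w' θ k := by
  have hi1 := (integrable_exp_duhamel (w := omega k) ht (hv k).1).const_mul (cutoff τ k)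
  have hi2 := (integrable_exp_duhamel (w := omega k) ht
    ((hw' k).intervalIntegrable (μ := volume) 0 T)).const_mul (cutoff τ k)
  rw [fourierCoeff_sub, fourierCoeff_proj hτ, hw, (hv k).2 t ht, fourierCoeff_proj hτ]
  have e1 : ∀ θ : ℝ, Complex.exp (Complex.I * (t - θ) * omega k) * forcingError τ v w' θ k =
      cutoff τ k * (Complex.exp (Complex.I * (t - θ) * omega k) * forcing (v θ) k) -
      cutoff τ k * (Complex.exp (Complex.I * (t - θ) * omega k) * forcing (w' θ) k) := fun θ => by
    rw [forcingError]; ring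
  have e2 : ∀ θ : ℝ, Complex.exp (Complex.I * (t - θ) * omega k) *
      (cutoff τ k * forcing (w' θ) k) =
      cutoff τ k * (Complex.exp (Complex.I * (t - θ) * omega k) * forcing (w' θ) k) := fun θ => by
    ring
  simp only [e1, e2]
  rw [intervalIntegral.integral_sub hi1 hi2, intervalIntegral.integral_const_mul,
    intervalIntegral.integral_const_mul]
  ring

lemma IsMildSolution.congr {N : L2 → ℤ → ℂ} {u₀ : L2} {T : ℝ} {u v : ℝ → L2} (hT : 0 ≤ T)
    (h : IsMildSolution N u₀ T u) (hv : EqOn v u (Icc 0 T)) : IsMildSolution N u₀ T v := by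
  intro k
  refine ⟨(h k).1.congr fun θ hθ => ?_, fun t ht => ?_⟩
  · rw [uIoc_of_le hT] at hθ
    simp only [hv ⟨hθ.1.le, hθ.2⟩]
  · rw [hv ht, (h k).2 t ht]
    congr 1
    refine intervalIntegral.integral_congr fun θ hθ => ?_
    rw [uIcc_of_le ht.1] at hθ
    simp only [hv ⟨hθ.1, hθ.2.trans ht.2⟩]

lemma isMildSolution_projForcing {τ T : ℝ} (hτ : 0 < τ) (hT : 0 ≤ T) {u₀ : L2} {w w' : ℝ → L2}
    (hw : Continuous w) (hww : EqOn w' w (Icc 0 T)) (hproj : ∀ t ∈ Icc 0 T, proj τ (w t) = w t)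
    (h : ∀ t ∈ Icc 0 T, ∀ k, fourierCoeff (w t) k =
      Complex.exp (Complex.I * t * omega k) * fourierCoeff (proj τ u₀) k
        + ∫ θ in (0 : ℝ)..t, Complex.exp (Complex.I * (t - θ) * omega k) *
          (cutoff τ k * forcing (w' θ) k)) :
    IsMildSolution (projForcing τ) (proj τ u₀) T w := by
  have e : ∀ θ ∈ Icc 0 T, ∀ k, projForcing τ (w θ) k = cutoff τ k * forcing (w θ) k :=
    fun θ hθ k => by rw [projForcing_eq hτ, hproj θ hθ]
  intro k
  have hc : Continuous fun θ => cutoff τ k * forcing (w θ) k :=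
    continuous_const.mul ((continuous_forcing k).comp hw)
  refine ⟨(hc.intervalIntegrable 0 T).congr fun θ hθ => ?_, fun t ht => ?_⟩
  · rw [uIoc_of_le hT] at hθ
    exact (e θ ⟨hθ.1.le, hθ.2⟩ k).symm
  · rw [h t ht k]
    congr 1
    refine intervalIntegral.integral_congr fun θ hθ => ?_
    rw [uIcc_of_le ht.1] at hθ
    have hθ' : θ ∈ Icc 0 T := ⟨hθ.1, hθ.2.trans ht.2⟩
    simp only [e θ hθ', hww hθ']

lemma exists_bound_of_profile {b : ℝ} (hb : 1 / 2 < b) {v : ℝ → L2} {g : ℝ → ℤ → ℂ}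
    (hv : IsProfile v g) (hg : profNorm 0 b g < ⊤) : ∃ U : ℝ, 0 < U ∧ ∀ t, ‖v t‖ ≤ U := by
  have hfin := ENNReal.mul_lt_top (weightConst_lt_top hb) hg
  refine ⟨(weightConst b * profNorm 0 b g).toReal + 1,
    add_pos_of_nonneg_of_pos ENNReal.toReal_nonneg one_pos, fun t => ?_⟩
  have h := hv.enorm_sq_le b t
  rw [← ENNReal.ofReal_toReal hfin.ne, ← ofReal_norm, ← ENNReal.ofReal_pow (norm_nonneg _),
    ENNReal.ofReal_le_ofReal_iff ENNReal.toReal_nonneg] at h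
  nlinarith [sq_nonneg (‖v t‖ - 1)]

/-- The projected equation has a solution on `[0,T]` for small `τ`, with an error controlled by the
high frequencies of the solution of the equation. -/
lemma exists_isProjSolution {s b T : ℝ} (hb : 1 / 2 < b) (hb1 : b ≤ 1) (hs : 0 ≤ s) (hT : 0 < T)
    {u₀ : L2} {v : ℝ → L2} {g : ℝ → ℤ → ℂ} (hv : IsProfile v g) (hg : profNorm s b g < ⊤)
    (hmild : IsMildSolution forcing u₀ T v) :
    ∃ κ τ₀ : ℝ, 0 ≤ κ ∧ 0 < τ₀ ∧ ∀ τ, 0 < τ → τ ≤ τ₀ → ∃ w : ℝ → L2,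
      IsProjSolution s b τ u₀ T w ∧ localBourgainENorm 0 b T (fun t => v t - w t) ^ 2 ≤
        ENNReal.ofReal κ * profNorm 0 b (fun σ k => (1 - cutoff τ k) * g σ k) := by
  have hg0 : profNorm 0 b g < ⊤ := (profNorm_mono hs b g).trans_lt hg
  have hvc := hv.continuous hb hg0
  obtain ⟨lam, a, ε, hlam, ha, hε, hboot⟩ := exists_energy_bootstrap hb hT hv hg0
  obtain ⟨τ₀, hτ₀, hsmall⟩ := exists_profNorm_highpass_le hg0 (ENNReal.ofReal_pos.mpr hε)
  obtain ⟨U, hU, hvU⟩ := exists_bound_of_profile hb hv hg0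
  -- As `‖Π_τ v‖ ≤ U`, an error of norm at most 1 keeps `w` inside the ball where the truncation is
  -- the identity.
  set R : ℝ := U + 1
  have hR : 0 < R := by positivity
  set κ : ℝ := (2 * Real.pi) ^ 2 *
    (2 + 2 * ((2 + 2 * T ^ 2) * (Real.exp (2 * lam * T) * a))) with hκ
  refine ⟨κ, τ₀, by positivity, hτ₀, fun τ hτ hle => ?_⟩
  have hcut : ∀ k, ‖cutoff τ k‖ₑ ≤ 1 := fun k => by
    rw [← ofReal_norm, ENNReal.ofReal_le_one]; exact norm_cutoff_le τ k
  have hcut' : ∀ k, ‖1 - cutoff τ k‖ₑ ≤ 1 := fun k => by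
    rcases cutoff_eq_zero_or_one τ k with h | h <;> simp [h]
  have hz : IsProfile (fun t => proj τ (v t)) (fun σ k => cutoff τ k * g σ k) :=
    hv.multiplier fun t k => fourierCoeff_proj hτ _ _
  have hq : IsProfile (fun t => v t - proj τ (v t)) (fun σ k => (1 - cutoff τ k) * g σ k) :=
    hv.multiplier fun t k => by rw [fourierCoeff_sub, fourierCoeff_proj hτ]; ring
  have hzc := hz.continuous hb ((profNorm_multiplier_le 0 b g hcut).trans_lt hg0)
  obtain ⟨w, hwc, hwp, hwk⟩ := exists_truncated_projForcing hτ hR hT u₀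
  set ρw : ℝ → L2 := fun θ => radialCut R (w θ)
  have hρc : Continuous ρw := (continuous_radialCut hR).comp hwc
  set F := forcingError τ v ρw
  have hFc : ∀ k, Continuous fun θ => F θ k := continuous_forcingError τ hvc hρc
  have hFS : ∀ θ, ∀ k ∉ freq τ, F θ k = 0 := fun θ k hk => by
    simp only [F, forcingError, cutoff_eq_zero hτ hk, zero_mul]
  have hek : ∀ t ∈ Icc 0 T, ∀ k, fourierCoeff (proj τ (v t) - w t : L2) k =
      ∫ θ in (0 : ℝ)..t, Complex.exp (Complex.I * (t - θ) * omega k) * F θ k := fun t ht k =>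
    fourierCoeff_proj_sub hτ ht hmild (fun k => (continuous_forcing k).comp hρc) (hwk t ht k)
  obtain ⟨F', hF', hae⟩ := exists_isDuhamel hT.le
    (fun k => (hFc k).intervalIntegrable 0 T) hek
  have hwR : ∀ t, ‖proj τ (v t) - w t‖ ≤ 1 → ‖w t‖ ≤ R := fun t h => by
    have h1 := norm_le_norm_add_norm_sub' (w t) (proj τ (v t))
    rw [norm_sub_rev] at h1
    have h2 := (norm_proj_le hτ (v t)).trans (hvU t)
    simp only [R]
    linarith
  have hρw : ∀ t, ‖proj τ (v t) - w t‖ ≤ 1 → ρw t = w t := fun t h =>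
    radialCut_of_le hR (hwR t h)
  obtain ⟨hen, he1⟩ := hboot (freq τ) _ (fun t => proj τ (v t) - w t) _ F F' hq
    (profNorm_multiplier_le 0 b g hcut')
    (hsmall τ hτ hle) (hzc.sub hwc) hF' hae hFc hFS fun θ _ hθ1 =>
      sqNorm_forcingError_le τ (by rw [hρw θ hθ1]; exact (sub_add_sub_cancel _ _ _).symm)
  have hww : EqOn ρw w (Icc 0 T) := fun t ht => hρw t (he1 t ht)
  -- The energy controls the source of `e` in `L²`, hence `e` in `X^{0,b}(T)`. Finitely many
  -- frequencies give membership in `X^{s,b}(T)` as well, so `w = Π_τ v - e` lies there.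
  obtain ⟨ve, ge, hve, hvek, hgeF, hge⟩ := exists_profile_duhamel hT hb1 hFc hFS
  have hve_eq : ∀ t ∈ Icc 0 T, ve t = proj τ (v t) - w t := fun t ht =>
    fourierCoeff_injective fun k => by rw [hvek t ht, hek t ht, integral_exp_mul_eq_duhamel]
  refine ⟨w, ⟨?_, isMildSolution_projForcing hτ hT.le hwc hww hwp hwk⟩, ?_⟩
  · refine (hz.sub hve).memLocalBourgain (fun t ht => ?_) (profNorm_sub_lt_top hz.measurable
      ((profNorm_multiplier_le s b g hcut).trans_lt hg) (hge s))
    simp only [hve_eq t ht]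
    abel
  · refine ((hq.add hve).localBourgainENorm_sq_le 0 b fun t ht => ?_).trans ?_
    · simp only [hve_eq t ht]
      abel
    set m := profNorm 0 b fun σ k => (1 - cutoff τ k) * g σ k
    calc _ ≤ ENNReal.ofReal ((2 * Real.pi) ^ 2) * (2 * m + 2 * profNorm 0 b ge) := by
          gcongr
          exact profNorm_add_le 0 b hq.measurable
      _ ≤ ENNReal.ofReal ((2 * Real.pi) ^ 2) * (2 * m + 2 * (ENNReal.ofReal (2 + 2 * T ^ 2) *
          (ENNReal.ofReal (Real.exp (2 * lam * T)) * (ENNReal.ofReal a * m)))) := by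
          gcongr
          refine hgeF.trans (mul_le_mul_right ?_ _)
          exact (lintegral_sqNorm_le_energy hlam F).trans (mul_le_mul_right hen _)
      _ = _ := by
          have hP : 0 ≤ 2 + 2 * T ^ 2 := by positivity
          rw [hκ]
          generalize 2 + 2 * T ^ 2 = P at hP
          rw [ENNReal.ofReal_mul (by positivity), ENNReal.ofReal_add (by positivity)
            (by positivity), ENNReal.ofReal_mul zero_le_two, ENNReal.ofReal_mul hP,
            ENNReal.ofReal_mul (Real.exp_pos _).le, ENNReal.ofReal_ofNat]
          ring

/-! ### Assembly of the theorem -/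

/-- The maximal time is a supremum, so some solution lives on a longer interval and is restricted.
-/
lemma exists_isSolution_of_lt_maximalTime {s b T : ℝ} {u₀ : L2} (hT : 0 < T)
    (h : ENNReal.ofReal T < maximalTime s b u₀) : ∃ u, IsSolution s b u₀ T u := by
  simp only [maximalTime, lt_iSup_iff] at h
  obtain ⟨T', ⟨hT', u, hu⟩, hlt⟩ := h
  have hle : T ≤ T' := (ENNReal.ofReal_le_ofReal_iff hT'.le).mp hlt.le
  exact ⟨u, hu.1.mono_T hle, hu.2.mono hT.le hle⟩

end GoodBoussinesq

end

theorem mainTheorem2 (b : ℝ) (hb : b ∈ Set.Ioo (1 / 2 : ℝ) 1) :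
    ∃ K : ℝ, 0 < K ∧ ∀ s : ℝ, 0 ≤ s →
      (∀ T : ℝ, 0 < T → ∀ v : ℝ → GoodBoussinesq.L2,
        GoodBoussinesq.MemLocalBourgain s b T v → GoodBoussinesq.ContinuousInSobolev s T v) ∧
      ∀ u₀ : GoodBoussinesq.L2, GoodBoussinesq.MemSobolev s u₀ →
      ∀ T : ℝ, 0 < T → ENNReal.ofReal T < GoodBoussinesq.maximalTime s b u₀ →
      ∃ u : ℝ → GoodBoussinesq.L2, GoodBoussinesq.IsSolution s b u₀ T u ∧
        (∀ w : ℝ → GoodBoussinesq.L2, GoodBoussinesq.IsSolution s b u₀ T w →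
          Set.EqOn w u (Set.Icc 0 T)) ∧
        ∃ τ₀ : ℝ, 0 < τ₀ ∧ ∃ C : ℝ, 0 < C ∧ ∀ τ : ℝ, 0 < τ → τ ≤ τ₀ →
          ∃ uτ : ℝ → GoodBoussinesq.L2,
            GoodBoussinesq.IsProjSolution s b τ u₀ T uτ ∧
            (∀ w : ℝ → GoodBoussinesq.L2, GoodBoussinesq.IsProjSolution s b τ u₀ T w →
              Set.EqOn w uτ (Set.Icc 0 T)) ∧
            MeasureTheory.eLpNorm (fun t => u t - uτ t) ⊤
                (MeasureTheory.volume.restrict (Set.Icc 0 T)) ≤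
              ENNReal.ofReal K *
                GoodBoussinesq.localBourgainENorm 0 b T (fun t => u t - uτ t) ∧
            GoodBoussinesq.localBourgainENorm 0 b T (fun t => u t - uτ t) ≤
              ENNReal.ofReal (C * τ ^ (s / 2)) := by
  obtain ⟨K, hK, hKle⟩ := GoodBoussinesq.exists_enorm_le_localBourgainENorm hb.1
  refine ⟨K, hK, fun s hs =>
    ⟨fun T _ v hv => GoodBoussinesq.continuousInSobolev_of_memLocalBourgain hb.1 hv,
      fun u₀ _ T hT hlt => ?_⟩⟩
  obtain ⟨u, hu⟩ := GoodBoussinesq.exists_isSolution_of_lt_maximalTime hT hlt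
  obtain ⟨v, g, hvu, hg, hfin⟩ := hu.1.exists_profile
  obtain ⟨κ, τ₀, hκ, hτ₀, hproj⟩ := GoodBoussinesq.exists_isProjSolution hb.1 hb.2.le hs hT hg hfin
    (hu.2.congr hT.le hvu)
  have hv : GoodBoussinesq.IsSolution s b u₀ T v :=
    ⟨hg.memLocalBourgain (Set.eqOn_refl _ _) hfin, hu.2.congr hT.le hvu⟩
  set G := (GoodBoussinesq.profNorm s b g).toReal
  have hG : 0 ≤ G := ENNReal.toReal_nonneg
  -- The chosen solution is the extension `v` with finite `X^{s,b}` norm on the whole line. The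
  -- constant satisfies `κG ≤ (κG + 1)²`, which avoids a square root and is positive when `κG = 0`.
  refine ⟨v, hv, fun w hw => hv.eqOn hb.1 hs hT hw, τ₀, hτ₀, κ * G + 1, by positivity,
    fun τ hτ hle => ?_⟩
  obtain ⟨w, hw, hwle⟩ := hproj τ hτ hle
  refine ⟨w, hw, fun w' hw' => hw.eqOn hb.1 hs hτ hT hw', ?_, ?_⟩
  · rw [MeasureTheory.eLpNorm_exponent_top]
    refine MeasureTheory.eLpNormEssSup_le_of_ae_enorm_bound ?_
    filter_upwards [MeasureTheory.ae_restrict_mem measurableSet_Icc] with t ht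
    exact hKle T (fun t => v t - w t) t ht
  · rw [← ENNReal.pow_le_pow_left_iff two_ne_zero, ← ENNReal.ofReal_pow (by positivity)]
    refine (hwle.trans (mul_le_mul_right (GoodBoussinesq.profNorm_highpass_le hτ hs b g) _)).trans ?_
    rw [← ENNReal.ofReal_toReal hfin.ne, ← ENNReal.ofReal_mul (by positivity),
      ← ENNReal.ofReal_mul hκ]
    refine ENNReal.ofReal_le_ofReal ?_
    rw [mul_pow, ← Real.rpow_mul_natCast hτ.le]
    norm_num
    have h1 : 0 ≤ τ ^ s := by positivity
    have h2 : κ * G ≤ (κ * G + 1) ^ 2 := by nlinarith [mul_nonneg hκ hG]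
    calc κ * (τ ^ s * G) = κ * G * τ ^ s := by ring
      _ ≤ _ := by gcongr
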